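/- **Setting.** A *localisation datum* $(Z=U_0\cup U_1,\ 1=\eta_0+(1-\eta_0),\ S,\ L,\ h)$ consists of the following. - $Z$ is a complete Riemannian manifold (second countable, without boundary) and $S$ a smooth hermitian vector bundle on $Z$. The space $L^2(Z;S)$ is taken with respect to the Riemannian volume measure, and $C_c^\infty(Z;S)$ is the space of compactly supported smooth sections. - $Z=U_0\cup U_1$ is an open covering and $1=\eta_0+(1-\eta_0)$ is a smooth partition of unity subordinate to it: $\eta_0\colon Z\to[0,1]$ is smooth, $\operatorname{supp}\eta_0\subset U_0$ and $\operatorname{supp}(1-\eta_0)\subset U_1$. - $L\colon C_c^\infty(Z;S)\to C_c^\infty(Z;S)$ is a first-order elliptic differential operator that is essentially self-adjoint on $L^2(Z;S)$. Its symbol $\sigma_L$ is normalised by $L(f\Phi)=f\,L\Phi+\sigma_L(df)\Phi$, and the pointwise operator norm $|\sigma_L(d\eta_0)|$ is bounded on $U_0\cap U_1$. - $h$ is a measurable self-adjoint endomorphism of $S$ with uniformly bounded eigenvalues. On $U_1$ it is smooth and anti-commutes with $L$, and the eigenvalues of $h^2$ are at least $1$ there. For $m>0$ put $L_m:=L+mh$.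 It is essentially self-adjoint on $C_c^\infty(Z;S)$, and its spectrum is the spectrum of its closure. The *discrete spectrum* consists of the isolated points of the spectrum that are eigenvalues of finite multiplicity. **Proposition.** Let $(Z=U_0\cup U_1,\eta_0,S,L,h)$ and $(Z'=U_0'\cup U_1',\eta_0',S',L',h')$ be two localisation data. Assume that $L$ and $L'$ coincide on $U_0\cong U_0'$: there is a Riemannian isometry $\tau\colon U_0\to U_0'$ covered by a bundle isometry $\tilde\tau\colon S|_{U_0}\to S'|_{U_0'}$ such that $\tilde\tau^{-1}\circ L'_m\circ\tilde\tau=L_m$ on sections supported in $U_0$. Then there is a constant $C>0$ that depends only on $\eta_0,\eta_0',\sigma_L,\sigma_{L'}$ such that the following holds for all $\Lambda_2>\Lambda_1>\Lambda_0\ge 0$ and $m>0$ (the coincidence above is needed only for this $m$). If $L_m$ has only discrete spectrum in $[-\Lambda_0,\Lambda_0]$, if $$\operatorname{spec}(L_m)\cap\big([-\Lambda_2,-\Lambda_0)\cup(\Lambda_0,\Lambda_2]\big)=\emptyset,$$ and if $$m^2>\max\left\{\frac{(C^2+\Lambda_2^2)(C^2+\Lambda_1^2)}{\Lambda_2^2-\Lambda_1^2},\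 \frac{(C^2+\Lambda_1^2)(C^2+\Lambda_0^2)}{\Lambda_1^2-\Lambda_0^2},\ C^2+\Lambda_2^2\right\},$$ then $L'_m$ has only discrete spectrum in $[-\Lambda_1,\Lambda_1]$, and the number of eigenvalues of $L'_m$ in $[-\Lambda_1,\Lambda_1]$, counted with multiplicity, equals the number of eigenvalues of $L_m$ in $[-\Lambda_0,\Lambda_0]$, counted with multiplicity. -/

import Mathlib

open Set MeasureTheory Bundle
open scoped Manifold ContDiff Topology

noncomputable section

/-! ### Hermitian vector bundles and their sections -/

section Sections

variable {E : Type*} [NormedAddCommGroup E] [NormedSpace ℝ E]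
  {Z : Type*} [EMetricSpace Z] [ChartedSpace E Z]
  (F : Type*) [NormedAddCommGroup F] [NormedSpace ℂ F]
  (S : Z → Type*) [TopologicalSpace (TotalSpace F S)]
  [∀ x, NormedAddCommGroup (S x)] [∀ x, InnerProductSpace ℂ (S x)] [FiberBundle F S]

/-- The section `s` of `S` is smooth on the set `U`. -/
def SmoothSectionOn (s : ∀ x, S x) (U : Set Z) : Prop :=
  ContMDiffOn 𝓘(ℝ, E) (𝓘(ℝ, E).prod 𝓘(ℝ, F)) ∞ (fun x => TotalSpace.mk' F x (s x)) U

/-- The hermitian inner products on the fibres depend smoothly on the base point: the inner product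
of any two smooth local sections is a smooth function. -/
class IsSmoothHermitianBundle : Prop where
  contMDiffOn_inner : ∀ (U : Set Z), IsOpen U → ∀ s t : ∀ x, S x,
    SmoothSectionOn (E := E) F S s U → SmoothSectionOn (E := E) F S t U →
    ContMDiffOn 𝓘(ℝ, E) 𝓘(ℝ, ℂ) ∞ (fun x => (inner ℂ (s x) (t x) : ℂ)) U

variable {S} in
/-- The support of a section. -/
def sectionSupport (s : ∀ x, S x) : Set Z := closure {x | s x ≠ 0}

variable [VectorBundle ℂ F S] [VectorBundle ℝ F S]

/-- `C_c^∞(Z; S)`: the complex vector space of compactly supported smooth sections of `S`. -/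
def SmoothCompactSections : Submodule ℂ (∀ x, S x) where
  carrier := {s | SmoothSectionOn (E := E) F S s univ ∧ IsCompact (sectionSupport s)}
  add_mem' := by
    rintro s t ⟨hs, hs'⟩ ⟨ht, ht'⟩
    refine ⟨ContMDiffOn.add_section hs ht, (hs'.union ht').of_isClosed_subset isClosed_closure ?_⟩
    unfold sectionSupport
    rw [← closure_union]
    refine closure_mono fun x hx => ?_
    by_contra hc
    simp only [mem_union, mem_ofPred_eq, not_or, not_not] at hc
    exact hx (by simp [hc.1, hc.2])
  zero_mem' := by
    refine ⟨(contMDiff_zeroSection ℝ S).contMDiffOn, ?_⟩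
    simp [sectionSupport]
  smul_mem' := by
    rintro c s ⟨hs, hs'⟩
    constructor
    · intro x hx
      have h := hs x hx
      rw [contMDiffWithinAt_section] at h ⊢
      have h2 : ContMDiffWithinAt 𝓘(ℝ, E) 𝓘(ℝ, F) ∞
          (fun y => c • (trivializationAt F S x ⟨y, s y⟩).2) univ x :=
        ((contDiff_const_smul c).contMDiff.contMDiffAt).comp_contMDiffWithinAt x h
      refine h2.congr_of_eventuallyEq ?_ ?_
      · have hb := (trivializationAt F S x).open_baseSet.mem_nhds
          (mem_baseSet_trivializationAt F S x)
        filter_upwards [mem_nhdsWithin_of_mem_nhds hb] with y hy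
        exact ((trivializationAt F S x).linear ℂ hy).2 c (s y)
      · exact ((trivializationAt F S x).linear ℂ (mem_baseSet_trivializationAt F S x)).2 c (s x)
    · refine hs'.of_isClosed_subset isClosed_closure (closure_mono fun x hx hc => hx ?_)
      simp [hc]

end Sections

/-! ### The Hilbert space of square-integrable sections -/

section L2

variable (E : Type*) [NormedAddCommGroup E] [NormedSpace ℝ E]
  {Z : Type*} [EMetricSpace Z] [MeasurableSpace Z] [BorelSpace Z]

/-- The Riemannian volume measure of a Riemannian manifold modelled on `E`: the Hausdorff measure of
dimension `dim E` of the Riemannian distance, normalised so that it is the Lebesgue measure on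
Euclidean space. -/
def riemannianVolume : Measure Z := μHE[Module.finrank ℝ E]

variable (F : Type*) [NormedAddCommGroup F] [NormedSpace ℂ F]
  (S : Z → Type*) [TopologicalSpace (TotalSpace F S)]
  [∀ x, NormedAddCommGroup (S x)] [∀ x, InnerProductSpace ℂ (S x)] [FiberBundle F S]

/-- The section `s` is measurable (up to a null set): its coordinates in all the local
trivialisations of the bundle are. -/
def MeasurableSection (s : ∀ x, S x) : Prop :=
  ∀ (e : Trivialization F (π F S)) [MemTrivializationAtlas e],
    AEStronglyMeasurable (fun x => (e ⟨x, s x⟩).2) ((riemannianVolume E).restrict e.baseSet)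

variable [VectorBundle ℂ F S]

variable {E F S} in
theorem MeasurableSection.add {s t : ∀ x, S x} (hs : MeasurableSection E F S s)
    (ht : MeasurableSection E F S t) : MeasurableSection E F S (s + t) := by
  intro e he
  refine ((hs e).add (ht e)).congr ?_
  filter_upwards [ae_restrict_mem e.open_baseSet.measurableSet] with x hx
  exact ((e.linear ℂ hx).1 (s x) (t x)).symm

variable {E F S} in
theorem MeasurableSection.smul {s : ∀ x, S x} (c : ℂ) (hs : MeasurableSection E F S s) :
    MeasurableSection E F S (c • s) := by
  intro e he
  refine ((hs e).const_smul c).congr ?_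
  filter_upwards [ae_restrict_mem e.open_baseSet.measurableSet] with x hx
  exact ((e.linear ℂ hx).2 c (s x)).symm

variable [ChartedSpace E Z] [SecondCountableTopology Z] [FiniteDimensional ℂ F] [VectorBundle ℝ F S]
  [ContMDiffVectorBundle ∞ F S 𝓘(ℝ, E)] [IsSmoothHermitianBundle (E := E) F S]

variable {E F S} in
theorem MeasurableSection.aestronglyMeasurable_inner {s t : ∀ x, S x} (hs : MeasurableSection E F S s)
    (ht : MeasurableSection E F S t) :
    AEStronglyMeasurable (fun x => (inner ℂ (s x) (t x) : ℂ)) (riemannianVolume E : Measure Z) := by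
  obtain ⟨c, hc, hcov⟩ := TopologicalSpace.countable_cover_nhds
    (f := fun x : Z => (trivializationAt F S x).baseSet)
    (fun x => (trivializationAt F S x).open_baseSet.mem_nhds (mem_baseSet_trivializationAt F S x))
  have := hc.to_subtype
  rw [← Measure.restrict_univ (μ := riemannianVolume E), ← hcov, biUnion_eq_iUnion,
    aestronglyMeasurable_iUnion_iff]
  rintro ⟨y, _⟩
  set e := trivializationAt F S y with he
  have : FiniteDimensional ℝ F := FiniteDimensional.complexToReal F
  let b := Module.finBasis ℝ F
  have hfr : ∀ i, SmoothSectionOn (E := E) F S (e.localFrame b i) e.baseSet := fun i =>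
    e.contMDiffOn_localFrame_baseSet (I := 𝓘(ℝ, E)) (n := ∞) b i
  have hG : ∀ i j, AEStronglyMeasurable
      (fun x => (inner ℂ (e.localFrame b i x) (e.localFrame b j x) : ℂ))
      ((riemannianVolume E).restrict e.baseSet) := fun i j =>
    ((IsSmoothHermitianBundle.contMDiffOn_inner (E := E) (F := F) e.baseSet e.open_baseSet _ _
      (hfr i) (hfr j)).continuousOn).aestronglyMeasurable e.open_baseSet.measurableSet
  have hco : ∀ {u : ∀ x, S x}, MeasurableSection E F S u → ∀ i, AEStronglyMeasurable
      (fun x => ((b.repr (e ⟨x, u x⟩).2 i : ℝ) : ℂ)) ((riemannianVolume E).restrict e.baseSet) := by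
    intro u hu i
    have hcont : Continuous fun v : F => ((b.repr v i : ℝ) : ℂ) :=
      Complex.continuous_ofReal.comp (LinearMap.continuous_of_finiteDimensional (b.coord i))
    exact hcont.comp_aestronglyMeasurable (hu e)
  have hsum : AEStronglyMeasurable (fun x => ∑ i, ∑ j,
      (starRingEnd ℂ) ((b.repr (e ⟨x, s x⟩).2 i : ℝ) : ℂ) * (((b.repr (e ⟨x, t x⟩).2 j : ℝ) : ℂ) *
        (inner ℂ (e.localFrame b i x) (e.localFrame b j x) : ℂ)))
      ((riemannianVolume E).restrict e.baseSet) := by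
    refine Finset.aestronglyMeasurable_fun_sum _ fun i _ =>
      Finset.aestronglyMeasurable_fun_sum _ fun j _ => ?_
    exact (Complex.continuous_conj.comp_aestronglyMeasurable (hco hs i)).mul
      ((hco ht j).mul (hG i j))
  refine hsum.congr ?_
  filter_upwards [ae_restrict_mem e.open_baseSet.measurableSet] with x hx
  have key : ∀ u : ∀ x, S x,
      u x = ∑ i, ((b.repr (e ⟨x, u x⟩).2 i : ℝ) : ℂ) • e.localFrame b i x := by
    intro u
    have h1 := ((e.basisAt b hx).sum_repr (u x)).symm
    rw [h1]
    conv_rhs => rw [← h1]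
    refine Finset.sum_congr rfl fun i _ => ?_
    rw [e.localFrame_apply_of_mem_baseSet b hx, Complex.coe_smul]
    congr 1
  conv_rhs => rw [key s, key t]
  simp only [sum_inner, inner_sum, inner_smul_left, inner_smul_right, Finset.mul_sum]
  rw [Finset.sum_comm]
  refine Finset.sum_congr rfl fun i _ => Finset.sum_congr rfl fun j _ => ?_
  ring

variable {E F S} in
theorem MeasurableSection.aestronglyMeasurable_norm {s : ∀ x, S x} (hs : MeasurableSection E F S s) :
    AEStronglyMeasurable (fun x => ‖s x‖) (riemannianVolume E : Measure Z) := by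
  have h := hs.aestronglyMeasurable_inner hs
  have h2 : (fun x => ‖s x‖) = fun x => √(Complex.re (inner ℂ (s x) (s x))) := by
    funext x
    exact norm_eq_sqrt_re_inner (𝕜 := ℂ) (s x)
  rw [h2]
  exact (Real.continuous_sqrt.comp Complex.continuous_re).comp_aestronglyMeasurable h

/-- The complex vector space of square-integrable measurable sections of `S`. -/
def squareIntegrableSections : Submodule ℂ (∀ x, S x) where
  carrier := {s | MeasurableSection E F S s ∧
    MemLp (fun x => ‖s x‖) 2 (riemannianVolume E : Measure Z)}
  add_mem' := by
    rintro s t ⟨hs, hs'⟩ ⟨ht, ht'⟩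
    refine ⟨hs.add ht, (hs'.add ht').mono (hs.add ht).aestronglyMeasurable_norm (ae_of_all _ fun x => ?_)⟩
    simp only [Pi.add_apply, norm_norm]
    exact (norm_add_le _ _).trans (le_abs_self _)
  zero_mem' := by
    refine ⟨?_, by simp⟩
    have h : (0 : ∀ x, S x) = (0 : ℂ) • (0 : ∀ x, S x) := by simp
    intro e he
    refine (aestronglyMeasurable_const (b := (0 : F))).congr ?_
    filter_upwards [ae_restrict_mem e.open_baseSet.measurableSet] with x hx
    exact ((e.linear ℂ hx).map_zero).symm
  smul_mem' := by
    rintro c s ⟨hs, hs'⟩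
    refine ⟨hs.smul c, ?_⟩
    simpa [norm_smul] using hs'.const_mul ‖c‖

/-- The space `squareIntegrableSections`, as a type that carries the `L²` semi-inner product. -/
def L2Section : Type _ := squareIntegrableSections E F S

variable {E F S} in
/-- The underlying section. -/
def L2Section.toSection (u : L2Section E F S) : ∀ x, S x := u.1

instance : AddCommGroup (L2Section E F S) :=
  inferInstanceAs (AddCommGroup (squareIntegrableSections E F S))

instance : Module ℂ (L2Section E F S) :=
  inferInstanceAs (Module ℂ (squareIntegrableSections E F S))

variable {E F S} in
theorem L2Section.integrable_inner (u v : L2Section E F S) :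
    Integrable (fun x => (inner ℂ (u.toSection x) (v.toSection x) : ℂ))
      (riemannianVolume E : Measure Z) := by
  have h := MemLp.integrable_mul u.2.2 v.2.2
  refine h.mono (u.2.1.aestronglyMeasurable_inner v.2.1) (ae_of_all _ fun x => ?_)
  refine (norm_inner_le_norm _ _).trans ?_
  simp only [Pi.mul_apply, norm_mul, norm_norm]
  exact le_rfl

/-- The `L²` inner product `⟪u, v⟫ = ∫ ⟪u(x), v(x)⟫ dvol(x)`. -/
@[reducible]
def L2Section.core : PreInnerProductSpace.Core ℂ (L2Section E F S) where
  inner u v := ∫ x, (inner ℂ (u.toSection x) (v.toSection x) : ℂ) ∂(riemannianVolume E : Measure Z)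
  conj_inner_symm u v := by
    rw [← integral_conj]
    exact integral_congr_ae (ae_of_all _ fun x => inner_conj_symm _ _)
  re_inner_nonneg u := by
    have h := integral_re (u.integrable_inner u)
    simp only [RCLike.re_to_complex] at h ⊢
    rw [← h]
    exact integral_nonneg fun x => inner_self_nonneg (𝕜 := ℂ)
  add_left u v w := by
    rw [← integral_add (u.integrable_inner w) (v.integrable_inner w)]
    exact integral_congr_ae (ae_of_all _ fun x => inner_add_left _ _ _)
  smul_left u v c := by
    rw [← integral_const_mul]
    exact integral_congr_ae (ae_of_all _ fun x => inner_smul_left _ _ _)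

instance : SeminormedAddCommGroup (L2Section E F S) :=
  InnerProductSpace.Core.toSeminormedAddCommGroup (c := L2Section.core E F S)

instance : InnerProductSpace ℂ (L2Section E F S) :=
  InnerProductSpace.ofCore (L2Section.core E F S)

/-- The Hilbert space `L²(Z; S)`, as the Hausdorff completion of the space of square-integrable
sections with its `L²` seminorm. As that space is complete (Riesz-Fischer), the completion does
nothing but identify the sections that agree almost everywhere. -/
abbrev L2Space : Type _ := UniformSpace.Completion (L2Section E F S)

end L2

/-! ### Unbounded operators, given by their graphs -/

section Spectral

variable {H : Type*} [NormedAddCommGroup H] [InnerProductSpace ℂ H]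

/-- The operator with graph `G` is essentially self-adjoint: it is densely defined and its closure
is its adjoint. -/
def IsEssentiallySelfAdjoint (G : Submodule ℂ (H × H)) : Prop :=
  Dense {u : H | ∃ w, (u, w) ∈ G} ∧ G.topologicalClosure = G.adjoint

/-- The spectrum of the closed operator with graph `A`: the complement of the set of the `z` such
that `A - z` is a bijection from the domain of `A` onto `H` with bounded inverse `R`. -/
def graphSpectrum (A : Submodule ℂ (H × H)) : Set ℂ :=
  {z | ∃ R : H →L[ℂ] H, ∀ u w : H, (u, w) ∈ A ↔ R (w - z • u) = u}ᶜ

/-- The eigenspace of the operator with graph `A` for the eigenvalue `z`. -/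
def graphEigenspace (A : Submodule ℂ (H × H)) (z : ℂ) : Submodule ℂ H :=
  A.comap (LinearMap.prod LinearMap.id (z • LinearMap.id))

/-- The point `z` belongs to the discrete spectrum: it is an isolated point of the spectrum and an
eigenvalue of finite multiplicity. -/
def IsDiscreteEigenvalue (A : Submodule ℂ (H × H)) (z : ℂ) : Prop :=
  graphEigenspace A z ≠ ⊥ ∧ FiniteDimensional ℂ (graphEigenspace A z) ∧
    ∃ ε > 0, ∀ w ∈ graphSpectrum A, ‖w - z‖ < ε → w = z

/-- The operator with graph `A` has only discrete spectrum in `[-Λ, Λ]`. -/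
def HasOnlyDiscreteSpectrum (A : Submodule ℂ (H × H)) (Λ : ℝ) : Prop :=
  ∀ t ∈ Icc (-Λ) Λ, (t : ℂ) ∈ graphSpectrum A → IsDiscreteEigenvalue A (t : ℂ)

/-- The number of eigenvalues in `[-Λ, Λ]`, counted with multiplicity (used only when there is only
discrete spectrum there, so that all terms and the number of nonzero terms are finite). -/
def eigenvalueCount (A : Submodule ℂ (H × H)) (Λ : ℝ) : ℕ :=
  ∑ᶠ t ∈ Icc (-Λ) Λ, Module.finrank ℂ (graphEigenspace A (t : ℂ))

end Spectral

/-! ### First-order operators with a potential -/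

section Operators

variable {E : Type*} [NormedAddCommGroup E] [NormedSpace ℝ E]
  {Z : Type*} [EMetricSpace Z] [MeasurableSpace Z] [BorelSpace Z] [SecondCountableTopology Z]
  [ChartedSpace E Z]
  {F : Type*} [NormedAddCommGroup F] [NormedSpace ℂ F] [FiniteDimensional ℂ F]
  {S : Z → Type*} [TopologicalSpace (TotalSpace F S)]
  [∀ x, NormedAddCommGroup (S x)] [∀ x, InnerProductSpace ℂ (S x)] [FiberBundle F S]
  [VectorBundle ℂ F S] [VectorBundle ℝ F S]

/-- The type of `σ_x : T_x^*Z → End(S_x)`, for all `x`. It is not required to be smooth in `x`: this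
follows when it is the symbol of an operator. -/
abbrev SymbolField (E : Type*) [NormedAddCommGroup E] [NormedSpace ℝ E]
    {Z : Type*} [TopologicalSpace Z] [ChartedSpace E Z] (S : Z → Type*)
    [∀ x, NormedAddCommGroup (S x)] [∀ x, InnerProductSpace ℂ (S x)] : Type _ :=
  ∀ x : Z, (TangentSpace 𝓘(ℝ, E) x →L[ℝ] ℝ) →ₗ[ℝ] (S x →L[ℂ] S x)

/-- `σ_x(d_x f)`, the symbol applied to the differential of a real function. -/
def symbolOfDifferential (σ : SymbolField E S) (f : Z → ℝ) (x : Z) : S x →L[ℂ] S x :=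
  σ x (mfderiv 𝓘(ℝ, E) 𝓘(ℝ, ℝ) f x)

/-- `L` is a differential operator of order at most one on `C_c^∞(Z; S)` with symbol `σ`, that is,
`L(fΦ) = f LΦ + σ(df) Φ` for all smooth real functions `f`. (This identity makes `L` a local operator
which in charts and frames is of the form `∑ aⱼ ∂ⱼ + b` with smooth `aⱼ` and `b`.) -/
def IsFirstOrderOperatorWithSymbol
    (L : SmoothCompactSections (E := E) F S →ₗ[ℂ] SmoothCompactSections (E := E) F S)
    (σ : SymbolField E S) : Prop :=
  ∀ f : Z → ℝ, ContMDiff 𝓘(ℝ, E) 𝓘(ℝ, ℝ) ∞ f →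
    ∀ Φ Ψ : SmoothCompactSections (E := E) F S, (∀ x, Ψ.1 x = (f x : ℂ) • Φ.1 x) →
      ∀ x, (L Ψ).1 x = (f x : ℂ) • (L Φ).1 x + symbolOfDifferential σ f x (Φ.1 x)

/-- The symbol `σ` is elliptic. -/
def IsEllipticSymbol (σ : SymbolField E S) : Prop :=
  ∀ (x : Z) (ξ : TangentSpace 𝓘(ℝ, E) x →L[ℝ] ℝ), ξ ≠ 0 → Function.Bijective (σ x ξ)

/-- The operator `L_m = L + m h` on `C_c^∞(Z; S)`. -/
def massOperator
    (L : SmoothCompactSections (E := E) F S →ₗ[ℂ] SmoothCompactSections (E := E) F S)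
    (h : ∀ x, Module.End ℂ (S x)) (m : ℝ) :
    SmoothCompactSections (E := E) F S →ₗ[ℂ] ∀ x, S x where
  toFun Φ := fun x => (L Φ).1 x + (m : ℂ) • h x (Φ.1 x)
  map_add' Φ Ψ := by
    funext x
    simp only [map_add, Submodule.coe_add, Pi.add_apply, smul_add]
    abel
  map_smul' c Φ := by
    funext x
    simp only [map_smul, Submodule.coe_smul, Pi.smul_apply, smul_add, RingHom.id_apply]
    rw [smul_comm]

variable [ContMDiffVectorBundle ∞ F S 𝓘(ℝ, E)] [IsSmoothHermitianBundle (E := E) F S]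

/-- The graph in `L²(Z; S) × L²(Z; S)` of an operator `T` with domain `C_c^∞(Z; S)`. -/
def operatorGraph (T : SmoothCompactSections (E := E) F S →ₗ[ℂ] ∀ x, S x) :
    Submodule ℂ (L2Space E F S × L2Space E F S) where
  carrier := {p | ∃ (Φ : SmoothCompactSections (E := E) F S) (u w : L2Section E F S),
    u.toSection = Φ.1 ∧ w.toSection = T Φ ∧ p.1 = (u : L2Space E F S) ∧ p.2 = (w : L2Space E F S)}
  add_mem' := by
    rintro p q ⟨Φ, u, w, hu, hw, hp, hp'⟩ ⟨Ψ, v, y, hv, hy, hq, hq'⟩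
    refine ⟨Φ + Ψ, u + v, w + y, ?_, ?_, ?_, ?_⟩
    · exact congrArg₂ (· + ·) hu hv
    · rw [map_add]
      exact congrArg₂ (· + ·) hw hy
    · rw [UniformSpace.Completion.coe_add, ← hp, ← hq, Prod.fst_add]
    · rw [UniformSpace.Completion.coe_add, ← hp', ← hq', Prod.snd_add]
  zero_mem' := ⟨0, 0, 0, rfl, (map_zero T).symm, rfl, rfl⟩
  smul_mem' := by
    rintro c p ⟨Φ, u, w, hu, hw, hp, hp'⟩
    refine ⟨c • Φ, c • u, c • w, ?_, ?_, ?_, ?_⟩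
    · exact congrArg (c • ·) hu
    · rw [map_smul]
      exact congrArg (c • ·) hw
    · rw [UniformSpace.Completion.coe_smul, ← hp, Prod.smul_fst]
    · rw [UniformSpace.Completion.coe_smul, ← hp', Prod.smul_snd]

/-- The graph of the closure in `L²(Z; S)` of `L_m = L + m h : C_c^∞(Z; S) → L²(Z; S)`. -/
def massClosure
    (L : SmoothCompactSections (E := E) F S →ₗ[ℂ] SmoothCompactSections (E := E) F S)
    (h : ∀ x, Module.End ℂ (S x)) (m : ℝ) : Submodule ℂ (L2Space E F S × L2Space E F S) :=
  (operatorGraph (massOperator L h m)).topologicalClosure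

/-- The standing assumptions on `(Z = U₀ ∪ U₁, 1 = η₀ + (1 - η₀), S, L, h)`, where `L` has the
symbol `σ`. -/
structure IsLocalisationDatum (σ : SymbolField E S) (η₀ : Z → ℝ) (U₀ U₁ : Set Z)
    (L : SmoothCompactSections (E := E) F S →ₗ[ℂ] SmoothCompactSections (E := E) F S)
    (h : ∀ x, Module.End ℂ (S x)) : Prop where
  /-- `Z = U₀ ∪ U₁` is an open covering. -/
  isOpen₀ : IsOpen U₀
  isOpen₁ : IsOpen U₁
  cover : U₀ ∪ U₁ = univ
  /-- `η₀` and `1 - η₀` form a smooth partition of unity subordinate to `U₀` and `U₁`. -/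
  eta_smooth : ContMDiff 𝓘(ℝ, E) 𝓘(ℝ, ℝ) ∞ η₀
  eta_mem : ∀ x, η₀ x ∈ Icc (0 : ℝ) 1
  eta_support₀ : tsupport η₀ ⊆ U₀
  eta_support₁ : tsupport (fun x => 1 - η₀ x) ⊆ U₁
  /-- `L` is a first-order elliptic operator with symbol `σ` and essentially self-adjoint. -/
  hasSymbol : IsFirstOrderOperatorWithSymbol L σ
  elliptic : IsEllipticSymbol σ
  essSelfAdjoint :
    IsEssentiallySelfAdjoint (operatorGraph ((SmoothCompactSections (E := E) F S).subtype ∘ₗ L))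
  /-- `|σ(dη₀)|` is bounded on `U₀ ∩ U₁`. -/
  symbol_bounded : ∃ B : ℝ, ∀ x ∈ U₀ ∩ U₁, ‖symbolOfDifferential σ η₀ x‖ ≤ B
  /-- `h` is a measurable self-adjoint endomorphism of `S` with uniformly bounded eigenvalues. -/
  h_selfAdjoint : ∀ x, (h x).IsSymmetric
  h_measurable : ∀ Φ : SmoothCompactSections (E := E) F S,
    MeasurableSection E F S fun x => h x (Φ.1 x)
  h_bounded : ∃ B : ℝ, ∀ (x : Z) (a : ℝ), (h x).HasEigenvalue (a : ℂ) → |a| ≤ B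
  /-- `h` is smooth on `U₁`. -/
  h_smooth : ∀ Φ : SmoothCompactSections (E := E) F S,
    SmoothSectionOn (E := E) F S (fun x => h x (Φ.1 x)) U₁
  /-- `h` anti-commutes with `L` on `U₁`: `L(hΦ) = -h(LΦ)` for `Φ` supported in `U₁`. -/
  h_anticommutes : ∀ Φ Ψ : SmoothCompactSections (E := E) F S, sectionSupport Φ.1 ⊆ U₁ →
    (∀ x, Ψ.1 x = h x (Φ.1 x)) → ∀ x, (L Ψ).1 x = -h x ((L Φ).1 x)
  /-- The eigenvalues of `h²` are at least `1` on `U₁`. -/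
  h_sq : ∀ x ∈ U₁, ∀ a : ℝ, (h x ^ 2).HasEigenvalue (a : ℂ) → 1 ≤ a

end Operators

/-! ### Isometries covered by bundle isometries -/

section Isometry

variable {E : Type*} [NormedAddCommGroup E] [NormedSpace ℝ E]
  {Z : Type*} [EMetricSpace Z] [ChartedSpace E Z]
  [RiemannianBundle (fun x : Z => TangentSpace 𝓘(ℝ, E) x)]
  {F : Type*} [NormedAddCommGroup F] [NormedSpace ℂ F]
  {S : Z → Type*} [TopologicalSpace (TotalSpace F S)]
  [∀ x, NormedAddCommGroup (S x)] [∀ x, InnerProductSpace ℂ (S x)] [FiberBundle F S]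
  {E' : Type*} [NormedAddCommGroup E'] [NormedSpace ℝ E']
  {Z' : Type*} [EMetricSpace Z'] [ChartedSpace E' Z']
  [RiemannianBundle (fun x : Z' => TangentSpace 𝓘(ℝ, E') x)]
  {F' : Type*} [NormedAddCommGroup F'] [NormedSpace ℂ F']
  {S' : Z' → Type*} [TopologicalSpace (TotalSpace F' S')]
  [∀ x, NormedAddCommGroup (S' x)] [∀ x, InnerProductSpace ℂ (S' x)] [FiberBundle F' S']

variable (E F E' F') in
/-- `τ` is a Riemannian isometry from `U₀` onto `U₀'`, and `θ` is a bundle isometry from `S|_{U₀}`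
to `S'|_{U₀'}` that covers `τ`. The values of `τ` and `θ` outside `U₀` play no role. -/
structure IsBundleIsometry (τ : OpenPartialHomeomorph Z Z') (θ : ∀ x, S x →ₗ[ℂ] S' (τ x))
    (U₀ : Set Z) (U₀' : Set Z') : Prop where
  source_eq : τ.source = U₀
  target_eq : τ.target = U₀'
  contMDiffOn : ContMDiffOn 𝓘(ℝ, E) 𝓘(ℝ, E') ∞ τ U₀
  contMDiffOn_symm : ContMDiffOn 𝓘(ℝ, E') 𝓘(ℝ, E) ∞ τ.symm U₀'
  norm_mfderiv : ∀ x ∈ U₀, ∀ v : TangentSpace 𝓘(ℝ, E) x,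
    ‖mfderiv 𝓘(ℝ, E) 𝓘(ℝ, E') τ x v‖ = ‖v‖
  bundle_contMDiffOn : ContMDiffOn (𝓘(ℝ, E).prod 𝓘(ℝ, F)) (𝓘(ℝ, E').prod 𝓘(ℝ, F')) ∞
    (fun p : TotalSpace F S => TotalSpace.mk' F' (τ p.1) (θ p.1 p.2)) {p | p.1 ∈ U₀}
  bundle_surjective : ∀ x ∈ U₀, Function.Surjective (θ x)
  bundle_norm : ∀ x ∈ U₀, ∀ v : S x, ‖θ x v‖ = ‖v‖

variable [MeasurableSpace Z] [BorelSpace Z] [VectorBundle ℂ F S] [VectorBundle ℝ F S]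
  [VectorBundle ℂ F' S'] [VectorBundle ℝ F' S']

/-- `θ⁻¹ ∘ T' ∘ θ = T` on sections supported in `U₀`: if `Φ` is supported in `U₀` and `Φ'` is its
image under `θ`, then `T' Φ'` is the image under `θ` of `T Φ`, almost everywhere on `U₀`. -/
def Intertwines (τ : OpenPartialHomeomorph Z Z') (θ : ∀ x, S x →ₗ[ℂ] S' (τ x))
    (U₀ : Set Z) (U₀' : Set Z')
    (T : SmoothCompactSections (E := E) F S →ₗ[ℂ] ∀ x, S x)
    (T' : SmoothCompactSections (E := E') F' S' →ₗ[ℂ] ∀ x, S' x) : Prop :=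
  ∀ (Φ : SmoothCompactSections (E := E) F S) (Φ' : SmoothCompactSections (E := E') F' S'),
    sectionSupport Φ.1 ⊆ U₀ → sectionSupport Φ'.1 ⊆ U₀' →
    (∀ x ∈ U₀, Φ'.1 (τ x) = θ x (Φ.1 x)) →
    ∀ᵐ x ∂(riemannianVolume E : Measure Z), x ∈ U₀ → T' Φ' (τ x) = θ x (T Φ x)

end Isometry

end

/-!
A section of `S` is compared with a section of `S'` by cutting it off to `U₀` and transporting it to
`U₀'`. The cut-off function `χ = cos (innerAngle η₀)` is accompanied by `ρ = cos (outerAngle η₀)`, which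
is supported in `U₁`, with `χ² + ρ² ≥ 1` and `ρ = 1` wherever `χ` varies. On `U₁` the endomorphism `h`
anti-commutes with `L` and `h² ≥ 1`, so that `(L + m h)² = L² + m² h² ≥ m²`, and hence
`m² ‖ρΦ‖² ≤ ‖L_m (ρΦ)‖²` (`IsLocalisationDatum.sq_mul_integral_le`). Because the cut-off functions are
cosines, `‖L_m (ρΦ)‖² ≤ ‖L_m Φ‖² + C² ‖Φ‖²`, where `C` bounds the symbol `σ_L(dη₀)` times the derivatives
of the two angle functions (`exists_cutoffBound`); this is all that the constant depends on. With
`q = (‖L_m Φ‖² + C² ‖Φ‖²) / m²`, the passage from `Φ` to `χΦ` therefore diminishes `‖Φ‖²` by at most `q`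
and increases `‖L_m Φ‖²` by at most `C² q` (`CutoffBound.innerCutoff_estimates`). A linear map between
the domains of two operators with these properties is called an almost isometry (`IsAlmostIsometry`).

The transport from `U₀` to `U₀'` changes neither of the two norms: a Riemannian isometry preserves the
volume (`map_riemannianVolume_restrict`), and the operators are local and intertwined
(`IsBundleIsometry.norms_eq_of_mem_correspondence`). Sections supported in `U₀` and sections supported
in `U₀'` correspond to each other, so that there are almost isometries in both directions. By density
they extend to the closures of the operators (`CutoffBound.exists_isAlmostIsometry`), which are
self-adjoint since `m h` is a bounded symmetric perturbation of an essentially self-adjoint operator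
(`IsLocalisationDatum.massClosure_eq_adjoint`).

The rest is a variational argument on Hilbert spaces. If
`(C² + b²) (C² + a²) < m² (b² - a²)`, then an almost isometry maps a nonzero vector on which `T` is
bounded by `a` to one on which `T'` is not bounded below by `b`; so the dimension of a space on which `T`
is bounded by `a` is at most that of any space off which `T'` is bounded below by `b`
(`IsAlmostIsometry.finrank_le`). The gap in the spectrum of `L_m` is turned into such a lower bound
by the functional calculus of the resolvent (`exists_eigenvalues_of_gap`). Applied with `a` slightly
larger than `Λ₁` and `b = Λ₂`, this bounds the dimensions of the spaces on which `L'_m` is bounded by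
`a`, and a variational form of Weyl's criterion (`bounded_below_of_finrank_le`) shows that `L'_m` has
only discrete spectrum up to `Λ₁` and a small gap beyond. Applied with `a = Λ₀`, `b = Λ₁` in the other
direction, it gives the reverse inequality (`eigenvalueCount_eq_of_isAlmostIsometry`).
-/

/-! ### Self-adjoint operators given by their graphs -/

section SelfAdjointGraph

variable {H : Type*} [NormedAddCommGroup H] [InnerProductSpace ℂ H] {A : Submodule ℂ (H × H)}

theorem isClosed_of_eq_adjoint (hA : A = A.adjoint) : IsClosed (A : Set (H × H)) := by
  have h : (A : Set (H × H)) =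
      ⋂ p : A, {x : H × H | inner ℂ p.1.2 x.1 - inner ℂ p.1.1 x.2 = 0} := by
    ext x
    conv_lhs => rw [SetLike.mem_coe, hA, Submodule.mem_adjoint_iff]
    simp only [mem_iInter, Subtype.forall, Prod.forall, mem_ofPred_eq]
  rw [h]
  refine isClosed_iInter fun p => isClosed_eq ?_ continuous_const
  fun_prop

theorem inner_comm_of_eq_adjoint (hA : A = A.adjoint) {p q : H × H} (hp : p ∈ A) (hq : q ∈ A) :
    (inner ℂ p.2 q.1 : ℂ) = inner ℂ p.1 q.2 := by
  rw [hA, Submodule.mem_adjoint_iff] at hq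
  exact sub_eq_zero.1 (hq p.1 p.2 hp)

/-- The bounded map `(u, w) ↦ w - z u`; on the graph of an operator it is `u ↦ (T - z) u`. -/
noncomputable def shiftMap (H : Type*) [NormedAddCommGroup H] [InnerProductSpace ℂ H] (z : ℂ) :
    H × H →L[ℂ] H :=
  ContinuousLinearMap.snd ℂ H H - z • ContinuousLinearMap.fst ℂ H H

theorem mem_graphEigenspace {z : ℂ} {u : H} : u ∈ graphEigenspace A z ↔ (u, z • u) ∈ A := Iff.rfl

/-- Eigenspaces of a self-adjoint operator for distinct real eigenvalues are orthogonal. -/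
theorem inner_eq_zero_of_mem_graphEigenspace (hA : A = A.adjoint) {s t : ℝ} (hst : s ≠ t) {u v : H}
    (hu : u ∈ graphEigenspace A s) (hv : v ∈ graphEigenspace A t) : (inner ℂ u v : ℂ) = 0 := by
  have h := inner_comm_of_eq_adjoint hA (show (u, (s : ℂ) • u) ∈ A from hu)
    (show (v, (t : ℂ) • v) ∈ A from hv)
  simp only [inner_smul_left, inner_smul_right, Complex.conj_ofReal] at h
  have h2 : ((s : ℂ) - t) * inner ℂ u v = 0 := by rw [sub_mul, h, sub_self]
  exact (mul_eq_zero.1 h2).resolve_left (sub_ne_zero.2 (by exact_mod_cast hst))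

/-- The orthogonal decomposition of the domain into an eigenspace and its complement reduces a
self-adjoint operator. -/
theorem exists_projection_decomposition (hA : A = A.adjoint) (t : ℝ)
    [FiniteDimensional ℂ (graphEigenspace A (t : ℂ))] {p : H × H} (hp : p ∈ A) :
    ∃ e ∈ graphEigenspace A (t : ℂ), ∃ q ∈ A, q.1 ∈ (graphEigenspace A (t : ℂ))ᗮ ∧
      q.2 ∈ (graphEigenspace A (t : ℂ))ᗮ ∧ p = (e, (t : ℂ) • e) + q := by
  set K := graphEigenspace A (t : ℂ)
  obtain ⟨e, he, f, hf, hef⟩ := K.exists_add_mem_mem_orthogonal p.1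
  have hq : p - (e, (t : ℂ) • e) ∈ A := A.sub_mem hp he
  have h1 : (p - (e, (t : ℂ) • e)).1 ∈ Kᗮ := by simpa [hef] using hf
  refine ⟨e, he, p - (e, (t : ℂ) • e), hq, h1, ?_, by abel⟩
  rw [Submodule.mem_orthogonal] at h1 ⊢
  intro v hv
  have h2 := inner_comm_of_eq_adjoint hA (show (v, (t : ℂ) • v) ∈ A from hv) hq
  rw [← h2, inner_smul_left, h1 v hv, mul_zero]

variable [CompleteSpace H]

/-- A complex number `z` is in the resolvent set of a self-adjoint operator `T` as soon as `T - z`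
and `T - conj z` are bounded below: the range of `T - z` is then dense, because a vector orthogonal
to it is in the kernel of `T - conj z`. -/
theorem notMem_graphSpectrum_of_bounded_below (hA : A = A.adjoint) {z : ℂ} {c : ℝ} (hc : 0 < c)
    (h1 : ∀ p ∈ A, c * ‖p.1‖ ≤ ‖p.2 - z • p.1‖)
    (h2 : ∀ p ∈ A, c * ‖p.1‖ ≤ ‖p.2 - (starRingEnd ℂ) z • p.1‖) :
    z ∉ graphSpectrum A := by
  let e : A →ₗ[ℂ] H := (shiftMap H z).toLinearMap ∘ₗ A.subtype
  let f : A →ₗ[ℂ] H := LinearMap.fst ℂ H H ∘ₗ A.subtype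
  have he : ∀ p : A, e p = p.1.2 - z • p.1.1 := fun p => rfl
  have hdense : DenseRange e := by
    have h3 : (LinearMap.range e)ᗮ = ⊥ := by
      rw [Submodule.eq_bot_iff]
      intro v hv
      rw [Submodule.mem_orthogonal] at hv
      have hmem : (v, (starRingEnd ℂ) z • v) ∈ A := by
        rw [hA, Submodule.mem_adjoint_iff]
        intro a b hab
        have h4 := hv _ ⟨⟨(a, b), hab⟩, rfl⟩
        rw [he, inner_sub_left, inner_smul_left] at h4
        simpa [inner_smul_right] using h4
      have h5 := h2 _ hmem
      simp only [sub_self, norm_zero] at h5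
      have h6 : ‖v‖ ≤ 0 := by nlinarith [norm_nonneg v]
      exact norm_le_zero_iff.1 h6
    have h4 := (Submodule.topologicalClosure_eq_top_iff (K := LinearMap.range e)).2 h3
    have h5 := Submodule.dense_iff_topologicalClosure_eq_top.2 h4
    exact h5
  have hbd : ∃ C, ∀ p, ‖f p‖ ≤ C * ‖e p‖ := by
    refine ⟨c⁻¹, fun p => ?_⟩
    have := h1 p.1 p.2
    rw [he, ← div_eq_inv_mul, le_div_iff₀' hc]
    exact this
  set R : H →L[ℂ] H := f.extendOfNorm e with hR
  have hRe : ∀ p, R (e p) = f p := LinearMap.extendOfNorm_eq hdense hbd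
  have hall : ∀ v, (R v, v + z • R v) ∈ A := by
    have hcl : IsClosed {v | (R v, v + z • R v) ∈ A} :=
      (isClosed_of_eq_adjoint hA).preimage (f := fun v => (R v, v + z • R v)) (by fun_prop)
    intro v
    refine hdense.induction_on v hcl fun p => ?_
    rw [hRe, he]
    simp only [f, LinearMap.comp_apply, Submodule.subtype_apply, LinearMap.fst_apply,
      sub_add_cancel]
    exact p.2
  rw [graphSpectrum, notMem_compl_iff]
  refine ⟨R, fun u w => ⟨fun h => ?_, fun h => ?_⟩⟩
  · exact hRe ⟨(u, w), h⟩
  · have := hall (w - z • u)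
    rwa [h, sub_add_cancel] at this

/-- If a self-adjoint operator is bounded below by `c` after subtracting `t` on the orthogonal
complement of the eigenspace for `t`, then `t` is at distance at least `c / 2` from the other points
of the spectrum. -/
theorem notMem_graphSpectrum_of_near (hA : A = A.adjoint) (t : ℝ)
    [FiniteDimensional ℂ (graphEigenspace A (t : ℂ))] {c : ℝ}
    (h : ∀ p ∈ A, p.1 ∈ (graphEigenspace A (t : ℂ))ᗮ → c * ‖p.1‖ ≤ ‖p.2 - (t : ℂ) • p.1‖)
    {z : ℂ} (hz : z ≠ t) (hzc : ‖z - t‖ ≤ c / 2) : z ∉ graphSpectrum A := by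
  have hpos : 0 < ‖z - t‖ := norm_pos_iff.2 (sub_ne_zero.2 hz)
  have key : ∀ z : ℂ, ‖z - t‖ ≤ c / 2 → ∀ p ∈ A, ‖z - t‖ * ‖p.1‖ ≤ ‖p.2 - z • p.1‖ := by
    intro z hzc p hp
    obtain ⟨e, he, q, hq, hq1, hq2, rfl⟩ := exists_projection_decomposition hA t hp
    have h1 : ((e, (t : ℂ) • e) + q).2 - z • ((e, (t : ℂ) • e) + q).1
        = ((t : ℂ) - z) • e + (q.2 - z • q.1) := by
      simp only [Prod.fst_add, Prod.snd_add, smul_add, sub_smul]; abel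
    have h2 : (inner ℂ (((t : ℂ) - z) • e) (q.2 - z • q.1) : ℂ) = 0 :=
      (Submodule.mem_orthogonal _ _).1 (Submodule.sub_mem _ hq2 (Submodule.smul_mem _ _ hq1)) _
        (Submodule.smul_mem _ _ he)
    have h3 : (inner ℂ e q.1 : ℂ) = 0 := (Submodule.mem_orthogonal _ _).1 hq1 _ he
    have h4 := norm_add_sq_eq_norm_sq_add_norm_sq_of_inner_eq_zero _ _ h2
    have h5 := norm_add_sq_eq_norm_sq_add_norm_sq_of_inner_eq_zero _ _ h3
    have h6 : ‖z - t‖ * ‖q.1‖ ≤ ‖q.2 - z • q.1‖ := by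
      have h7 := h q hq hq1
      have h8 : q.2 - (t : ℂ) • q.1 = (q.2 - z • q.1) + (z - t) • q.1 := by
        rw [sub_smul]; abel
      have h9 : ‖q.2 - (t : ℂ) • q.1‖ ≤ ‖q.2 - z • q.1‖ + ‖z - t‖ * ‖q.1‖ := by
        rw [h8, ← norm_smul]; exact norm_add_le _ _
      nlinarith [norm_nonneg q.1]
    rw [h1]
    have h10 : ‖((t : ℂ) - z) • e‖ = ‖z - t‖ * ‖e‖ := by rw [norm_smul, norm_sub_rev]
    refine le_of_sq_le_sq ?_ (norm_nonneg _)
    have h11 : (‖z - t‖ * ‖q.1‖) ^ 2 ≤ ‖q.2 - z • q.1‖ ^ 2 := by gcongr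
    rw [mul_pow, Prod.fst_add, sq ‖e + q.1‖, h5, sq ‖((t : ℂ) - z) • e + _‖, h4, h10]
    nlinarith
  refine notMem_graphSpectrum_of_bounded_below hA hpos (key z hzc) ?_
  have h12 : ‖(starRingEnd ℂ) z - t‖ = ‖z - t‖ := by
    rw [← Complex.conj_ofReal t, ← map_sub, RCLike.norm_conj, Complex.conj_ofReal]
  rw [← h12]
  exact key _ (h12 ▸ hzc)

/-- If `T - t` is bounded below on the orthogonal complement of a finite-dimensional subspace of the
domain, then it has closed range: the range is the sum of the closed image of this complement and of
a finite-dimensional space. -/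
theorem isClosed_map_shiftMap_of_bounded_below (hA : IsClosed (A : Set (H × H))) (t : ℝ)
    {X : Submodule ℂ (H × H)} [FiniteDimensional ℂ X] (hXA : X ≤ A) {c : ℝ} (hc : 0 < c)
    (h : ∀ p ∈ A, p.1 ∈ (X.map (LinearMap.fst ℂ H H))ᗮ → c * ‖p.1‖ ≤ ‖p.2 - (t : ℂ) • p.1‖) :
    IsClosed (A.map (shiftMap H (t : ℂ)).toLinearMap : Set H) := by
  set Y : Submodule ℂ H := X.map (LinearMap.fst ℂ H H) with hY
  have hYfin : FiniteDimensional ℂ Y := inferInstance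
  let M : Submodule ℂ (H × H) := A ⊓ Yᗮ.comap (LinearMap.fst ℂ H H)
  have hMcl : IsClosed (M : Set (H × H)) :=
    hA.inter (Y.isClosed_orthogonal.preimage continuous_fst)
  have : CompleteSpace M := hMcl.completeSpace_coe
  let TM : M →L[ℂ] H := shiftMap H (t : ℂ) ∘L M.subtypeL
  have hbd : ∀ p : M, ‖p‖ ≤ ((1 + (1 + |t|) * c⁻¹).toNNReal : ℝ) * ‖TM p‖ := by
    intro p
    rw [Real.coe_toNNReal _ (by positivity)]
    have h1 := h p.1 p.2.1 p.2.2
    have h2 : TM p = p.1.2 - (t : ℂ) • p.1.1 := rfl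
    rw [← h2] at h1
    have h3 : ‖p.1.2‖ ≤ ‖TM p‖ + |t| * ‖p.1.1‖ := by
      have h6 : p.1.2 = TM p + (t : ℂ) • p.1.1 := by rw [h2, sub_add_cancel]
      calc ‖p.1.2‖ = ‖TM p + (t : ℂ) • p.1.1‖ := by rw [← h6]
        _ ≤ _ := (norm_add_le _ _).trans (by rw [norm_smul, Complex.norm_real, Real.norm_eq_abs])
    have h4 : ‖p.1.1‖ ≤ c⁻¹ * ‖TM p‖ := by
      rw [← div_eq_inv_mul, le_div_iff₀' hc]; exact h1
    have h6 : |t| * ‖p.1.1‖ ≤ |t| * (c⁻¹ * ‖TM p‖) := by gcongr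
    have h7 := norm_nonneg (TM p)
    have h8 : 0 ≤ |t| * c⁻¹ * ‖TM p‖ := by positivity
    have h9 : 0 ≤ c⁻¹ * ‖TM p‖ := by positivity
    exact max_le (by change ‖p.1.1‖ ≤ _; nlinarith) (by change ‖p.1.2‖ ≤ _; nlinarith)
  have hTMcl : IsClosed (LinearMap.range TM.toLinearMap : Set H) :=
    (TM.antilipschitz_of_bound hbd).isClosed_range TM.uniformContinuous
  have hfin : FiniteDimensional ℂ (X.map (shiftMap H (t : ℂ)).toLinearMap) := inferInstance
  have hsum : A.map (shiftMap H (t : ℂ)).toLinearMap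
      = LinearMap.range TM.toLinearMap ⊔ X.map (shiftMap H (t : ℂ)).toLinearMap := by
    refine le_antisymm ?_ (sup_le ?_ (Submodule.map_mono hXA))
    · rintro _ ⟨p, hp, rfl⟩
      obtain ⟨y, ⟨x, hx, hxy⟩, z, hz, hyz⟩ := Y.exists_add_mem_mem_orthogonal p.1
      have hr : p - x ∈ M := by
        refine ⟨A.sub_mem hp (hXA hx), ?_⟩
        have h1 : p.1 - x.1 = z := by rw [hyz, ← hxy]; simp
        change p.1 - x.1 ∈ Yᗮ
        rwa [h1]
      refine Submodule.mem_sup.2 ⟨_, ⟨⟨_, hr⟩, rfl⟩, _, ⟨x, hx, rfl⟩, ?_⟩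
      change shiftMap H (t : ℂ) (p - x) + shiftMap H (t : ℂ) x = shiftMap H (t : ℂ) p
      rw [map_sub, sub_add_cancel]
    · rintro _ ⟨p, rfl⟩
      exact ⟨p.1, p.2.1, rfl⟩
  rw [hsum]
  exact Submodule.isClosed_sup_finiteDimensional _ _ hTMcl

/-- Weyl's criterion in variational form. If the dimension of the spaces of vectors on which `T - t`
is at most `δ` is bounded, then the eigenspace for `t` is finite-dimensional and `T - t` is bounded
below on its orthogonal complement.

On the orthogonal complement of a space of largest dimension on which `T - t` is small, `T - t` is
bounded below, so that its range is closed and the open mapping theorem applies. -/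
theorem bounded_below_of_finrank_le (hA : A = A.adjoint) (t : ℝ) {δ : ℝ} (hδ : 0 < δ) (N : ℕ)
    (hN : ∀ X : Submodule ℂ (H × H), X ≤ A → FiniteDimensional ℂ X →
      (∀ p ∈ X, ‖p.2 - (t : ℂ) • p.1‖ ≤ δ * ‖p.1‖) → Module.finrank ℂ X ≤ N) :
    FiniteDimensional ℂ (graphEigenspace A (t : ℂ)) ∧ ∃ c > 0, ∀ p ∈ A,
      p.1 ∈ (graphEigenspace A (t : ℂ))ᗮ → c * ‖p.1‖ ≤ ‖p.2 - (t : ℂ) • p.1‖ := by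
  -- `P n`: there are spaces of dimension `n` on which `T - t` is arbitrarily small.
  let P : ℕ → Prop := fun n => ∀ c, 0 < c → c ≤ δ → ∃ X : Submodule ℂ (H × H), X ≤ A ∧
    FiniteDimensional ℂ X ∧ (∀ p ∈ X, ‖p.2 - (t : ℂ) • p.1‖ ≤ c * ‖p.1‖) ∧ Module.finrank ℂ X = n
  have hP0 : P 0 := fun c hc hcδ => ⟨⊥, bot_le, inferInstance, by
    rintro p hp
    rw [Submodule.mem_bot] at hp
    simp [hp], finrank_bot ℂ _⟩
  have hPN : ¬ P (N + 1) := by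
    intro h
    obtain ⟨X, h1, h2, h3, h4⟩ := h δ hδ le_rfl
    have := hN X h1 h2 h3
    omega
  obtain ⟨n, hn, hn1⟩ : ∃ n, P n ∧ ¬ P (n + 1) := by
    by_contra! hcon
    exact hPN (Nat.rec hP0 hcon (N + 1))
  simp only [P, not_forall] at hn1
  obtain ⟨c₀, hc₀, hc₀δ, hmax⟩ := hn1
  obtain ⟨X, hXA, hXfin, hXbd, hXn⟩ := hn (c₀ / 2) (by positivity) (by linarith)
  let Y : Submodule ℂ H := X.map (LinearMap.fst ℂ H H)
  have hYfin : FiniteDimensional ℂ Y := inferInstance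
  have hbelow : ∀ p ∈ A, p.1 ∈ Yᗮ → c₀ / 2 * ‖p.1‖ ≤ ‖p.2 - (t : ℂ) • p.1‖ := by
    intro p hp hpY
    by_contra! hlt
    have hp0 : p.1 ≠ 0 := by
      intro h0
      rw [h0, norm_zero, mul_zero] at hlt
      exact absurd hlt (not_lt.2 (norm_nonneg _))
    have hpX : p ∉ X := fun hpX => hp0 <| by
      have h1 : p.1 ∈ Y := ⟨p, hpX, rfl⟩
      exact inner_self_eq_zero.1 ((Submodule.mem_orthogonal _ _).1 hpY _ h1)
    refine hmax ⟨X ⊔ Submodule.span ℂ {p}, ?_, inferInstance, ?_, ?_⟩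
    · exact sup_le hXA ((Submodule.span_singleton_le_iff_mem _ _).2 hp)
    · intro r hr
      obtain ⟨x, hx, y, hy, rfl⟩ := Submodule.mem_sup.1 hr
      obtain ⟨a, rfl⟩ := Submodule.mem_span_singleton.1 hy
      have h0 : (inner ℂ x.1 (a • p.1) : ℂ) = 0 := by
        rw [inner_smul_right, (Submodule.mem_orthogonal _ _).1 hpY x.1 ⟨x, hx, rfl⟩, mul_zero]
      have h1 := norm_add_sq_eq_norm_sq_add_norm_sq_of_inner_eq_zero _ _ h0
      have h2 : ‖x.1‖ ≤ ‖x.1 + a • p.1‖ :=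
        abs_le_of_sq_le_sq' (by nlinarith [sq_nonneg ‖a • p.1‖]) (norm_nonneg _) |>.2
      have h3 : ‖a • p.1‖ ≤ ‖x.1 + a • p.1‖ :=
        abs_le_of_sq_le_sq' (by nlinarith [sq_nonneg ‖x.1‖]) (norm_nonneg _) |>.2
      have h4 : (x + a • p).2 - (t : ℂ) • (x + a • p).1
          = (x.2 - (t : ℂ) • x.1) + a • (p.2 - (t : ℂ) • p.1) := by
        simp only [Prod.snd_add, Prod.fst_add, Prod.smul_fst, Prod.smul_snd, smul_add, smul_sub]
        rw [smul_comm a]; abel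
      rw [h4]
      have h5 : ‖a • (p.2 - (t : ℂ) • p.1)‖ ≤ c₀ / 2 * ‖a • p.1‖ := by
        rw [norm_smul, norm_smul]
        nlinarith [norm_nonneg a]
      have h6 := hXbd x hx
      calc _ ≤ ‖x.2 - (t : ℂ) • x.1‖ + ‖a • (p.2 - (t : ℂ) • p.1)‖ := norm_add_le _ _
        _ ≤ c₀ * ‖x.1 + a • p.1‖ := by nlinarith
    · have hdisj : X ⊓ Submodule.span ℂ {p} = ⊥ :=
        (Submodule.disjoint_span_singleton_of_notMem hpX).eq_bot
      have h1 := Submodule.finrank_sup_add_finrank_inf_eq X (Submodule.span ℂ {p})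
      rw [hdisj, finrank_bot, finrank_span_singleton (fun h => hp0 (by rw [h]; rfl)), hXn] at h1
      exact h1
  have hEfin : FiniteDimensional ℂ (graphEigenspace A (t : ℂ)) := by
    let f : graphEigenspace A (t : ℂ) →ₗ[ℂ] Y :=
      Y.orthogonalProjectionOnto.toLinearMap ∘ₗ (graphEigenspace A (t : ℂ)).subtype
    refine FiniteDimensional.of_injective f ?_
    rw [injective_iff_map_eq_zero]
    rintro ⟨u, hu⟩ h0
    have h1 : u ∈ Yᗮ := Submodule.orthogonalProjectionOnto_eq_zero_iff.1 h0
    have h2 := hbelow (u, (t : ℂ) • u) hu h1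
    simp only [sub_self, norm_zero] at h2
    have h3 : ‖u‖ ≤ 0 := by nlinarith [norm_nonneg u]
    exact Subtype.ext (norm_le_zero_iff.1 h3)
  refine ⟨hEfin, ?_⟩
  have hAcl := isClosed_of_eq_adjoint hA
  have : CompleteSpace A := hAcl.completeSpace_coe
  let T : A →L[ℂ] H := shiftMap H t ∘L A.subtypeL
  have hT : ∀ p : A, T p = p.1.2 - (t : ℂ) • p.1.1 := fun p => rfl
  have hrange : IsClosed (LinearMap.range T.toLinearMap : Set H) := by
    have h := isClosed_map_shiftMap_of_bounded_below hAcl t hXA (half_pos hc₀) hbelow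
    rwa [← A.range_subtype, ← LinearMap.range_comp] at h
  have : CompleteSpace (LinearMap.range T.toLinearMap) := hrange.completeSpace_coe
  obtain ⟨C, hC, hpre⟩ := ContinuousLinearMap.exists_preimage_norm_le T.rangeRestrict
    (LinearMap.surjective_rangeRestrict T.toLinearMap)
  refine ⟨C⁻¹, inv_pos.2 hC, fun p hp hpE => ?_⟩
  obtain ⟨q, hq, hqC⟩ := hpre ⟨T ⟨p, hp⟩, ⟨p, hp⟩, rfl⟩
  have hTq : T q = T ⟨p, hp⟩ := congrArg Subtype.val hq
  have hmem : p.1 - q.1.1 ∈ graphEigenspace A (t : ℂ) := by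
    have h1 : p - q.1 ∈ A := A.sub_mem hp q.2
    have h2 : p.2 - q.1.2 = (t : ℂ) • (p.1 - q.1.1) := by
      rw [hT, hT] at hTq
      have h3 : p.2 - q.1.2 = (p.2 - (t : ℂ) • p.1) - (q.1.2 - (t : ℂ) • q.1.1)
          + (t : ℂ) • (p.1 - q.1.1) := by rw [smul_sub]; abel
      rw [h3, hTq]; simp
    rw [mem_graphEigenspace, ← h2]
    exact h1
  have h0 : (inner ℂ (p.1 - q.1.1) p.1 : ℂ) = 0 := (Submodule.mem_orthogonal _ _).1 hpE _ hmem
  have h1 : ‖p.1‖ ≤ ‖q.1.1‖ := by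
    rw [inner_sub_left, sub_eq_zero, inner_self_eq_norm_sq_to_K] at h0
    have h2 : ‖p.1‖ ^ 2 ≤ ‖q.1.1‖ * ‖p.1‖ := by
      have := norm_inner_le_norm (𝕜 := ℂ) q.1.1 p.1
      rw [← h0] at this
      simpa using this
    by_cases h3 : ‖p.1‖ = 0
    · rw [h3]; exact norm_nonneg _
    · have h4 : 0 < ‖p.1‖ := lt_of_le_of_ne (norm_nonneg _) (Ne.symm h3)
      nlinarith
  have h2 : ‖q.1.1‖ ≤ ‖q‖ := norm_fst_le q.1
  have h3 : ‖q‖ ≤ C * ‖p.2 - (t : ℂ) • p.1‖ := hqC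
  rw [inv_mul_le_iff₀ hC]
  linarith

end SelfAdjointGraph

/-! ### Spectral gaps and discrete spectrum -/

section SpectralGap

variable {H : Type*} [NormedAddCommGroup H] [InnerProductSpace ℂ H] {A : Submodule ℂ (H × H)}

/-- Finitely many finite-dimensional eigenspaces with eigenvalues in `[-Λ, Λ]` span a space on which
the operator is bounded by `Λ` and whose dimension is the sum of the multiplicities. -/
theorem exists_sum_of_eigenspaces (hA : A = A.adjoint) (K : Finset ℝ) {Λ : ℝ}
    (hK : ∀ t ∈ K, |t| ≤ Λ) (hΛ : 0 ≤ Λ)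
    (hfin : ∀ t ∈ K, FiniteDimensional ℂ (graphEigenspace A (t : ℂ))) :
    ∃ X : Submodule ℂ (H × H), X ≤ A ∧ FiniteDimensional ℂ X ∧ (∀ p ∈ X, ‖p.2‖ ≤ Λ * ‖p.1‖) ∧
      Module.finrank ℂ X = ∑ t ∈ K, Module.finrank ℂ (graphEigenspace A (t : ℂ)) ∧
      ∀ t ∈ K, ∀ u ∈ graphEigenspace A (t : ℂ), (u, (t : ℂ) • u) ∈ X := by
  have hfin' : ∀ t : K, FiniteDimensional ℂ (graphEigenspace A ((t : ℝ) : ℂ)) :=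
    fun t => hfin t t.2
  have horth : OrthogonalFamily ℂ (fun t : K => graphEigenspace A ((t : ℝ) : ℂ))
      fun t => (graphEigenspace A ((t : ℝ) : ℂ)).subtypeₗᵢ := by
    intro s t hst u v
    exact inner_eq_zero_of_mem_graphEigenspace hA (fun h => hst (Subtype.ext h)) u.2 v.2
  let Φ : (∀ t : K, graphEigenspace A ((t : ℝ) : ℂ)) →ₗ[ℂ] H × H :=
    ∑ t : K, (LinearMap.prod LinearMap.id (((t : ℝ) : ℂ) • LinearMap.id)) ∘ₗ
      (graphEigenspace A ((t : ℝ) : ℂ)).subtype ∘ₗ LinearMap.proj t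
  have hΦ1 : ∀ u, (Φ u).1 = ∑ t : K, (u t : H) := fun u => by
    simp [Φ, LinearMap.sum_apply, Prod.fst_sum]
  have hΦ2 : ∀ u, (Φ u).2 = ∑ t : K, ((t : ℝ) : ℂ) • (u t : H) := fun u => by
    simp [Φ, LinearMap.sum_apply, Prod.snd_sum]
  have hn1 : ∀ u, ‖(Φ u).1‖ ^ 2 = ∑ t : K, ‖u t‖ ^ 2 := fun u => by
    rw [hΦ1]; exact horth.norm_sum u Finset.univ
  have hn2 : ∀ u, ‖(Φ u).2‖ ^ 2 = ∑ t : K, |(t : ℝ)| ^ 2 * ‖u t‖ ^ 2 := fun u => by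
    rw [hΦ2]
    have := horth.norm_sum (fun t => ((t : ℝ) : ℂ) • u t) Finset.univ
    simp only [norm_smul, mul_pow, Complex.norm_real, Real.norm_eq_abs] at this
    exact this
  have hinj : Function.Injective Φ := by
    rw [injective_iff_map_eq_zero]
    intro u hu
    have h1 := hn1 u
    rw [hu] at h1
    simp only [Prod.fst_zero, norm_zero, ne_eq, OfNat.ofNat_ne_zero, not_false_eq_true,
      zero_pow] at h1
    have h2 := (Finset.sum_eq_zero_iff_of_nonneg (fun t _ => sq_nonneg ‖u t‖)).1 h1.symm
    funext t
    simpa using h2 t (Finset.mem_univ _)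
  refine ⟨LinearMap.range Φ, ?_, inferInstance, ?_, ?_, ?_⟩
  · rintro _ ⟨u, rfl⟩
    simp only [Φ, LinearMap.sum_apply]
    exact Submodule.sum_mem _ fun t _ => (u t).2
  · rintro _ ⟨u, rfl⟩
    refine le_of_sq_le_sq ?_ (by positivity)
    rw [mul_pow, hn1, hn2, Finset.mul_sum]
    gcongr with t
    exact hK t t.2
  · rw [LinearMap.finrank_range_of_inj hinj, Module.finrank_pi_fintype]
    exact Finset.sum_coe_sort K fun t => Module.finrank ℂ (graphEigenspace A (t : ℂ))
  · intro t ht u hu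
    refine ⟨Pi.single ⟨t, ht⟩ ⟨u, hu⟩, Prod.ext ?_ ?_⟩
    · rw [hΦ1, Finset.sum_eq_single ⟨t, ht⟩]
      · simp
      · intro s _ hs; simp [Pi.single_eq_of_ne hs]
      · simp
    · rw [hΦ2, Finset.sum_eq_single ⟨t, ht⟩]
      · simp
      · intro s _ hs; simp [Pi.single_eq_of_ne hs]
      · simp

theorem graph_mem_of_resolvent {s : ℂ} {R : H →L[ℂ] H}
    (hR : ∀ u w : H, (u, w) ∈ A ↔ R (w - s • u) = u) (v : H) : (R v, v + s • R v) ∈ A := by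
  rw [hR, add_sub_cancel_right]

/-- The spectral mapping theorem for the resolvent `R = (T - s)⁻¹`: a nonzero `x` in the spectrum of
`R` comes from the point `s + 1/x` of the spectrum of `T`. -/
theorem mem_graphSpectrum_of_mem_spectrum_resolvent {s : ℝ} {R : H →L[ℂ] H}
    (hR : ∀ u w : H, (u, w) ∈ A ↔ R (w - (s : ℂ) • u) = u) {x : ℝ} (hx : x ≠ 0)
    (hxR : x ∈ spectrum ℝ R) : ((s + x⁻¹ : ℝ) : ℂ) ∈ graphSpectrum A := by
  by_contra hcon
  rw [graphSpectrum, notMem_compl_iff] at hcon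
  obtain ⟨Q, hQ⟩ := hcon
  refine hxR ?_
  have h1 : ∀ v, R v + (x : ℂ)⁻¹ • R (Q v) = Q v := fun v => by
    have := (hR _ _).1 (graph_mem_of_resolvent hQ v)
    rw [← map_smul, ← map_add, ← this]
    congr 1
    rw [this]
    push_cast
    rw [add_smul]; abel
  have h2 : ∀ v, Q v - (x : ℂ)⁻¹ • Q (R v) = R v := fun v => by
    have := (hQ _ _).1 (graph_mem_of_resolvent hR v)
    rw [← map_smul, ← map_sub, ← this]
    congr 1
    rw [this]
    push_cast
    rw [add_smul]; abel
  have hxc : (x : ℂ) ≠ 0 := by exact_mod_cast hx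
  refine isUnit_iff_exists.2 ⟨(x : ℂ)⁻¹ • (1 + (x : ℂ)⁻¹ • Q), ?_, ?_⟩
  · ext v
    have h3 : R v = Q v - (x : ℂ)⁻¹ • R (Q v) := eq_sub_of_add_eq (h1 v)
    simp only [mul_apply_eq_comp, sub_apply, Algebra.algebraMap_eq_smul_one, smul_apply,
      one_apply_eq_self, add_apply, smul_add, map_add, map_smul]
    rw [h3, ← Complex.coe_smul, ← Complex.coe_smul]
    match_scalars <;> field_simp <;> ring
  · ext v
    have h3 : Q v = R v + (x : ℂ)⁻¹ • Q (R v) := eq_add_of_sub_eq (h2 v)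
    simp only [mul_apply_eq_comp, sub_apply, Algebra.algebraMap_eq_smul_one, smul_apply,
      one_apply_eq_self, add_apply, map_sub]
    rw [← Complex.coe_smul, map_smul, h3]
    match_scalars <;> field_simp <;> ring

variable [CompleteSpace H]

theorem resolvent_isSelfAdjoint (hA : A = A.adjoint) {s : ℝ} {R : H →L[ℂ] H}
    (hR : ∀ u w : H, (u, w) ∈ A ↔ R (w - (s : ℂ) • u) = u) : IsSelfAdjoint R := by
  rw [ContinuousLinearMap.isSelfAdjoint_iff_isSymmetric]
  intro v w
  have h := inner_comm_of_eq_adjoint hA (graph_mem_of_resolvent hR v) (graph_mem_of_resolvent hR w)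
  simp only [inner_add_left, inner_add_right, inner_smul_left, inner_smul_right,
    Complex.conj_ofReal] at h
  exact (add_right_cancel h).symm

/-- The spectral projection of a self-adjoint operator for an isolated point of the spectrum maps
onto eigenvectors. -/
theorem exists_eigenprojection {R : H →L[ℂ] H} (hR : IsSelfAdjoint R) {x : ℝ}
    (hx : ∃ ε > 0, ∀ y ∈ spectrum ℝ R, |y - x| < ε → y = x) :
    ContinuousOn (fun y : ℝ => if y = x then (1 : ℝ) else 0) (spectrum ℝ R) ∧
      (∀ v, R (cfc (fun y : ℝ => if y = x then (1 : ℝ) else 0) R v) =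
        (x : ℂ) • cfc (fun y : ℝ => if y = x then (1 : ℝ) else 0) R v) ∧
      (∀ v, cfc (fun y : ℝ => if y = x then (1 : ℝ) else 0) R (R v) =
        (x : ℂ) • cfc (fun y : ℝ => if y = x then (1 : ℝ) else 0) R v) := by
  set f : ℝ → ℝ := fun y => if y = x then (1 : ℝ) else 0 with hf
  have hcont : ContinuousOn f (spectrum ℝ R) := by
    obtain ⟨ε, hε, hiso⟩ := hx
    intro y hy
    by_cases hyx : y = x
    · subst hyx
      refine (continuousWithinAt_const (b := (1 : ℝ))).congr_of_eventuallyEq ?_ (by simp [hf])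
      filter_upwards [self_mem_nhdsWithin,
        mem_nhdsWithin_of_mem_nhds (Metric.ball_mem_nhds y hε)] with z hz hz2
      simp [hf, hiso z hz (by simpa [Real.dist_eq] using hz2)]
    · refine (continuousWithinAt_const (b := (0 : ℝ))).congr_of_eventuallyEq ?_ (by simp [hf, hyx])
      filter_upwards [mem_nhdsWithin_of_mem_nhds (isOpen_ne.mem_nhds hyx)] with z hz
      simp only [hf]
      rw [if_neg hz]
  have hmul : ∀ y : ℝ, y * f y = x * f y := by
    intro y
    by_cases hyx : y = x
    · rw [hyx]
    · simp [hf, hyx]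
  have h1 : R * cfc f R = x • cfc f R := by
    calc R * cfc f R = cfc (fun y : ℝ => y) R * cfc f R := by rw [cfc_id' ℝ R]
      _ = cfc (fun y => y * f y) R := (cfc_mul _ _ R).symm
      _ = cfc (fun y => x * f y) R := by simp_rw [hmul]
      _ = x • cfc f R := cfc_const_mul x f R
  have h2 : cfc f R * R = x • cfc f R := by
    have h3 := (cfc_commute_cfc f (fun y : ℝ => y) R).eq
    rw [cfc_id' ℝ R] at h3
    rw [h3, h1]
  refine ⟨hcont, fun v => ?_, fun v => ?_⟩
  · have := congrArg (fun T : H →L[ℂ] H => T v) h1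
    simpa [Complex.coe_smul] using this
  · have := congrArg (fun T : H →L[ℂ] H => T v) h2
    simpa [Complex.coe_smul] using this

/-- Outside the finitely many eigenspaces in a gap of the spectrum, a self-adjoint operator is
bounded below by the size of the gap. If `R = (T - Λ)⁻¹`, `u = R v` and `w = T u`, then
`‖w‖² - Λ² ‖u‖² = ⟪(1 + 2 Λ R) v, v⟫`, and `1 + 2 Λ x` is nonnegative on the spectrum of `R` except at
the points that come from the discrete spectrum, whose spectral projections annihilate `v`. -/
theorem exists_eigenvalues_of_gap (hA : A = A.adjoint) {Λ₀ Λ : ℝ} (hΛ₀ : 0 ≤ Λ₀) (hΛ : Λ₀ < Λ)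
    (hdisc : HasOnlyDiscreteSpectrum A Λ₀)
    (hgap : {t : ℝ | (t : ℂ) ∈ graphSpectrum A} ∩ (Ico (-Λ) (-Λ₀) ∪ Ioc Λ₀ Λ) = ∅) :
    ∃ K : Finset ℝ, (∀ t ∈ K, t ∈ Icc (-Λ₀) Λ₀ ∧ (t : ℂ) ∈ graphSpectrum A) ∧
      (∀ t ∈ Icc (-Λ₀) Λ₀, t ∉ K → graphEigenspace A (t : ℂ) = ⊥) ∧
      ∀ p ∈ A, (∀ t ∈ K, p.1 ∈ (graphEigenspace A (t : ℂ))ᗮ) → Λ * ‖p.1‖ ≤ ‖p.2‖ := by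
  have hΛpos : 0 < Λ := hΛ₀.trans_lt hΛ
  have hnot : ∀ t : ℝ, (t : ℂ) ∈ graphSpectrum A → t ∉ Ico (-Λ) (-Λ₀) ∪ Ioc Λ₀ Λ :=
    fun t ht ht2 => (Set.ext_iff.1 hgap t).1 ⟨ht, ht2⟩
  obtain ⟨R, hR⟩ : ∃ R : H →L[ℂ] H, ∀ u w : H, (u, w) ∈ A ↔ R (w - (Λ : ℂ) • u) = u := by
    by_contra hcon
    exact hnot Λ hcon (Or.inr ⟨hΛ, le_rfl⟩)
  have hRsa := resolvent_isSelfAdjoint hA hR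
  -- The points of `[-Λ₀, Λ₀]` correspond to the interval `[a, b]` on the side of the resolvent.
  set a : ℝ := -(Λ - Λ₀)⁻¹ with ha
  set b : ℝ := -(Λ + Λ₀)⁻¹ with hb
  have hb0 : b < 0 := by rw [hb]; simp; linarith
  have hconv : ∀ x ∈ Icc a b, x ≠ 0 ∧ Λ + x⁻¹ ∈ Icc (-Λ₀) Λ₀ := by
    rintro x ⟨hx1, hx2⟩
    have hx0 : x < 0 := hx2.trans_lt hb0
    have h1 : (Λ + Λ₀)⁻¹ ≤ -x := by linarith
    have h2 : -x ≤ (Λ - Λ₀)⁻¹ := by linarith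
    have h3 := inv_anti₀ (inv_pos.2 (by linarith)) h1
    have h4 := inv_anti₀ (by linarith : 0 < -x) h2
    rw [inv_inv, inv_neg] at h3 h4
    exact ⟨hx0.ne, by linarith, by linarith⟩
  have hconv' : ∀ x : ℝ, x ≠ 0 → Λ + x⁻¹ ∈ Icc (-Λ₀) Λ₀ → x ∈ Icc a b := by
    rintro x hx ⟨h1, h2⟩
    have h3 : x⁻¹ < 0 := by linarith
    have hx0 : x < 0 := inv_lt_zero.1 h3
    have h4 : Λ - Λ₀ ≤ (-x)⁻¹ := by rw [inv_neg]; linarith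
    have h5 : (-x)⁻¹ ≤ Λ + Λ₀ := by rw [inv_neg]; linarith
    have h6 := inv_anti₀ (by linarith) h4
    have h7 := inv_anti₀ (inv_pos.2 (by linarith)) h5
    rw [inv_inv] at h6 h7
    exact ⟨by linarith, by linarith⟩
  set S : Set ℝ := spectrum ℝ R ∩ Icc a b with hS
  have hiso : ∀ x ∈ S, ∃ ε > 0, ∀ y ∈ spectrum ℝ R, |y - x| < ε → y = x := by
    rintro x ⟨hxR, hxI⟩
    obtain ⟨hx0, hxt⟩ := hconv x hxI
    obtain ⟨-, -, ε, hε, hiso⟩ := hdisc _ hxt (mem_graphSpectrum_of_mem_spectrum_resolvent hR hx0 hxR)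
    have h1 : ContinuousAt (fun y : ℝ => Λ + y⁻¹) x := by fun_prop (disch := exact hx0)
    have h2 : ∀ᶠ y in 𝓝 x, y ≠ 0 ∧ |(Λ + y⁻¹) - (Λ + x⁻¹)| < ε :=
      Filter.Eventually.and (isOpen_ne.mem_nhds hx0)
        (by simpa [Real.dist_eq] using h1.eventually (Metric.ball_mem_nhds _ hε))
    obtain ⟨δ, hδ, hball⟩ := Metric.eventually_nhds_iff.1 h2
    refine ⟨δ, hδ, fun y hy hyx => ?_⟩
    obtain ⟨hy0, hyε⟩ := hball (by rwa [Real.dist_eq])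
    have h3 := hiso _ (mem_graphSpectrum_of_mem_spectrum_resolvent hR hy0 hy)
      (by rwa [← Complex.ofReal_sub, Complex.norm_real, Real.norm_eq_abs])
    exact inv_injective (add_left_cancel (Complex.ofReal_injective h3))
  have hSfin : S.Finite := by
    have hcomp : IsCompact S := (spectrum.isCompact (𝕜 := ℝ) R).inter_right isClosed_Icc
    choose! ε hε hεS using hiso
    obtain ⟨F, hFS, hcover⟩ := hcomp.elim_nhds_subcover (fun x => Metric.ball x (ε x))
      fun x hx => Metric.ball_mem_nhds x (hε x hx)
    refine F.finite_toSet.subset fun y hy => ?_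
    obtain ⟨x, hx, hyx⟩ := mem_iUnion₂.1 (hcover hy)
    rw [hεS x (hFS x hx) y hy.1 (by simpa [Real.dist_eq] using hyx)]
    exact hx
  set F : Finset ℝ := hSfin.toFinset with hF
  have hFS : ∀ x, x ∈ F ↔ x ∈ S := fun x => hSfin.mem_toFinset
  let P : ℝ → H →L[ℂ] H := fun x => cfc (fun y : ℝ => if y = x then (1 : ℝ) else 0) R
  have hP := fun x (hx : x ∈ S) => exists_eigenprojection hRsa (hiso x hx)
  have hmem : ∀ x : ℝ, x ≠ 0 → ∀ v, v ∈ graphEigenspace A ((Λ + x⁻¹ : ℝ) : ℂ) ↔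
      R v = (x : ℂ) • v := by
    intro x hx v
    have hxc : (x : ℂ) ≠ 0 := by exact_mod_cast hx
    rw [mem_graphEigenspace, hR, ← sub_smul]
    push_cast
    rw [add_sub_cancel_left, map_smul, inv_smul_eq_iff₀ hxc]
  refine ⟨F.image fun x => Λ + x⁻¹, ?_, ?_, ?_⟩
  · intro t ht
    obtain ⟨x, hx, rfl⟩ := Finset.mem_image.1 ht
    obtain ⟨hxR, hxI⟩ := (hFS x).1 hx
    obtain ⟨hx0, hxt⟩ := hconv x hxI
    exact ⟨hxt, mem_graphSpectrum_of_mem_spectrum_resolvent hR hx0 hxR⟩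
  · intro t ht htK
    by_contra hne
    obtain ⟨v, hv, hv0⟩ := (Submodule.ne_bot_iff _).1 hne
    have htΛ : t - Λ ≠ 0 := by have := ht.2; linarith
    set x : ℝ := (t - Λ)⁻¹ with hx
    have hx0 : x ≠ 0 := inv_ne_zero htΛ
    have htx : t = Λ + x⁻¹ := by rw [hx, inv_inv]; ring
    refine htK (Finset.mem_image.2 ⟨x, (hFS x).2 ⟨?_, hconv' x hx0 (htx ▸ ht)⟩, htx.symm⟩)
    rw [htx, hmem x hx0] at hv
    intro hunit
    obtain ⟨B, -, hB⟩ := isUnit_iff_exists.1 hunit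
    refine hv0 ?_
    have h1 := congrArg (fun T : H →L[ℂ] H => T v) hB
    simp only [mul_apply_eq_comp, sub_apply, Algebra.algebraMap_eq_smul_one, smul_apply,
      one_apply_eq_self, hv, Complex.coe_smul, sub_self, map_zero] at h1
    exact h1.symm
  · intro p hp hpK
    set v := p.2 - (Λ : ℂ) • p.1 with hv
    have hRv : R v = p.1 := (hR _ _).1 hp
    have hPv : ∀ x ∈ F, P x v = 0 := by
      intro x hx
      have hxS := (hFS x).1 hx
      obtain ⟨hx0, -⟩ := hconv x hxS.2
      obtain ⟨-, h1, h2⟩ := hP x hxS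
      have hsa : (P x).toLinearMap.IsSymmetric :=
        ContinuousLinearMap.isSelfAdjoint_iff_isSymmetric.1 (cfc_predicate _ R)
      have h3 : P x p.1 = 0 := by
        have h4 : (inner ℂ (P x (P x p.1)) p.1 : ℂ) = 0 :=
          (Submodule.mem_orthogonal _ _).1 (hpK _ (Finset.mem_image_of_mem _ hx)) _
            ((hmem x hx0 _).2 (h1 _))
        have h5 := hsa (P x p.1) p.1
        simp only [ContinuousLinearMap.coe_coe] at h5
        rw [h4] at h5
        exact inner_self_eq_zero.1 h5.symm
      have h4 := h2 v
      rw [hRv] at h4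
      have h5 : (x : ℂ) • P x v = 0 := h4.symm.trans h3
      exact (smul_eq_zero.1 h5).resolve_left (by exact_mod_cast hx0)
    -- `2 Λ |a|` is large enough to make `1 + 2 Λ y + M` nonnegative for all `y ≥ a`
    set M : ℝ := 2 * Λ * |a| with hM
    let h : ℝ → ℝ := fun y => (1 + 2 * Λ * y) + ∑ x ∈ F, M * (if y = x then (1 : ℝ) else 0)
    have hpos : ∀ y ∈ spectrum ℝ R, 0 ≤ h y := by
      intro y hy
      have hM0 : 0 ≤ M := by positivity
      by_cases hyF : y ∈ F
      · have h1 : ∑ x ∈ F, M * (if y = x then (1 : ℝ) else 0) = M := by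
          simp [hyF]
        have h2 := ((hFS y).1 hyF).2.1
        simp only [h]
        rw [h1, hM]
        have := neg_abs_le a
        nlinarith
      · have h1 : 0 ≤ ∑ x ∈ F, M * (if y = x then (1 : ℝ) else 0) :=
          Finset.sum_nonneg fun x _ => mul_nonneg hM0 (by split_ifs <;> norm_num)
        have h2 : 0 ≤ 1 + 2 * Λ * y := by
          by_contra! hneg
          have hy0 : y < 0 := by
            by_contra! h0
            nlinarith [mul_nonneg hΛpos.le h0]
          have h3 := mem_graphSpectrum_of_mem_spectrum_resolvent hR hy0.ne hy
          have h4 : y⁻¹ < 0 := inv_lt_zero.2 hy0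
          have h5 : y * y⁻¹ = 1 := mul_inv_cancel₀ hy0.ne
          have h6 : -(2 * Λ) < y⁻¹ := by nlinarith
          refine hyF ((hFS y).2 ⟨hy, hconv' y hy0.ne ?_⟩)
          have h7 := hnot _ h3
          simp only [mem_union, mem_Ico, mem_Ioc, not_or, not_and, not_lt, not_le] at h7
          constructor
          · exact h7.1 (by linarith)
          · by_contra! h8
            linarith [h7.2 h8]
        exact add_nonneg h2 h1
    have hc1 : ∀ x ∈ F, ContinuousOn (fun y : ℝ => M * (if y = x then (1 : ℝ) else 0))
        (spectrum ℝ R) := fun x hx => ((hP x ((hFS x).1 hx)).1).const_smul M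
    have hcfc : cfc h R = (1 + (2 * Λ) • R) + ∑ x ∈ F, M • P x := by
      have h0 : cfc (fun y : ℝ => 1 + 2 * Λ * y) R = 1 + (2 * Λ) • R := by
        rw [cfc_add .., cfc_const_one ℝ R, cfc_const_mul .., cfc_id' ℝ R]
      have h1 : h = fun y => (fun y => 1 + 2 * Λ * y) y
          + (fun y => ∑ x ∈ F, M * (if y = x then (1 : ℝ) else 0)) y := rfl
      rw [h1, cfc_add (hf := by fun_prop) (hg := continuousOn_finsetSum _ hc1), h0]
      congr 1
      have h2 : (fun y => ∑ x ∈ F, M * (if y = x then (1 : ℝ) else 0))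
          = ∑ x ∈ F, fun y => M * (if y = x then (1 : ℝ) else 0) := by
        funext y; simp only [Finset.sum_apply]
      rw [h2, cfc_sum _ _ _ hc1]
      refine Finset.sum_congr rfl fun x hx => ?_
      exact cfc_const_mul M _ R (hP x ((hFS x).1 hx)).1
    have hcfcpos : 0 ≤ cfc h R := cfc_nonneg hpos
    have h1 := ((ContinuousLinearMap.nonneg_iff_isPositive _).1 hcfcpos).inner_nonneg_right v
    have h2 : cfc h R v = v + ((2 * Λ : ℝ) : ℂ) • p.1 := by
      rw [hcfc]
      simp only [add_apply, one_apply_eq_self, smul_apply, hRv, sum_apply]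
      rw [Finset.sum_eq_zero fun x hx => by rw [hPv x hx, smul_zero], add_zero, Complex.coe_smul]
    rw [h2] at h1
    have h3 : 0 ≤ ‖v‖ ^ 2 + 2 * Λ * RCLike.re (inner ℂ v p.1 : ℂ) := by
      have := (RCLike.nonneg_iff.1 h1).1
      rw [inner_add_right, inner_smul_right, inner_self_eq_norm_sq_to_K, map_add] at this
      have h5 : RCLike.re (((2 * Λ : ℝ) : ℂ) * inner ℂ v p.1) =
        2 * Λ * RCLike.re (inner ℂ v p.1 : ℂ) := Complex.re_ofReal_mul _ _
      rw [h5] at this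
      refine this.trans_eq ?_
      norm_cast
    have h4 : p.2 = v + (Λ : ℂ) • p.1 := by rw [hv, sub_add_cancel]
    refine le_of_sq_le_sq ?_ (norm_nonneg _)
    rw [h4, norm_add_sq (𝕜 := ℂ), inner_smul_right, norm_smul, Complex.norm_real, Real.norm_eq_abs,
      abs_of_pos hΛpos]
    have h5 : RCLike.re ((Λ : ℂ) * inner ℂ v p.1) = Λ * RCLike.re (inner ℂ v p.1 : ℂ) :=
      Complex.re_ofReal_mul _ _
    rw [h5]
    nlinarith

/-- The form in which a gap of the spectrum is used: a space `X` whose dimension is the number of the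
eigenvalues in `[-Λ₀, Λ₀]`, on which the operator is bounded by `Λ₀`, and off which it is bounded
below by `Λ`. -/
theorem exists_eigenspace_sum_of_gap (hA : A = A.adjoint) {Λ₀ Λ : ℝ} (hΛ₀ : 0 ≤ Λ₀) (hΛ : Λ₀ < Λ)
    (hdisc : HasOnlyDiscreteSpectrum A Λ₀)
    (hgap : {t : ℝ | (t : ℂ) ∈ graphSpectrum A} ∩ (Ico (-Λ) (-Λ₀) ∪ Ioc Λ₀ Λ) = ∅) :
    ∃ X : Submodule ℂ (H × H), X ≤ A ∧ FiniteDimensional ℂ X ∧ (∀ p ∈ X, ‖p.2‖ ≤ Λ₀ * ‖p.1‖) ∧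
      Module.finrank ℂ X = eigenvalueCount A Λ₀ ∧
      ∀ p ∈ A, p.1 ∈ (X.map (LinearMap.fst ℂ H H))ᗮ → Λ * ‖p.1‖ ≤ ‖p.2‖ := by
  obtain ⟨K, hK, hKbot, hbelow⟩ := exists_eigenvalues_of_gap hA hΛ₀ hΛ hdisc hgap
  obtain ⟨X, hXA, hX, hXbd, hXrank, hXmem⟩ := exists_sum_of_eigenspaces hA K
    (fun t ht => abs_le.2 (hK t ht).1) hΛ₀ fun t ht => (hdisc t (hK t ht).1 (hK t ht).2).2.1
  refine ⟨X, hXA, hX, hXbd, ?_, fun p hp hpX => hbelow p hp fun t ht => ?_⟩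
  · rw [hXrank, eigenvalueCount]
    symm
    refine finsum_mem_eq_sum_of_subset _ ?_ fun t ht => (hK t ht).1
    rintro t ⟨ht, ht2⟩
    by_contra htK
    refine ht2 ?_
    change Module.finrank ℂ (graphEigenspace A (t : ℂ)) = 0
    rw [hKbot t ht htK, finrank_bot]
  · rw [Submodule.mem_orthogonal] at hpX ⊢
    exact fun u hu => hpX u ⟨_, hXmem t ht u hu, rfl⟩

/-- If the spaces on which a self-adjoint operator is bounded by `Λ'` have bounded dimension, then
there is only discrete spectrum in `[-Λ₁, Λ₁]` for `Λ₁ < Λ'`, and no spectrum just outside. -/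
theorem hasOnlyDiscreteSpectrum_of_finrank_le (hA : A = A.adjoint) {Λ₁ Λ' : ℝ} (hΛ₁ : 0 ≤ Λ₁)
    (hΛ : Λ₁ < Λ') (N : ℕ)
    (hN : ∀ X : Submodule ℂ (H × H), X ≤ A → FiniteDimensional ℂ X →
      (∀ p ∈ X, ‖p.2‖ ≤ Λ' * ‖p.1‖) → Module.finrank ℂ X ≤ N) :
    HasOnlyDiscreteSpectrum A Λ₁ ∧ ∃ Λ > Λ₁,
      {t : ℝ | (t : ℂ) ∈ graphSpectrum A} ∩ (Ico (-Λ) (-Λ₁) ∪ Ioc Λ₁ Λ) = ∅ := by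
  have key : ∀ t ∈ Icc (-Λ₁) Λ₁, FiniteDimensional ℂ (graphEigenspace A (t : ℂ)) ∧ ∃ c > 0,
      ∀ p ∈ A, p.1 ∈ (graphEigenspace A (t : ℂ))ᗮ → c * ‖p.1‖ ≤ ‖p.2 - (t : ℂ) • p.1‖ := by
    intro t ht
    refine bounded_below_of_finrank_le hA t (sub_pos.2 hΛ) N fun X hXA hX hXbd =>
      hN X hXA hX fun p hp => ?_
    have h1 : p.2 = (p.2 - (t : ℂ) • p.1) + (t : ℂ) • p.1 := by abel
    have h2 : ‖(t : ℂ) • p.1‖ ≤ Λ₁ * ‖p.1‖ := by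
      rw [norm_smul, Complex.norm_real]
      exact mul_le_mul_of_nonneg_right (abs_le.2 ht) (norm_nonneg _)
    have h3 := hXbd p hp
    have h4 := norm_add_le (p.2 - (t : ℂ) • p.1) ((t : ℂ) • p.1)
    rw [← h1] at h4
    linarith
  refine ⟨fun t ht htA => ?_, ?_⟩
  · obtain ⟨hfin, c, hc, hbd⟩ := key t ht
    refine ⟨fun hbot => ?_, hfin, c / 2, half_pos hc, fun w hw hwt => ?_⟩
    · refine notMem_graphSpectrum_of_bounded_below hA hc (fun p hp => ?_) (fun p hp => ?_) htA
      · exact hbd p hp (by rw [hbot]; simp)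
      · rw [Complex.conj_ofReal]
        exact hbd p hp (by rw [hbot]; simp)
    · by_contra hne
      exact notMem_graphSpectrum_of_near hA t hbd hne hwt.le hw
  · obtain ⟨hfin, c, hc, hbd⟩ := key Λ₁ ⟨by linarith, le_rfl⟩
    obtain ⟨hfin', c', hc', hbd'⟩ := key (-Λ₁) ⟨le_rfl, by linarith⟩
    refine ⟨Λ₁ + min (c / 2) (c' / 2), lt_add_of_pos_right _ (lt_min (half_pos hc) (half_pos hc')), ?_⟩
    rw [Set.eq_empty_iff_forall_notMem]
    rintro t ⟨ht, (⟨h1, h2⟩ | ⟨h1, h2⟩)⟩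
    · refine notMem_graphSpectrum_of_near hA (-Λ₁) hbd' ?_ ?_ ht
      · exact_mod_cast h2.ne
      · rw [← Complex.ofReal_sub, Complex.norm_real, Real.norm_eq_abs, abs_le]
        have := min_le_right (c / 2) (c' / 2)
        constructor <;> linarith
    · refine notMem_graphSpectrum_of_near hA Λ₁ hbd ?_ ?_ ht
      · exact_mod_cast h1.ne'
      · rw [← Complex.ofReal_sub, Complex.norm_real, Real.norm_eq_abs, abs_le]
        have := min_le_left (c / 2) (c' / 2)
        constructor <;> linarith

end SpectralGap

/-! ### Comparison of two operators -/

section Comparison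

variable {H : Type*} [NormedAddCommGroup H] [InnerProductSpace ℂ H] {A : Submodule ℂ (H × H)}
  {H' : Type*} [NormedAddCommGroup H'] [InnerProductSpace ℂ H'] {A' : Submodule ℂ (H' × H')}

/-- The linear map `J` from the domain of `T` to the domain of `T'` (with graphs `A` and `A'`)
diminishes `‖u‖²` by at most `q(u)` and increases `‖T u‖²` by at most `C² q(u)`, where
`q(u) = (‖T u‖² + C² ‖u‖²) / m²`. -/
def IsAlmostIsometry (C m : ℝ) (J : A →ₗ[ℂ] A') : Prop :=
  ∀ p : A, m ^ 2 * ‖p.1.1‖ ^ 2 ≤ m ^ 2 * ‖(J p).1.1‖ ^ 2 + (‖p.1.2‖ ^ 2 + C ^ 2 * ‖p.1.1‖ ^ 2) ∧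
    m ^ 2 * ‖(J p).1.2‖ ^ 2 ≤ m ^ 2 * ‖p.1.2‖ ^ 2 + C ^ 2 * (‖p.1.2‖ ^ 2 + C ^ 2 * ‖p.1.1‖ ^ 2)

/-- A space on which `T` is bounded by `a` is mapped to a space on which `T'` is bounded by less than
`b`, so it meets trivially every space on which `T'` is bounded below by `b`. -/
theorem IsAlmostIsometry.finrank_le {C m : ℝ} {J : A →ₗ[ℂ] A'} (hJ : IsAlmostIsometry C m J)
    {a b : ℝ} (ha : 0 ≤ a) (hab : a < b)
    (hm : (C ^ 2 + b ^ 2) * (C ^ 2 + a ^ 2) < m ^ 2 * (b ^ 2 - a ^ 2))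
    {X : Submodule ℂ (H × H)} (hXA : X ≤ A)
    (hXbd : ∀ p ∈ X, ‖p.2‖ ≤ a * ‖p.1‖)
    {X' : Submodule ℂ (H' × H')} [FiniteDimensional ℂ X']
    (hX' : ∀ p ∈ A', p.1 ∈ (X'.map (LinearMap.fst ℂ H' H'))ᗮ → b * ‖p.1‖ ≤ ‖p.2‖) :
    Module.finrank ℂ X ≤ Module.finrank ℂ X' := by
  set Y := X'.map (LinearMap.fst ℂ H' H')
  let f : X →ₗ[ℂ] Y := Y.orthogonalProjectionOnto.toLinearMap ∘ₗ LinearMap.fst ℂ H' H' ∘ₗ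
    A'.subtype ∘ₗ J ∘ₗ Submodule.inclusion hXA
  have hf : Function.Injective f := by
    rw [injective_iff_map_eq_zero]
    rintro ⟨p, hp⟩ h0
    set q := J ⟨p, hXA hp⟩ with hq
    have h1 : q.1.1 ∈ Yᗮ := Submodule.orthogonalProjectionOnto_eq_zero_iff.1 h0
    have h2 := hX' q.1 q.2 h1
    have h3 := hXbd p hp
    obtain ⟨h4, h5⟩ := hJ ⟨p, hXA hp⟩
    rw [← hq] at h4 h5
    have h6 : b ^ 2 * ‖q.1.1‖ ^ 2 ≤ ‖q.1.2‖ ^ 2 := by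
      rw [← mul_pow]
      exact pow_le_pow_left₀ (by have := ha.trans_lt hab; positivity) h2 2
    have h7 : ‖p.2‖ ^ 2 ≤ a ^ 2 * ‖p.1‖ ^ 2 := by
      rw [← mul_pow]
      exact pow_le_pow_left₀ (norm_nonneg _) h3 2
    simp only at h4 h5
    -- `m² b² ‖u‖² ≤ b² (m² ‖J u‖² + …) ≤ m² ‖T' J u‖² + b² (…)`, and `T' J u` is estimated by `T u`
    have h8 : m ^ 2 * (b ^ 2 - a ^ 2) * ‖p.1‖ ^ 2
        ≤ (C ^ 2 + b ^ 2) * (C ^ 2 + a ^ 2) * ‖p.1‖ ^ 2 := by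
      have e1 := mul_le_mul_of_nonneg_left h4 (sq_nonneg b)
      have e2 := mul_le_mul_of_nonneg_left h6 (sq_nonneg m)
      have e3 := mul_le_mul_of_nonneg_left h7 (by positivity : 0 ≤ C ^ 2 + b ^ 2 + m ^ 2)
      nlinarith
    have h9 : ‖p.1‖ ^ 2 ≤ 0 := by
      by_contra! h10
      nlinarith
    have h10 : p.1 = 0 := by
      have := le_antisymm h9 (sq_nonneg _)
      simpa using this
    have h11 : p.2 = 0 := by
      rw [h10, norm_zero, mul_zero] at h3
      exact norm_le_zero_iff.1 h3
    exact Subtype.ext (Prod.ext h10 h11)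
  exact (LinearMap.finrank_le_finrank_of_injective hf).trans (Submodule.finrank_map_le _ _)

variable [CompleteSpace H] [CompleteSpace H']

/-- Two self-adjoint operators between whose domains there are almost isometries in both directions
have the same number of eigenvalues in an interval around zero, provided that there is a gap in the
spectrum of one of them. -/
theorem eigenvalueCount_eq_of_isAlmostIsometry (hA : A = A.adjoint) (hA' : A' = A'.adjoint)
    {C m : ℝ} {J : A →ₗ[ℂ] A'} (hJ : IsAlmostIsometry C m J)
    {J' : A' →ₗ[ℂ] A} (hJ' : IsAlmostIsometry C m J')
    {Λ₀ Λ₁ Λ₂ : ℝ} (h0 : 0 ≤ Λ₀) (h01 : Λ₀ < Λ₁) (h12 : Λ₁ < Λ₂)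
    (hm₁ : (C ^ 2 + Λ₂ ^ 2) * (C ^ 2 + Λ₁ ^ 2) < m ^ 2 * (Λ₂ ^ 2 - Λ₁ ^ 2))
    (hm₀ : (C ^ 2 + Λ₁ ^ 2) * (C ^ 2 + Λ₀ ^ 2) < m ^ 2 * (Λ₁ ^ 2 - Λ₀ ^ 2))
    (hdisc : HasOnlyDiscreteSpectrum A Λ₀)
    (hgap : {t : ℝ | (t : ℂ) ∈ graphSpectrum A} ∩ (Ico (-Λ₂) (-Λ₀) ∪ Ioc Λ₀ Λ₂) = ∅) :
    HasOnlyDiscreteSpectrum A' Λ₁ ∧ eigenvalueCount A' Λ₁ = eigenvalueCount A Λ₀ := by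
  obtain ⟨X, hXA, hX, hXbd, hXrank, hXbelow⟩ :=
    exists_eigenspace_sum_of_gap hA h0 (h01.trans h12) hdisc hgap
  -- the inequality for `Λ₁` still holds slightly above it, which leaves room to exclude essential
  -- spectrum at the end points of `[-Λ₁, Λ₁]`
  obtain ⟨Λ', ⟨hΛ', hΛ'₂⟩, hm'⟩ : ∃ Λ' ∈ Ioo Λ₁ Λ₂,
      (C ^ 2 + Λ₂ ^ 2) * (C ^ 2 + Λ' ^ 2) < m ^ 2 * (Λ₂ ^ 2 - Λ' ^ 2) := by
    have h1 : ∀ᶠ x in 𝓝[>] Λ₁,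
        (C ^ 2 + Λ₂ ^ 2) * (C ^ 2 + x ^ 2) < m ^ 2 * (Λ₂ ^ 2 - x ^ 2) := by
      refine nhdsWithin_le_nhds (ContinuousAt.eventually_lt ?_ ?_ hm₁) <;> fun_prop
    obtain ⟨x, hx, hx2⟩ := (h1.and (Ioo_mem_nhdsGT h12)).exists
    exact ⟨x, hx2, hx⟩
  have hN : ∀ Y : Submodule ℂ (H' × H'), Y ≤ A' → FiniteDimensional ℂ Y →
      (∀ p ∈ Y, ‖p.2‖ ≤ Λ' * ‖p.1‖) → Module.finrank ℂ Y ≤ Module.finrank ℂ X :=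
    fun Y hYA _ hYbd => hJ'.finrank_le (by linarith) hΛ'₂ hm' hYA hYbd hXbelow
  obtain ⟨hdisc', Λ'', hΛ'', hgap'⟩ :=
    hasOnlyDiscreteSpectrum_of_finrank_le hA' (by linarith) hΛ' _ hN
  refine ⟨hdisc', ?_⟩
  obtain ⟨X', hXA', hX', hXbd', hXrank', hXbelow'⟩ :=
    exists_eigenspace_sum_of_gap hA' (by linarith) hΛ'' hdisc' hgap'
  rw [← hXrank, ← hXrank']
  refine le_antisymm (hN X' hXA' hX' fun p hp => (hXbd' p hp).trans ?_) ?_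
  · gcongr
  · refine hJ.finrank_le h0 h01 hm₀ hXA hXbd fun p hp hpX => le_trans ?_ (hXbelow' p hp hpX)
    gcongr

end Comparison

/-! ### Riemannian isometries preserve the volume -/

section Volume

open Manifold

section HausdorffMeasure

variable {X Y : Type*} [EMetricSpace X] [MeasurableSpace X] [BorelSpace X]
  [SecondCountableTopology X] [EMetricSpace Y] [MeasurableSpace Y] [BorelSpace Y]

/-- A map that is locally `1`-Lipschitz on a set does not increase the Hausdorff measure. -/
theorem euclideanHausdorffMeasure_image_le_of_locally {f : X → Y} (d : ℕ) {s : Set X}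
    (hs : MeasurableSet s)
    (hf : ∀ x ∈ s, ∃ V ∈ 𝓝 x, ∀ y ∈ V, ∀ z ∈ V, edist (f y) (f z) ≤ edist y z) :
    (μHE[d] : Measure Y) (f '' s) ≤ μHE[d] s := by
  have hlip : ∀ t : Set X, (∀ y ∈ t, ∀ z ∈ t, edist (f y) (f z) ≤ edist y z) →
      (μHE[d] : Measure Y) (f '' t) ≤ μHE[d] t := by
    intro t ht
    have h1 : LipschitzOnWith 1 f t := fun y hy z hz => by simpa using ht y hy z hz
    have h2 := h1.hausdorffMeasure_image_le (d := (d : ℝ)) (by positivity)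
    simp only [ENNReal.coe_one, ENNReal.one_rpow, one_mul] at h2
    rw [Measure.euclideanHausdorffMeasure_def, Measure.euclideanHausdorffMeasure_def,
      Measure.smul_apply, Measure.smul_apply]
    gcongr
  rcases s.eq_empty_or_nonempty with rfl | ⟨x₀, hx₀⟩
  · simp
  choose! V hV hVf using hf
  obtain ⟨c, hcs, hc, hcov⟩ := TopologicalSpace.countable_cover_nhdsWithin
    (f := fun x => interior (V x)) (s := s)
    fun x hx => mem_nhdsWithin_of_mem_nhds (interior_mem_nhds.2 (hV x hx))
  have hne : c.Nonempty := by
    obtain ⟨i, hi, -⟩ := mem_iUnion₂.1 (hcov hx₀)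
    exact ⟨i, hi⟩
  obtain ⟨g, rfl⟩ := hc.exists_eq_range hne
  -- A decomposition of `s` into countably many disjoint measurable pieces on which `f` is Lipschitz.
  let W : ℕ → Set X := disjointed fun n => interior (V (g n))
  have hW : ∀ n, MeasurableSet (W n) :=
    fun n => MeasurableSet.disjointed (fun n => isOpen_interior.measurableSet) n
  have hsW : s = ⋃ n, s ∩ W n := by
    rw [← inter_iUnion, iUnion_disjointed]
    refine (inter_eq_left.2 ?_).symm
    rwa [biUnion_range] at hcov
  calc (μHE[d] : Measure Y) (f '' s) = μHE[d] (⋃ n, f '' (s ∩ W n)) := by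
        conv_lhs => rw [hsW, image_iUnion]
    _ ≤ ∑' n, μHE[d] (f '' (s ∩ W n)) := measure_iUnion_le _
    _ ≤ ∑' n, μHE[d] (s ∩ W n) := by
        refine ENNReal.tsum_le_tsum fun n => hlip _ fun y hy z hz => ?_
        have h1 : W n ⊆ V (g n) := (disjointed_subset _ n).trans interior_subset
        exact hVf (g n) (hcs ⟨n, rfl⟩) y (h1 hy.2) z (h1 hz.2)
    _ = μHE[d] (⋃ n, s ∩ W n) := by
        refine (measure_iUnion (fun i j hij => ?_) fun n => hs.inter (hW n)).symm
        exact ((disjoint_disjointed _) hij).mono inter_subset_right inter_subset_right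
    _ = μHE[d] s := by rw [← hsW]

end HausdorffMeasure

variable {E : Type*} [NormedAddCommGroup E] [NormedSpace ℝ E]
  {Z : Type*} [EMetricSpace Z] [ChartedSpace E Z]
  {E' : Type*} [NormedAddCommGroup E'] [NormedSpace ℝ E']
  {Z' : Type*} [EMetricSpace Z'] [ChartedSpace E' Z'] {τ : OpenPartialHomeomorph Z Z'}

theorem mfderiv_comp_symm_apply (hτ : ContMDiffOn 𝓘(ℝ, E) 𝓘(ℝ, E') ∞ τ τ.source)
    (hτ' : ContMDiffOn 𝓘(ℝ, E') 𝓘(ℝ, E) ∞ τ.symm τ.target) {y : Z'} (hy : y ∈ τ.target)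
    (v : TangentSpace 𝓘(ℝ, E') y) :
    (mfderiv 𝓘(ℝ, E) 𝓘(ℝ, E') τ (τ.symm y) (mfderiv 𝓘(ℝ, E') 𝓘(ℝ, E) τ.symm y v) : E') = v := by
  have hx := τ.map_target hy
  have h1 : MDifferentiableAt 𝓘(ℝ, E) 𝓘(ℝ, E') τ (τ.symm y) :=
    ((hτ _ hx).contMDiffAt (τ.open_source.mem_nhds hx)).mdifferentiableAt (by simp)
  have h2 : MDifferentiableAt 𝓘(ℝ, E') 𝓘(ℝ, E) τ.symm y :=
    ((hτ' _ hy).contMDiffAt (τ.open_target.mem_nhds hy)).mdifferentiableAt (by simp)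
  have h3 := mfderiv_comp y h1 h2
  have h4 : (τ ∘ τ.symm) =ᶠ[𝓝 y] id := by
    filter_upwards [τ.open_target.mem_nhds hy] with z hz using τ.right_inv hz
  rw [h4.mfderiv_eq, mfderiv_id] at h3
  exact (congrArg (fun T : E' →L[ℝ] E' => T v) h3).symm

theorem finrank_le_of_mfderiv [FiniteDimensional ℝ E]
    (hτ : ContMDiffOn 𝓘(ℝ, E) 𝓘(ℝ, E') ∞ τ τ.source)
    (hτ' : ContMDiffOn 𝓘(ℝ, E') 𝓘(ℝ, E) ∞ τ.symm τ.target) {y : Z'} (hy : y ∈ τ.target) :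
    Module.finrank ℝ E' ≤ Module.finrank ℝ E := by
  refine LinearMap.finrank_le_finrank_of_injective
    (f := (show E' →L[ℝ] E from mfderiv 𝓘(ℝ, E') 𝓘(ℝ, E) τ.symm y).toLinearMap) ?_
  intro v w hvw
  rw [← mfderiv_comp_symm_apply hτ hτ' hy v, ← mfderiv_comp_symm_apply hτ hτ' hy w]
  exact congrArg (fun u : E => (show E →L[ℝ] E' from mfderiv 𝓘(ℝ, E) 𝓘(ℝ, E') τ (τ.symm y)) u) hvw

variable [RiemannianBundle (fun x : Z => TangentSpace 𝓘(ℝ, E) x)]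
  [RiemannianBundle (fun x : Z' => TangentSpace 𝓘(ℝ, E') x)]

theorem norm_mfderiv_symm (hτ : ContMDiffOn 𝓘(ℝ, E) 𝓘(ℝ, E') ∞ τ τ.source)
    (hτ' : ContMDiffOn 𝓘(ℝ, E') 𝓘(ℝ, E) ∞ τ.symm τ.target)
    (hnorm : ∀ x ∈ τ.source, ∀ v : TangentSpace 𝓘(ℝ, E) x,
      ‖mfderiv 𝓘(ℝ, E) 𝓘(ℝ, E') τ x v‖ = ‖v‖)
    {y : Z'} (hy : y ∈ τ.target) (v : TangentSpace 𝓘(ℝ, E') y) :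
    ‖mfderiv 𝓘(ℝ, E') 𝓘(ℝ, E) τ.symm y v‖ = ‖v‖ := by
  rw [← hnorm _ (τ.map_target hy)]
  have h := mfderiv_comp_symm_apply hτ hτ' hy v
  have key : ∀ (z : Z') (hz : z = y) (w : TangentSpace 𝓘(ℝ, E') z), (w : E') = v → ‖w‖ = ‖v‖ := by
    rintro z rfl w hw
    exact congrArg _ hw
  exact key _ (τ.right_inv hy) _ h

variable [IsRiemannianManifold 𝓘(ℝ, E) Z] [IsRiemannianManifold 𝓘(ℝ, E') Z']

/-- A map whose differential is an isometry on a neighbourhood of `x` is `1`-Lipschitz near `x`: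
short paths between points close to `x` stay in this neighbourhood, and their images have the same
length. -/
theorem exists_nhds_edist_le_of_norm_mfderiv {f : Z → Z'} {U : Set Z} (hU : IsOpen U)
    (hf : ContMDiffOn 𝓘(ℝ, E) 𝓘(ℝ, E') ∞ f U)
    (hnorm : ∀ x ∈ U, ∀ v : TangentSpace 𝓘(ℝ, E) x, ‖mfderiv 𝓘(ℝ, E) 𝓘(ℝ, E') f x v‖ = ‖v‖)
    {x : Z} (hx : x ∈ U) :
    ∃ V ∈ 𝓝 x, ∀ y ∈ V, ∀ z ∈ V, edist (f y) (f z) ≤ edist y z := by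
  obtain ⟨r, hr, hrU⟩ := EMetric.isOpen_iff.1 hU x hx
  refine ⟨Metric.eball x (r / 3), Metric.eball_mem_nhds x (ENNReal.div_pos hr.ne' (by simp)), ?_⟩
  intro y hy z hz
  refine le_of_forall_gt fun ρ' hρ' => ?_
  have hyz : edist y z < r / 3 + r / 3 := by
    refine (edist_triangle_right y z x).trans_lt (ENNReal.add_lt_add hy hz)
  set ρ := min ρ' (r / 3 + r / 3) with hρ
  have hyzρ : edist y z < ρ := lt_min hρ' hyz
  rw [IsRiemannianManifold.out (I := 𝓘(ℝ, E)) y z] at hyzρ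
  obtain ⟨γ, hγ0, hγ1, hγ, hlen⟩ := exists_lt_of_riemannianEDist_lt hyzρ
  have hγU : ∀ t ∈ Icc (0 : ℝ) 1, γ t ∈ U := by
    intro t ht
    refine hrU ?_
    have h1 : edist y (γ t) ≤ pathELength 𝓘(ℝ, E) γ 0 t := by
      rw [IsRiemannianManifold.out (I := 𝓘(ℝ, E)) y (γ t)]
      exact riemannianEDist_le_pathELength (hγ.mono (Icc_subset_Icc_right ht.2)) hγ0 rfl ht.1
    have h2 : edist y (γ t) < r / 3 + r / 3 :=
      (h1.trans (pathELength_mono le_rfl ht.2)).trans_lt (hlen.trans_le (min_le_right _ _))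
    calc edist (γ t) x ≤ edist (γ t) y + edist y x := edist_triangle _ _ _
      _ < (r / 3 + r / 3) + r / 3 := by
        rw [edist_comm (γ t)]
        exact ENNReal.add_lt_add h2 hy
      _ = r := ENNReal.add_thirds r
  have hlen' : pathELength 𝓘(ℝ, E') (f ∘ γ) 0 1 = pathELength 𝓘(ℝ, E) γ 0 1 := by
    rw [pathELength_eq_lintegral_mfderiv_Ioo, pathELength_eq_lintegral_mfderiv_Ioo]
    refine setLIntegral_congr_fun measurableSet_Ioo fun t ht => ?_
    have htI := Ioo_subset_Icc_self ht
    have h1 : MDifferentiableAt 𝓘(ℝ, ℝ) 𝓘(ℝ, E) γ t :=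
      ((hγ t htI).contMDiffAt (Icc_mem_nhds ht.1 ht.2)).mdifferentiableAt one_ne_zero
    have h2 : MDifferentiableAt 𝓘(ℝ, E) 𝓘(ℝ, E') f (γ t) :=
      ((hf _ (hγU t htI)).contMDiffAt (hU.mem_nhds (hγU t htI))).mdifferentiableAt (by simp)
    simp only [mfderiv_comp t h2 h1]
    rw [← ofReal_norm, ← ofReal_norm]
    congr 1
    exact hnorm _ (hγU t htI) _
  rw [IsRiemannianManifold.out (I := 𝓘(ℝ, E')) (f y) (f z)]
  have h3 : ContMDiffOn 𝓘(ℝ, ℝ) 𝓘(ℝ, E') 1 (f ∘ γ) (Icc 0 1) :=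
    (hf.of_le (by simp)).comp hγ hγU
  refine (riemannianEDist_le_pathELength h3 (by simp [hγ0]) (by simp [hγ1]) zero_le_one).trans_lt ?_
  rw [hlen']
  exact hlen.trans_le (min_le_left _ _)

/-- A Riemannian isometry between open sets maps the Riemannian volume to the Riemannian volume. -/
theorem map_riemannianVolume_restrict [FiniteDimensional ℝ E] [FiniteDimensional ℝ E']
    [MeasurableSpace Z] [BorelSpace Z] [SecondCountableTopology Z]
    [MeasurableSpace Z'] [BorelSpace Z'] [SecondCountableTopology Z']
    (hτ : ContMDiffOn 𝓘(ℝ, E) 𝓘(ℝ, E') ∞ τ τ.source)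
    (hτ' : ContMDiffOn 𝓘(ℝ, E') 𝓘(ℝ, E) ∞ τ.symm τ.target)
    (hnorm : ∀ x ∈ τ.source, ∀ v : TangentSpace 𝓘(ℝ, E) x,
      ‖mfderiv 𝓘(ℝ, E) 𝓘(ℝ, E') τ x v‖ = ‖v‖) :
    ((riemannianVolume E : Measure Z).restrict τ.source).map τ
      = (riemannianVolume E' : Measure Z').restrict τ.target := by
  rcases τ.source.eq_empty_or_nonempty with hemp | ⟨x₀, hx₀⟩
  · have : τ.target = ∅ := by rw [← τ.image_source_eq_target, hemp, image_empty]
    rw [hemp, this]; simp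
  have hrank : Module.finrank ℝ E' = Module.finrank ℝ E :=
    le_antisymm (finrank_le_of_mfderiv hτ hτ' (τ.map_source hx₀))
      (finrank_le_of_mfderiv (τ := τ.symm) hτ' (by simpa using hτ) (by simpa using hx₀))
  have hmeas : AEMeasurable τ ((riemannianVolume E : Measure Z).restrict τ.source) :=
    τ.continuousOn.aemeasurable τ.open_source.measurableSet
  ext s hs
  rw [Measure.map_apply_of_aemeasurable hmeas hs, Measure.restrict_apply hs,
    Measure.restrict_apply' τ.open_source.measurableSet]
  have hopen : MeasurableSet (τ ⁻¹' s ∩ τ.source) := by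
    rw [inter_comm]
    have h1 := τ.continuousOn.domRestrict.measurable hs
    have h2 := τ.open_source.measurableSet.subtype_image h1
    convert h2 using 1
    ext x; simp [and_comm]
  have himage : τ '' (τ ⁻¹' s ∩ τ.source) = s ∩ τ.target := by
    rw [inter_comm, τ.image_source_inter_eq', inter_comm]
    ext y
    simp only [mem_inter_iff, mem_preimage]
    constructor
    · rintro ⟨h1, h2⟩; exact ⟨by rwa [τ.right_inv h2] at h1, h2⟩
    · rintro ⟨h1, h2⟩; exact ⟨by rwa [τ.right_inv h2], h2⟩
  have himage' : τ.symm '' (s ∩ τ.target) = τ ⁻¹' s ∩ τ.source := by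
    rw [← himage, inter_comm]
    exact τ.symm_image_image_of_subset_source inter_subset_left
  unfold riemannianVolume
  rw [hrank]
  refine le_antisymm ?_ ?_
  · rw [← himage']
    refine euclideanHausdorffMeasure_image_le_of_locally _
      (hs.inter τ.open_target.measurableSet) fun y hy => ?_
    exact exists_nhds_edist_le_of_norm_mfderiv τ.open_target hτ'
      (fun z hz v => norm_mfderiv_symm hτ hτ' hnorm hz v) hy.2
  · rw [← himage]
    refine euclideanHausdorffMeasure_image_le_of_locally _ hopen fun x hx => ?_
    exact exists_nhds_edist_le_of_norm_mfderiv τ.open_source hτ hnorm hx.2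

end Volume

/-! ### Self-adjoint endomorphisms of finite-dimensional spaces -/

section Endomorphisms

variable {V : Type*} [NormedAddCommGroup V] [InnerProductSpace ℂ V] [FiniteDimensional ℂ V]

theorem norm_apply_le_of_eigenvalues {T : Module.End ℂ V} (hT : T.IsSymmetric) {B : ℝ}
    (hB : ∀ a : ℝ, T.HasEigenvalue (a : ℂ) → |a| ≤ B) (hB0 : 0 ≤ B) (v : V) : ‖T v‖ ≤ B * ‖v‖ := by
  let b := hT.eigenvectorBasis rfl
  refine le_of_sq_le_sq ?_ (by positivity)
  rw [mul_pow, ← b.sum_sq_norm_inner_right, ← b.sum_sq_norm_inner_right v, Finset.mul_sum]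
  refine Finset.sum_le_sum fun i _ => ?_
  have h1 : (inner ℂ (b i) (T v) : ℂ) = hT.eigenvalues rfl i * inner ℂ (b i) v := by
    rw [← hT, hT.apply_eigenvectorBasis, inner_smul_left, RCLike.conj_ofReal]
    rfl
  rw [h1, norm_mul, mul_pow, Complex.norm_real, Real.norm_eq_abs]
  gcongr
  exact hB _ (hT.hasEigenvalue_eigenvalues rfl i)

theorem norm_le_norm_apply_of_eigenvalues_sq {T : Module.End ℂ V} (hT : T.IsSymmetric)
    (h : ∀ a : ℝ, (T ^ 2).HasEigenvalue (a : ℂ) → 1 ≤ a) (v : V) : ‖v‖ ≤ ‖T v‖ := by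
  let b := hT.eigenvectorBasis rfl
  refine le_of_sq_le_sq ?_ (norm_nonneg _)
  rw [← b.sum_sq_norm_inner_right v, ← b.sum_sq_norm_inner_right (T v)]
  refine Finset.sum_le_sum fun i _ => ?_
  have h1 : (inner ℂ (b i) (T v) : ℂ) = hT.eigenvalues rfl i * inner ℂ (b i) v := by
    rw [← hT, hT.apply_eigenvectorBasis, inner_smul_left, RCLike.conj_ofReal]
    rfl
  have h2 : 1 ≤ (hT.eigenvalues rfl i) ^ 2 := by
    refine h _ (Module.End.hasEigenvalue_of_hasEigenvector (x := b i)
      ⟨Module.End.mem_eigenspace_iff.2 ?_, ?_⟩)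
    · rw [pow_two, Module.End.mul_apply, hT.apply_eigenvectorBasis, map_smul,
        hT.apply_eigenvectorBasis, smul_smul]
      push_cast
      rw [pow_two]; rfl
    · exact b.orthonormal.ne_zero i
  rw [h1, norm_mul, mul_pow, Complex.norm_real, Real.norm_eq_abs, sq_abs]
  nlinarith [sq_nonneg ‖(inner ℂ (b i) v : ℂ)‖]

end Endomorphisms

/-! ### Bounded symmetric perturbations of essentially self-adjoint operators -/

section Perturbation

variable {H : Type*} [NormedAddCommGroup H] [InnerProductSpace ℂ H]

theorem adjoint_topologicalClosure (G : Submodule ℂ (H × H)) :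
    G.topologicalClosure.adjoint = G.adjoint := by
  refine le_antisymm (fun x hx => ?_) (fun x hx => ?_)
  · rw [Submodule.mem_adjoint_iff] at hx ⊢
    exact fun a b hab => hx a b (G.le_topologicalClosure hab)
  · rw [Submodule.mem_adjoint_iff] at hx ⊢
    intro a b hab
    have hcl : IsClosed {p : H × H | (inner ℂ p.2 x.1 : ℂ) - inner ℂ p.1 x.2 = 0} :=
      isClosed_eq (by fun_prop) continuous_const
    exact closure_minimal (fun p hp => hx p.1 p.2 hp) hcl hab

/-- The closure of `T + K` is self-adjoint if `T` is essentially self-adjoint and `K` is bounded and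
symmetric. The operators are given by linear maps `u`, `w`, `k` on a space `D` that parametrises the
domain: `T (u d) = w d` and `K (u d) = k d`. -/
theorem topologicalClosure_eq_adjoint_of_perturbation [CompleteSpace H] {D : Type*} [AddCommGroup D]
    [Module ℂ D] (u w k : D →ₗ[ℂ] H)
    (hT : IsEssentiallySelfAdjoint (LinearMap.range (u.prod w)))
    {b : ℝ} (hb : ∀ d, ‖k d‖ ≤ b * ‖u d‖)
    (hsymm : ∀ d e, (inner ℂ (k d) (u e) : ℂ) = inner ℂ (u d) (k e)) :
    (LinearMap.range (u.prod (w + k))).topologicalClosure =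
      (LinearMap.range (u.prod (w + k))).topologicalClosure.adjoint := by
  have hdense : DenseRange u := by
    refine hT.1.mono ?_
    rintro _ ⟨_, d, hd⟩
    exact ⟨d, congrArg Prod.fst hd⟩
  set K : H →L[ℂ] H := k.extendOfNorm u with hK
  have hKu : ∀ d, K (u d) = k d := LinearMap.extendOfNorm_eq hdense ⟨b, hb⟩
  have hKsymm : ∀ x y, (inner ℂ (K x) y : ℂ) = inner ℂ x (K y) := by
    intro x y
    refine hdense.induction_on x (isClosed_eq (by fun_prop) (by fun_prop)) fun d => ?_
    refine hdense.induction_on y (isClosed_eq (by fun_prop) (by fun_prop)) fun e => ?_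
    rw [hKu, hKu, hsymm]
  have hcl : ∀ p : H × H, p ∈ (LinearMap.range (u.prod (w + k))).topologicalClosure ↔
      (p.1, p.2 - K p.1) ∈ (LinearMap.range (u.prod w)).topologicalClosure := by
    intro p
    constructor
    · intro hp
      refine map_mem_closure (f := fun p : H × H => (p.1, p.2 - K p.1)) (by fun_prop) hp ?_
      rintro _ ⟨d, rfl⟩
      exact ⟨d, by simp [hKu]⟩
    · intro hp
      have := map_mem_closure (f := fun p : H × H => (p.1, p.2 + K p.1)) (by fun_prop) hp
        (t := LinearMap.range (u.prod (w + k))) ?_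
      · rw [sub_add_cancel] at this
        exact this
      · rintro _ ⟨d, rfl⟩
        exact ⟨d, by simp [hKu]⟩
  rw [adjoint_topologicalClosure]
  ext p
  rw [hcl, hT.2, Submodule.mem_adjoint_iff, Submodule.mem_adjoint_iff]
  have key : ∀ d, (inner ℂ (w d) p.1 : ℂ) - inner ℂ (u d) (p.2 - K p.1)
      = inner ℂ (w d + k d) p.1 - inner ℂ (u d) p.2 := by
    intro d
    rw [inner_sub_right, ← hKsymm, hKu, inner_add_left]
    ring
  constructor
  · rintro h _ _ ⟨d, hd⟩
    have h1 := h (u d) (w d) ⟨d, rfl⟩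
    rw [key] at h1
    obtain ⟨rfl, rfl⟩ := Prod.mk.inj hd
    exact h1
  · rintro h _ _ ⟨d, hd⟩
    have h1 := h (u d) (w d + k d) ⟨d, rfl⟩
    rw [← key] at h1
    obtain ⟨rfl, rfl⟩ := Prod.mk.inj hd
    exact h1

end Perturbation

/-! ### Square-integrable sections -/

section Sections

variable {E : Type*} [NormedAddCommGroup E] [NormedSpace ℝ E]
  {Z : Type*} [EMetricSpace Z] [ChartedSpace E Z]
  {F : Type*} [NormedAddCommGroup F] [NormedSpace ℂ F]
  {S : Z → Type*} [TopologicalSpace (TotalSpace F S)]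
  [∀ x, NormedAddCommGroup (S x)] [FiberBundle F S]

theorem eq_zero_of_notMem_sectionSupport {s : ∀ x, S x} {x : Z} (hx : x ∉ sectionSupport s) :
    s x = 0 := by
  by_contra h
  exact hx (subset_closure h)

theorem sectionSupport_add_subset (s t : ∀ x, S x) :
    sectionSupport (s + t) ⊆ sectionSupport s ∪ sectionSupport t := by
  unfold sectionSupport
  rw [← closure_union]
  refine closure_mono fun x hx => ?_
  by_contra hc
  simp only [mem_union, mem_ofPred_eq, not_or, not_not] at hc
  exact hx (by simp [hc.1, hc.2])

theorem isCompact_sectionSupport_of_eq_zero {s : ∀ x, S x} {K : Set Z} (hK : IsCompact K)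
    (h0 : ∀ x ∉ K, s x = 0) : sectionSupport s ⊆ K ∧ IsCompact (sectionSupport s) := by
  have h : sectionSupport s ⊆ K :=
    closure_minimal (fun x hx => by_contra fun h => hx (h0 x h)) hK.isClosed
  exact ⟨h, hK.of_isClosed_subset isClosed_closure h⟩

theorem SmoothSectionOn.measurableSection [MeasurableSpace Z] [BorelSpace Z]
    [SecondCountableTopology Z] {s : ∀ x, S x}
    (hs : SmoothSectionOn (E := E) F S s univ) : MeasurableSection E F S s := by
  intro e he
  refine ContinuousOn.aestronglyMeasurable ?_ e.open_baseSet.measurableSet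
  refine continuous_snd.comp_continuousOn (e.continuousOn.comp
    (hs.continuousOn.mono (subset_univ _)) fun x hx => ?_)
  exact e.mem_source.2 hx

variable [∀ x, InnerProductSpace ℂ (S x)] [VectorBundle ℝ F S]

/-- A section that is smooth on an open set and vanishes outside a closed subset of it is smooth. -/
theorem smoothSectionOn_univ_of_eq_zero {s : ∀ x, S x} {U K : Set Z} (hU : IsOpen U)
    (hK : IsClosed K) (hKU : K ⊆ U) (hs : SmoothSectionOn (E := E) F S s U)
    (h0 : ∀ x ∉ K, s x = 0) : SmoothSectionOn (E := E) F S s univ := by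
  intro x _
  by_cases hx : x ∈ U
  · exact ((hs x hx).contMDiffAt (hU.mem_nhds hx)).contMDiffWithinAt
  · have hxK : Kᶜ ∈ 𝓝 x := hK.isOpen_compl.mem_nhds fun h => hx (hKU h)
    refine ContMDiffAt.contMDiffWithinAt ?_
    refine ((contMDiff_zeroSection ℝ S).contMDiffAt (x := x)).congr_of_eventuallyEq ?_
    filter_upwards [hxK] with y hy
    simp [zeroSection, h0 y hy]

variable [VectorBundle ℂ F S]

/-- The product of a smooth real function and a compactly supported smooth section. -/
def smulSection {f : Z → ℝ} (hf : ContMDiff 𝓘(ℝ, E) 𝓘(ℝ, ℝ) ∞ f)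
    (Φ : SmoothCompactSections (E := E) F S) : SmoothCompactSections (E := E) F S :=
  ⟨fun x => (f x : ℂ) • Φ.1 x, by
    refine ⟨?_, Φ.2.2.of_isClosed_subset isClosed_closure (closure_mono fun x hx hc => hx ?_)⟩
    · have h := ContMDiffOn.smul_section (V := S) hf.contMDiffOn Φ.2.1
      refine h.congr fun x _ => ?_
      simp [Complex.coe_smul]
    · simp [hc]⟩

variable [MeasurableSpace Z] [BorelSpace Z] [SecondCountableTopology Z] [FiniteDimensional ℂ F]
  [ContMDiffVectorBundle ∞ F S 𝓘(ℝ, E)] [IsSmoothHermitianBundle (E := E) F S]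

/-- The class in `L²(Z; S)` of a square-integrable section. -/
noncomputable def toL2 : squareIntegrableSections E F S →ₗ[ℂ] L2Space E F S :=
  (UniformSpace.Completion.toComplₗᵢ (𝕜 := ℂ) (E := L2Section E F S)).toLinearMap

theorem inner_toL2 (s t : squareIntegrableSections E F S) :
    (inner ℂ (toL2 s) (toL2 t) : ℂ)
      = ∫ x, (inner ℂ (s.1 x) (t.1 x) : ℂ) ∂(riemannianVolume E : Measure Z) :=
  UniformSpace.Completion.inner_coe (𝕜 := ℂ) (E := L2Section E F S) s t

theorem norm_toL2_sq (s : squareIntegrableSections E F S) :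
    ‖toL2 s‖ ^ 2 = ∫ x, ‖s.1 x‖ ^ 2 ∂(riemannianVolume E : Measure Z) := by
  have h1 : ((‖toL2 s‖ ^ 2 : ℝ) : ℂ) = ((∫ x, ‖s.1 x‖ ^ 2 ∂(riemannianVolume E : Measure Z) : ℝ) : ℂ) := by
    have h2 := inner_self_eq_norm_sq_to_K (𝕜 := ℂ) (toL2 s)
    rw [inner_toL2] at h2
    rw [← integral_complex_ofReal]
    simp only [inner_self_eq_norm_sq_to_K] at h2
    push_cast
    exact h2.symm
  exact_mod_cast h1

theorem integrable_norm_sq (s : squareIntegrableSections E F S) :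
    Integrable (fun x => ‖s.1 x‖ ^ 2) (riemannianVolume E : Measure Z) := s.2.2.integrable_sq

theorem mem_squareIntegrableSections_of_norm_le {s t : ∀ x, S x}
    (hs : s ∈ squareIntegrableSections E F S) (ht : MeasurableSection E F S t) {B : ℝ}
    (hB : ∀ x, ‖t x‖ ≤ B * ‖s x‖) : t ∈ squareIntegrableSections E F S :=
  ⟨ht, (hs.2.const_mul B).mono ht.aestronglyMeasurable_norm (ae_of_all _ fun x => by
    rw [norm_norm]; exact (hB x).trans (le_abs_self _))⟩

/-- The domain of the operator `T` in `L²(Z; S)`: the compactly supported smooth sections `Φ` such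
that `Φ` and `T Φ` are square-integrable. -/
def operatorDomain (T : SmoothCompactSections (E := E) F S →ₗ[ℂ] ∀ x, S x) :
    Submodule ℂ (SmoothCompactSections (E := E) F S) :=
  (squareIntegrableSections E F S).comap (SmoothCompactSections (E := E) F S).subtype ⊓
    (squareIntegrableSections E F S).comap T

/-- The classes in `L²(Z; S)` of the sections `T Φ`, for `Φ` in `D`. -/
noncomputable def sectionClass (D : Submodule ℂ (SmoothCompactSections (E := E) F S))
    (T : SmoothCompactSections (E := E) F S →ₗ[ℂ] ∀ x, S x)
    (hT : ∀ Φ ∈ D, T Φ ∈ squareIntegrableSections E F S) : D →ₗ[ℂ] L2Space E F S :=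
  toL2 ∘ₗ LinearMap.codRestrict _ (T ∘ₗ D.subtype) fun Φ => hT Φ Φ.2

section SectionClass

variable {D : Submodule ℂ (SmoothCompactSections (E := E) F S)}
  {T T' : SmoothCompactSections (E := E) F S →ₗ[ℂ] ∀ x, S x}
  {hT : ∀ Φ ∈ D, T Φ ∈ squareIntegrableSections E F S}
  {hT' : ∀ Φ ∈ D, T' Φ ∈ squareIntegrableSections E F S}

theorem inner_sectionClass (Φ Ψ : D) :
    (inner ℂ (sectionClass D T hT Φ) (sectionClass D T' hT' Ψ) : ℂ)
      = ∫ x, (inner ℂ (T Φ.1 x) (T' Ψ.1 x) : ℂ) ∂(riemannianVolume E : Measure Z) :=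
  inner_toL2 _ _

theorem norm_sectionClass_sq (Φ : D) :
    ‖sectionClass D T hT Φ‖ ^ 2 = ∫ x, ‖T Φ.1 x‖ ^ 2 ∂(riemannianVolume E : Measure Z) :=
  norm_toL2_sq _

theorem sectionClass_add :
    sectionClass D (T + T') (fun Φ hΦ => Submodule.add_mem _ (hT Φ hΦ) (hT' Φ hΦ)) =
      sectionClass D T hT + sectionClass D T' hT' := by
  ext Φ
  exact map_add toL2 ⟨T Φ.1, hT Φ.1 Φ.2⟩ ⟨T' Φ.1, hT' Φ.1 Φ.2⟩

end SectionClass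

/-- The graph of an operator in `L²` is the range of a linear map from any description `D` of its
domain. -/
theorem operatorGraph_eq_range {T : SmoothCompactSections (E := E) F S →ₗ[ℂ] ∀ x, S x}
    {D : Submodule ℂ (SmoothCompactSections (E := E) F S)} (hD : operatorDomain T = D)
    (h1 : ∀ Φ ∈ D, (SmoothCompactSections (E := E) F S).subtype Φ ∈ squareIntegrableSections E F S)
    (h2 : ∀ Φ ∈ D, T Φ ∈ squareIntegrableSections E F S) :
    operatorGraph T = LinearMap.range ((sectionClass D _ h1).prod (sectionClass D T h2)) := by
  subst hD
  ext p
  constructor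
  · rintro ⟨Φ, u, w, hu, hw, h3, h4⟩
    refine ⟨⟨Φ, ?_, ?_⟩, Prod.ext ?_ ?_⟩
    · change Φ.1 ∈ squareIntegrableSections E F S
      rw [← hu]; exact u.2
    · change T Φ ∈ squareIntegrableSections E F S
      rw [← hw]; exact w.2
    · rw [h3]
      exact congrArg toL2 (Subtype.ext hu.symm : (⟨Φ.1, _⟩ : squareIntegrableSections E F S) = u)
    · rw [h4]
      exact congrArg toL2 (Subtype.ext hw.symm : (⟨T Φ, _⟩ : squareIntegrableSections E F S) = w)
  · rintro ⟨Φ, rfl⟩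
    exact ⟨Φ.1, ⟨_, Φ.2.1⟩, ⟨_, Φ.2.2⟩, rfl, rfl, rfl, rfl⟩

end Sections

/-! ### The operators of a localisation datum -/

section LocalisationDatum

variable {E : Type*} [NormedAddCommGroup E] [NormedSpace ℝ E]
  {Z : Type*} [EMetricSpace Z] [ChartedSpace E Z]
  {F : Type*} [NormedAddCommGroup F] [NormedSpace ℂ F]
  {S : Z → Type*} [TopologicalSpace (TotalSpace F S)]
  [∀ x, NormedAddCommGroup (S x)] [∀ x, InnerProductSpace ℂ (S x)] [FiberBundle F S]
  [VectorBundle ℂ F S] [VectorBundle ℝ F S]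
  {σ : SymbolField E S} {η₀ : Z → ℝ} {U₀ U₁ : Set Z}
  {L : SmoothCompactSections (E := E) F S →ₗ[ℂ] SmoothCompactSections (E := E) F S}
  {h : ∀ x, Module.End ℂ (S x)}

/-- The operator `L`, with values in the space of all sections. -/
abbrev plainOperator
    (L : SmoothCompactSections (E := E) F S →ₗ[ℂ] SmoothCompactSections (E := E) F S) :
    SmoothCompactSections (E := E) F S →ₗ[ℂ] ∀ x, S x :=
  (SmoothCompactSections (E := E) F S).subtype ∘ₗ L

/-- The operator `m h`. -/
def potentialOperator (F : Type*) [NormedAddCommGroup F] [NormedSpace ℂ F]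
    [TopologicalSpace (TotalSpace F S)] [FiberBundle F S] [VectorBundle ℂ F S] [VectorBundle ℝ F S]
    (h : ∀ x, Module.End ℂ (S x)) (m : ℝ) :
    SmoothCompactSections (E := E) F S →ₗ[ℂ] ∀ x, S x where
  toFun Φ := fun x => (m : ℂ) • h x (Φ.1 x)
  map_add' Φ Ψ := by
    funext x
    simp only [Submodule.coe_add, Pi.add_apply, map_add, smul_add]
  map_smul' c Φ := by
    funext x
    simp only [Submodule.coe_smul, Pi.smul_apply, map_smul, RingHom.id_apply]
    rw [smul_comm]

variable [SecondCountableTopology Z] [MeasurableSpace Z] [BorelSpace Z] [FiniteDimensional ℂ F]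
  [ContMDiffVectorBundle ∞ F S 𝓘(ℝ, E)] [IsSmoothHermitianBundle (E := E) F S]

theorem finiteDimensional_fiber (F : Type*) [NormedAddCommGroup F] [NormedSpace ℂ F]
    [FiniteDimensional ℂ F] {Z : Type*} [TopologicalSpace Z] {S : Z → Type*}
    [TopologicalSpace (TotalSpace F S)] [∀ x, NormedAddCommGroup (S x)]
    [∀ x, InnerProductSpace ℂ (S x)] [FiberBundle F S] [VectorBundle ℂ F S] (x : Z) :
    FiniteDimensional ℂ (S x) :=
  ((trivializationAt F S x).continuousLinearEquivAt ℂ x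
    (mem_baseSet_trivializationAt F S x)).toLinearEquiv.symm.finiteDimensional

theorem IsLocalisationDatum.exists_norm_le (hd : IsLocalisationDatum σ η₀ U₀ U₁ L h) :
    ∃ B : ℝ, ∀ x (v : S x), ‖h x v‖ ≤ B * ‖v‖ := by
  obtain ⟨B, hB⟩ := hd.h_bounded
  refine ⟨max B 0, fun x v => ?_⟩
  have := finiteDimensional_fiber F (S := S) x
  exact norm_apply_le_of_eigenvalues (hd.h_selfAdjoint x)
    (fun a ha => (hB x a ha).trans (le_max_left _ _)) (le_max_right _ _) v

theorem IsLocalisationDatum.norm_le_norm_apply (hd : IsLocalisationDatum σ η₀ U₀ U₁ L h) {x : Z}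
    (hx : x ∈ U₁) (v : S x) : ‖v‖ ≤ ‖h x v‖ := by
  have := finiteDimensional_fiber F (S := S) x
  exact norm_le_norm_apply_of_eigenvalues_sq (hd.h_selfAdjoint x) (hd.h_sq x hx) v

theorem IsLocalisationDatum.potential_mem (hd : IsLocalisationDatum σ η₀ U₀ U₁ L h)
    {Φ : SmoothCompactSections (E := E) F S} (hΦ : Φ.1 ∈ squareIntegrableSections E F S) :
    (fun x => h x (Φ.1 x)) ∈ squareIntegrableSections E F S := by
  obtain ⟨B, hB⟩ := hd.exists_norm_le
  exact mem_squareIntegrableSections_of_norm_le hΦ (hd.h_measurable Φ) fun x => hB x _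

theorem IsLocalisationDatum.operatorDomain_eq (hd : IsLocalisationDatum σ η₀ U₀ U₁ L h) (m : ℝ) :
    operatorDomain (massOperator L h m) = operatorDomain (plainOperator L) := by
  ext Φ
  refine and_congr_right fun hΦ => ?_
  have h1 := Submodule.smul_mem _ (m : ℂ) (hd.potential_mem hΦ)
  exact Submodule.add_mem_iff_left _ h1

/-- The closure of `L + m h` is self-adjoint, because `h` is bounded and symmetric. -/
theorem IsLocalisationDatum.massClosure_eq_adjoint (hd : IsLocalisationDatum σ η₀ U₀ U₁ L h)
    (m : ℝ) : massClosure L h m = (massClosure L h m).adjoint := by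
  obtain ⟨B, hB⟩ := hd.exists_norm_le
  have h1 : ∀ Φ ∈ operatorDomain (plainOperator L),
      (SmoothCompactSections (E := E) F S).subtype Φ ∈ squareIntegrableSections E F S :=
    fun Φ hΦ => hΦ.1
  have h2 : ∀ Φ ∈ operatorDomain (plainOperator L),
      plainOperator L Φ ∈ squareIntegrableSections E F S := fun Φ hΦ => hΦ.2
  have h3 : ∀ Φ ∈ operatorDomain (plainOperator L),
      potentialOperator F h m Φ ∈ squareIntegrableSections E F S :=
    fun Φ hΦ => Submodule.smul_mem _ (m : ℂ) (hd.potential_mem hΦ.1)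
  have hgraph : operatorGraph (massOperator L h m) = LinearMap.range
      ((sectionClass _ _ h1).prod (sectionClass _ _ h2 + sectionClass _ _ h3)) := by
    rw [← sectionClass_add]
    exact operatorGraph_eq_range (hd.operatorDomain_eq m) _ _
  have hess : IsEssentiallySelfAdjoint
      (LinearMap.range ((sectionClass _ _ h1).prod (sectionClass _ _ h2))) := by
    rw [← operatorGraph_eq_range rfl]
    exact hd.essSelfAdjoint
  have hbound : ∀ Φ, ‖sectionClass _ _ h3 Φ‖ ≤ |m| * |B| * ‖sectionClass _ _ h1 Φ‖ := by
    intro Φ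
    refine le_of_sq_le_sq ?_ (by positivity)
    rw [mul_pow, norm_sectionClass_sq, norm_sectionClass_sq, ← integral_const_mul]
    refine integral_mono (integrable_norm_sq ⟨_, h3 _ Φ.2⟩)
      ((integrable_norm_sq ⟨_, h1 _ Φ.2⟩).const_mul _) fun x => ?_
    change ‖(m : ℂ) • h x (Φ.1.1 x)‖ ^ 2 ≤ _ * ‖Φ.1.1 x‖ ^ 2
    rw [← mul_pow, norm_smul, Complex.norm_real, Real.norm_eq_abs, mul_assoc]
    gcongr
    exact (hB x _).trans (by gcongr; exact le_abs_self B)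
  have hsymm : ∀ Φ Ψ, (inner ℂ (sectionClass _ _ h3 Φ) (sectionClass _ _ h1 Ψ) : ℂ)
      = inner ℂ (sectionClass _ _ h1 Φ) (sectionClass _ _ h3 Ψ) := by
    intro Φ Ψ
    rw [inner_sectionClass, inner_sectionClass]
    refine integral_congr_ae (ae_of_all _ fun x => ?_)
    change (inner ℂ ((m : ℂ) • h x (Φ.1.1 x)) (Ψ.1.1 x) : ℂ)
      = inner ℂ (Φ.1.1 x) ((m : ℂ) • h x (Ψ.1.1 x))
    rw [inner_smul_left, inner_smul_right, Complex.conj_ofReal, hd.h_selfAdjoint x]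
  have key := @topologicalClosure_eq_adjoint_of_perturbation (L2Space E F S) _ _ _
    (operatorDomain (plainOperator L)) _ _ (sectionClass _ _ h1) (sectionClass _ _ h2)
    (sectionClass _ _ h3)
  have key' := key hess (b := |m| * |B|) hbound hsymm
  unfold massClosure
  rw [hgraph]
  exact key'

end LocalisationDatum

/-! ### The lower bound away from `U₀` -/

section MassBound

variable {E : Type*} [NormedAddCommGroup E] [NormedSpace ℝ E]
  {Z : Type*} [EMetricSpace Z] [SecondCountableTopology Z]
  [MeasurableSpace Z] [BorelSpace Z] [ChartedSpace E Z]
  {F : Type*} [NormedAddCommGroup F] [NormedSpace ℂ F] [FiniteDimensional ℂ F]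
  {S : Z → Type*} [TopologicalSpace (TotalSpace F S)]
  [∀ x, NormedAddCommGroup (S x)] [∀ x, InnerProductSpace ℂ (S x)] [FiberBundle F S]
  [VectorBundle ℂ F S] [VectorBundle ℝ F S] [ContMDiffVectorBundle ∞ F S 𝓘(ℝ, E)]
  [IsSmoothHermitianBundle (E := E) F S]
  {σ : SymbolField E S} {η₀ : Z → ℝ} {U₀ U₁ : Set Z}
  {L : SmoothCompactSections (E := E) F S →ₗ[ℂ] SmoothCompactSections (E := E) F S}
  {h : ∀ x, Module.End ℂ (S x)}

theorem IsLocalisationDatum.integral_inner_comm (hd : IsLocalisationDatum σ η₀ U₀ U₁ L h)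
    {Φ Ψ : SmoothCompactSections (E := E) F S} (hΦ : Φ ∈ operatorDomain (plainOperator L))
    (hΨ : Ψ ∈ operatorDomain (plainOperator L)) :
    ∫ x, (inner ℂ ((L Φ).1 x) (Ψ.1 x) : ℂ) ∂(riemannianVolume E : Measure Z)
      = ∫ x, (inner ℂ (Φ.1 x) ((L Ψ).1 x) : ℂ) ∂(riemannianVolume E : Measure Z) := by
  have hA : (operatorGraph (plainOperator L)).topologicalClosure
      = (operatorGraph (plainOperator L)).topologicalClosure.adjoint := by
    rw [adjoint_topologicalClosure]
    exact hd.essSelfAdjoint.2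
  have hmem : ∀ {Θ : SmoothCompactSections (E := E) F S}
      (hΘ : Θ ∈ operatorDomain (plainOperator L)),
      (toL2 ⟨Θ.1, hΘ.1⟩, toL2 ⟨(L Θ).1, hΘ.2⟩)
        ∈ (operatorGraph (plainOperator L)).topologicalClosure := fun {Θ} hΘ =>
    Submodule.le_topologicalClosure _ ⟨Θ, ⟨_, hΘ.1⟩, ⟨_, hΘ.2⟩, rfl, rfl, rfl, rfl⟩
  have h1 := inner_comm_of_eq_adjoint hA (hmem hΦ) (hmem hΨ)
  rwa [inner_toL2, inner_toL2] at h1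

/-- The section `h Φ` is smooth if `Φ` is supported in `U₁`. -/
theorem IsLocalisationDatum.exists_potential_section (hd : IsLocalisationDatum σ η₀ U₀ U₁ L h)
    {Φ : SmoothCompactSections (E := E) F S} (hsupp : sectionSupport Φ.1 ⊆ U₁) :
    ∃ Ψ : SmoothCompactSections (E := E) F S, ∀ x, Ψ.1 x = h x (Φ.1 x) := by
  refine ⟨⟨fun x => h x (Φ.1 x), ?_, ?_⟩, fun x => rfl⟩
  · refine smoothSectionOn_univ_of_eq_zero hd.isOpen₁ isClosed_closure hsupp (hd.h_smooth Φ)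
      fun x hx => ?_
    rw [eq_zero_of_notMem_sectionSupport hx, map_zero]
  · refine Φ.2.2.of_isClosed_subset isClosed_closure (closure_mono fun x hx hc => hx ?_)
    simp [hc]

/-- On sections supported in `U₁`, where `h` anti-commutes with `L`, the square of `L + m h` is
`L² + m² h²`, so that `L + m h` is bounded below by `m`. -/
theorem IsLocalisationDatum.sq_mul_integral_le (hd : IsLocalisationDatum σ η₀ U₀ U₁ L h) (m : ℝ)
    {Φ : SmoothCompactSections (E := E) F S} (hΦ : Φ ∈ operatorDomain (massOperator L h m))
    (hsupp : sectionSupport Φ.1 ⊆ U₁) :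
    m ^ 2 * ∫ x, ‖Φ.1 x‖ ^ 2 ∂(riemannianVolume E : Measure Z)
      ≤ ∫ x, ‖massOperator L h m Φ x‖ ^ 2 ∂(riemannianVolume E : Measure Z) := by
  have hΦL : Φ ∈ operatorDomain (plainOperator L) := hd.operatorDomain_eq m ▸ hΦ
  obtain ⟨Ψ, hΨ⟩ := hd.exists_potential_section hsupp
  have hLΨ := hd.h_anticommutes Φ Ψ hsupp hΨ
  obtain ⟨B, hB⟩ := hd.exists_norm_le
  have hΨ2 : Ψ.1 ∈ squareIntegrableSections E F S :=
    (funext hΨ : Ψ.1 = _) ▸ hd.potential_mem hΦ.1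
  have hΨL : Ψ ∈ operatorDomain (plainOperator L) := by
    refine ⟨hΨ2, mem_squareIntegrableSections_of_norm_le hΦL.2 (L Ψ).2.1.measurableSection
      (B := B) fun x => ?_⟩
    change ‖(L Ψ).1 x‖ ≤ B * ‖(L Φ).1 x‖
    rw [hLΨ, norm_neg]
    exact hB x _
  -- The cross term `Re ⟪L Φ, h Φ⟫` integrates to zero.
  have hcross : (∫ x, (inner ℂ ((L Φ).1 x) (Ψ.1 x) : ℂ) ∂(riemannianVolume E : Measure Z)).re = 0 := by
    have h1 := hd.integral_inner_comm hΦL hΨL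
    have h2 : ∀ x, (inner ℂ (Φ.1 x) ((L Ψ).1 x) : ℂ)
        = -(starRingEnd ℂ) (inner ℂ ((L Φ).1 x) (Ψ.1 x)) := fun x => by
      rw [hLΨ, inner_neg_right, ← hd.h_selfAdjoint x, ← hΨ, inner_conj_symm]
    simp_rw [h2] at h1
    rw [integral_neg, integral_conj] at h1
    have h3 := congrArg Complex.re h1
    rw [Complex.neg_re, Complex.conj_re] at h3
    linarith
  have hint : Integrable (fun x => (inner ℂ ((L Φ).1 x) (Ψ.1 x) : ℂ))
      (riemannianVolume E : Measure Z) :=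
    L2Section.integrable_inner (⟨_, hΦL.2⟩ : squareIntegrableSections E F S) ⟨_, hΨ2⟩
  have hT := integrable_norm_sq ⟨_, hΦ.2⟩
  have hpoint : ∀ x, m ^ 2 * ‖Φ.1 x‖ ^ 2 ≤ ‖massOperator L h m Φ x‖ ^ 2
      - 2 * m * (inner ℂ ((L Φ).1 x) (Ψ.1 x) : ℂ).re := by
    intro x
    have h1 : massOperator L h m Φ x = (L Φ).1 x + (m : ℂ) • Ψ.1 x := by
      rw [hΨ]; rfl
    have h2 : ‖Φ.1 x‖ ≤ ‖Ψ.1 x‖ := by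
      by_cases hx : x ∈ sectionSupport Φ.1
      · rw [hΨ]; exact hd.norm_le_norm_apply (hsupp hx) _
      · rw [eq_zero_of_notMem_sectionSupport hx, norm_zero]; exact norm_nonneg _
    have h3 : ‖Φ.1 x‖ ^ 2 ≤ ‖Ψ.1 x‖ ^ 2 := by gcongr
    have h4 : RCLike.re ((m : ℂ) * inner ℂ ((L Φ).1 x) (Ψ.1 x)) =
        m * (inner ℂ ((L Φ).1 x) (Ψ.1 x) : ℂ).re := Complex.re_ofReal_mul _ _
    rw [h1, norm_add_sq (𝕜 := ℂ), inner_smul_right, h4, norm_smul, Complex.norm_real,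
      Real.norm_eq_abs, mul_pow, sq_abs]
    nlinarith [sq_nonneg ‖(L Φ).1 x‖, sq_nonneg m]
  rw [← integral_const_mul]
  refine (integral_mono ((integrable_norm_sq ⟨_, hΦ.1⟩).const_mul _)
    (hT.sub (hint.re.const_mul (2 * m))) hpoint).trans_eq ?_
  have h5 : ∫ x, (inner ℂ ((L Φ).1 x) (Ψ.1 x) : ℂ).re ∂(riemannianVolume E : Measure Z) = 0 := by
    rw [← hcross]
    exact integral_re hint
  refine (integral_sub hT (hint.re.const_mul (2 * m))).trans ?_
  rw [integral_const_mul]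
  refine (congrArg (fun r : ℝ => _ - 2 * m * r) h5).trans ?_
  rw [mul_zero, sub_zero]

end MassBound

/-! ### Locality -/

section Locality

variable {E : Type*} [NormedAddCommGroup E] [NormedSpace ℝ E] [FiniteDimensional ℝ E]
  {Z : Type*} [EMetricSpace Z] [ChartedSpace E Z] [IsManifold 𝓘(ℝ, E) ∞ Z]
  {F : Type*} [NormedAddCommGroup F] [NormedSpace ℂ F]
  {S : Z → Type*} [TopologicalSpace (TotalSpace F S)]
  [∀ x, NormedAddCommGroup (S x)] [∀ x, InnerProductSpace ℂ (S x)] [FiberBundle F S]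
  [VectorBundle ℂ F S] [VectorBundle ℝ F S]
  {σ : SymbolField E S}
  {L : SmoothCompactSections (E := E) F S →ₗ[ℂ] SmoothCompactSections (E := E) F S}

/-- A differential operator is local. -/
theorem IsFirstOrderOperatorWithSymbol.apply_eq_zero (hL : IsFirstOrderOperatorWithSymbol L σ)
    {Φ : SmoothCompactSections (E := E) F S} {x : Z} (hx : x ∉ sectionSupport Φ.1) :
    (L Φ).1 x = 0 := by
  have hnhds : (sectionSupport Φ.1)ᶜ ∈ 𝓝 x := isClosed_closure.isOpen_compl.mem_nhds hx
  obtain ⟨f, -, hf⟩ := (SmoothBumpFunction.nhds_basis_support (I := 𝓘(ℝ, E)) hnhds).mem_iff.1 hnhds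
  have h1 := hL (fun y => 1 - f y) (contMDiff_const.sub f.contMDiff) Φ Φ (fun y => ?_) x
  · rw [h1, eq_zero_of_notMem_sectionSupport hx, map_zero]
    simp
  · by_cases hy : y ∈ sectionSupport Φ.1
    · have : f y = 0 := by
        by_contra hne
        exact hf hne hy
      simp [this]
    · simp [eq_zero_of_notMem_sectionSupport hy]

theorem IsLocalisationDatum.massOperator_eq_zero [SecondCountableTopology Z] [MeasurableSpace Z]
    [BorelSpace Z] [FiniteDimensional ℂ F] [ContMDiffVectorBundle ∞ F S 𝓘(ℝ, E)]
    [IsSmoothHermitianBundle (E := E) F S] {η₀ : Z → ℝ} {U₀ U₁ : Set Z}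
    {h : ∀ x, Module.End ℂ (S x)} {m : ℝ} (hd : IsLocalisationDatum σ η₀ U₀ U₁ L h)
    {Φ : SmoothCompactSections (E := E) F S} {x : Z} (hx : x ∉ sectionSupport Φ.1) :
    massOperator L h m Φ x = 0 := by
  change (L Φ).1 x + (m : ℂ) • h x (Φ.1 x) = 0
  rw [hd.hasSymbol.apply_eq_zero hx, eq_zero_of_notMem_sectionSupport hx, map_zero, smul_zero,
    add_zero]

end Locality

/-! ### Cut-off functions -/

section Cutoff

open Real

/-- An angle that decreases from `π/2` to `0` on `[0, 1/2]`, so that `cos (innerAngle η₀)` is supported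
in `U₀`; it is the function by which sections are cut off to `U₀`. -/
noncomputable def innerAngle (t : ℝ) : ℝ := π / 2 * (1 - smoothTransition (2 * t))

/-- An angle that increases from `0` to `π/2` on `[1/2, 1]`, so that `cos (outerAngle η₀)` is supported
in `U₁` and equal to `1` where `cos (innerAngle η₀)` is not locally constant. -/
noncomputable def outerAngle (t : ℝ) : ℝ := π / 2 * smoothTransition (2 * t - 1)

theorem contDiff_innerAngle : ContDiff ℝ ∞ innerAngle :=
  contDiff_const.mul (contDiff_const.sub
    (smoothTransition.contDiff.comp (contDiff_const.mul contDiff_id)))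

theorem contDiff_outerAngle : ContDiff ℝ ∞ outerAngle :=
  contDiff_const.mul
    (smoothTransition.contDiff.comp ((contDiff_const.mul contDiff_id).sub contDiff_const))

theorem cos_innerAngle_zero : cos (innerAngle 0) = 0 := by simp [innerAngle]

theorem cos_outerAngle_one : cos (outerAngle 1) = 0 := by
  norm_num [outerAngle, smoothTransition.one_of_one_le]

theorem innerAngle_eq_zero {t : ℝ} (ht : 1 / 2 ≤ t) : innerAngle t = 0 := by
  simp [innerAngle, smoothTransition.one_of_one_le (show 1 ≤ 2 * t by linarith)]

theorem outerAngle_eq_zero {t : ℝ} (ht : t ≤ 1 / 2) : outerAngle t = 0 := by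
  simp [outerAngle, smoothTransition.zero_of_nonpos (show 2 * t - 1 ≤ 0 by linarith)]

/-- The inner cut-off function varies only where the outer one is `1`. -/
theorem deriv_innerAngle_sq_le {t D : ℝ} (hD : |deriv innerAngle t| ≤ D) :
    deriv innerAngle t ^ 2 ≤ D ^ 2 * cos (outerAngle t) ^ 2 := by
  have h1 : deriv innerAngle t ^ 2 ≤ D ^ 2 := by
    rw [← sq_abs]
    exact pow_le_pow_left₀ (abs_nonneg _) hD 2
  rcases le_or_gt t (1 / 2) with ht | ht
  · simpa [outerAngle_eq_zero ht] using h1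
  · have h2 : innerAngle =ᶠ[𝓝 t] fun _ => 0 := by
      filter_upwards [lt_mem_nhds ht] with s hs using innerAngle_eq_zero hs.le
    rw [h2.deriv_eq]
    simp only [deriv_const, ne_eq, OfNat.ofNat_ne_zero, not_false_eq_true, zero_pow]
    positivity

theorem one_le_cos_sq_add_cos_sq (t : ℝ) : 1 ≤ cos (innerAngle t) ^ 2 + cos (outerAngle t) ^ 2 := by
  rcases le_or_gt t (1 / 2) with ht | ht
  · simp [outerAngle_eq_zero ht, sq_nonneg]
  · simp [innerAngle_eq_zero ht.le, sq_nonneg]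

theorem exists_deriv_le {f : ℝ → ℝ} (hf : ContDiff ℝ ∞ f) :
    ∃ D : ℝ, ∀ t ∈ Icc (0 : ℝ) 1, |deriv f t| ≤ D :=
  isCompact_Icc.exists_bound_of_continuousOn (hf.continuous_deriv (by simp)).continuousOn

/-- The Cauchy-Schwarz inequality for `‖p a + q b‖` with `(p, q)` on the unit circle. -/
theorem norm_add_sq_le_of_sq_add_sq {V : Type*} [NormedAddCommGroup V] [NormedSpace ℂ V] {p q : ℝ}
    (hpq : p ^ 2 + q ^ 2 = 1) (a b : V) :
    ‖(p : ℂ) • a + (q : ℂ) • b‖ ^ 2 ≤ ‖a‖ ^ 2 + ‖b‖ ^ 2 := by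
  have h1 : ‖(p : ℂ) • a + (q : ℂ) • b‖ ≤ |p| * ‖a‖ + |q| * ‖b‖ := by
    refine (norm_add_le _ _).trans_eq ?_
    rw [norm_smul, norm_smul, Complex.norm_real, Complex.norm_real, norm_eq_abs, norm_eq_abs]
  have h2 : |p| ^ 2 + |q| ^ 2 = 1 := by rwa [sq_abs, sq_abs]
  calc ‖(p : ℂ) • a + (q : ℂ) • b‖ ^ 2 ≤ (|p| * ‖a‖ + |q| * ‖b‖) ^ 2 := by gcongr
    _ ≤ (|p| ^ 2 + |q| ^ 2) * (‖a‖ ^ 2 + ‖b‖ ^ 2) := by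
      nlinarith [sq_nonneg (|p| * ‖b‖ - |q| * ‖a‖)]
    _ = ‖a‖ ^ 2 + ‖b‖ ^ 2 := by rw [h2, one_mul]

end Cutoff

section CutoffSections

variable {E : Type*} [NormedAddCommGroup E] [NormedSpace ℝ E]
  {Z : Type*} [EMetricSpace Z] [ChartedSpace E Z]
  {F : Type*} [NormedAddCommGroup F] [NormedSpace ℂ F]
  {S : Z → Type*} [TopologicalSpace (TotalSpace F S)]
  [∀ x, NormedAddCommGroup (S x)] [∀ x, InnerProductSpace ℂ (S x)] [FiberBundle F S]
  [VectorBundle ℂ F S] [VectorBundle ℝ F S]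
  {σ : SymbolField E S} {η₀ : Z → ℝ} {U₀ U₁ : Set Z}
  {L : SmoothCompactSections (E := E) F S →ₗ[ℂ] SmoothCompactSections (E := E) F S}
  {h : ∀ x, Module.End ℂ (S x)}

theorem symbolOfDifferential_comp {c : ℝ → ℝ} {x : Z} (hc : DifferentiableAt ℝ c (η₀ x))
    (hη : MDifferentiableAt 𝓘(ℝ, E) 𝓘(ℝ, ℝ) η₀ x) :
    symbolOfDifferential σ (fun y => c (η₀ y)) x = deriv c (η₀ x) • symbolOfDifferential σ η₀ x := by
  have h1 : mfderiv 𝓘(ℝ, E) 𝓘(ℝ, ℝ) (fun y => c (η₀ y)) x =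
      deriv c (η₀ x) • (mfderiv 𝓘(ℝ, E) 𝓘(ℝ, ℝ) η₀ x : TangentSpace 𝓘(ℝ, E) x →L[ℝ] ℝ) := by
    refine (mfderiv_comp x hc.mdifferentiableAt hη).trans ?_
    ext v
    change mfderiv 𝓘(ℝ, ℝ) 𝓘(ℝ, ℝ) c (η₀ x) (mfderiv 𝓘(ℝ, E) 𝓘(ℝ, ℝ) η₀ x v) =
      deriv c (η₀ x) * (show ℝ from mfderiv 𝓘(ℝ, E) 𝓘(ℝ, ℝ) η₀ x v)
    rw [mfderiv_eq_fderiv]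
    exact (fderiv_eq_deriv_mul (𝕜 := ℝ) (f := c))
  exact (congrArg (σ x) h1).trans ((σ x).map_smul _ _)

theorem massOperator_smulSection (hL : IsFirstOrderOperatorWithSymbol L σ) (m : ℝ) {f : Z → ℝ}
    (hf : ContMDiff 𝓘(ℝ, E) 𝓘(ℝ, ℝ) ∞ f) (Φ : SmoothCompactSections (E := E) F S) (x : Z) :
    massOperator L h m (smulSection hf Φ) x
      = (f x : ℂ) • massOperator L h m Φ x + symbolOfDifferential σ f x (Φ.1 x) := by
  change (L (smulSection hf Φ)).1 x + (m : ℂ) • h x ((f x : ℂ) • Φ.1 x) =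
    (f x : ℂ) • ((L Φ).1 x + (m : ℂ) • h x (Φ.1 x)) + _
  rw [hL f hf Φ (smulSection hf Φ) (fun _ => rfl) x, map_smul, smul_add,
    smul_comm (m : ℂ) (f x : ℂ)]
  abel

/-- The effect of a cut-off `cos (f η₀)` on the operator. -/
theorem norm_massOperator_cos_sq_le (hL : IsFirstOrderOperatorWithSymbol L σ) (m : ℝ) {f : ℝ → ℝ}
    (hf : ContDiff ℝ ∞ f) (hη : ContMDiff 𝓘(ℝ, E) 𝓘(ℝ, ℝ) ∞ η₀)
    (hχ : ContMDiff 𝓘(ℝ, E) 𝓘(ℝ, ℝ) ∞ fun x => Real.cos (f (η₀ x)))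
    (Φ : SmoothCompactSections (E := E) F S) (x : Z) :
    ‖massOperator L h m (smulSection hχ Φ) x‖ ^ 2 ≤ ‖massOperator L h m Φ x‖ ^ 2 +
      deriv f (η₀ x) ^ 2 * ‖symbolOfDifferential σ η₀ x (Φ.1 x)‖ ^ 2 := by
  have hfd : DifferentiableAt ℝ f (η₀ x) := hf.differentiable (by simp) _
  have h1 : symbolOfDifferential σ (fun y => Real.cos (f (η₀ y))) x (Φ.1 x)
      = ((-Real.sin (f (η₀ x)) : ℝ) : ℂ) •
        (((deriv f (η₀ x) : ℝ) : ℂ) • symbolOfDifferential σ η₀ x (Φ.1 x)) := by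
    have h2 := symbolOfDifferential_comp (σ := σ) (c := fun t => Real.cos (f t)) (x := x)
      hfd.cos (hη.mdifferentiableAt (by simp))
    rw [h2, (hfd.hasDerivAt.cos).deriv, mul_smul, smul_apply, smul_apply, ← Complex.coe_smul,
      ← Complex.coe_smul]
  rw [massOperator_smulSection hL, h1]
  refine (norm_add_sq_le_of_sq_add_sq ?_ _ _).trans_eq ?_
  · rw [neg_sq, Real.cos_sq_add_sin_sq]
  · rw [norm_smul, mul_pow, Complex.norm_real, Real.norm_eq_abs, sq_abs]

theorem IsLocalisationDatum.contMDiff_cos [MeasurableSpace Z] [BorelSpace Z]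
    [SecondCountableTopology Z] [FiniteDimensional ℂ F] [ContMDiffVectorBundle ∞ F S 𝓘(ℝ, E)]
    [IsSmoothHermitianBundle (E := E) F S] (hd : IsLocalisationDatum σ η₀ U₀ U₁ L h) {f : ℝ → ℝ}
    (hf : ContDiff ℝ ∞ f) : ContMDiff 𝓘(ℝ, E) 𝓘(ℝ, ℝ) ∞ fun x => Real.cos (f (η₀ x)) :=
  (Real.contDiff_cos.comp hf).contMDiff.comp hd.eta_smooth

variable [MeasurableSpace Z] [BorelSpace Z] [SecondCountableTopology Z] [FiniteDimensional ℂ F]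
  [ContMDiffVectorBundle ∞ F S 𝓘(ℝ, E)] [IsSmoothHermitianBundle (E := E) F S]

/-- The symbol of `dη₀` is bounded everywhere, as `dη₀` vanishes outside `U₀ ∩ U₁`. -/
theorem IsLocalisationDatum.exists_symbol_le (hd : IsLocalisationDatum σ η₀ U₀ U₁ L h) :
    ∃ B : ℝ, ∀ x, ‖symbolOfDifferential σ η₀ x‖ ≤ B := by
  obtain ⟨B, hB⟩ := hd.symbol_bounded
  refine ⟨max B 0, fun x => ?_⟩
  have hzero : mfderiv 𝓘(ℝ, E) 𝓘(ℝ, ℝ) η₀ x = 0 → ‖symbolOfDifferential σ η₀ x‖ ≤ max B 0 := by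
    intro h0
    unfold symbolOfDifferential
    rw [h0]
    exact ((congrArg norm (σ x).map_zero).trans norm_zero).le.trans (le_max_right _ _)
  by_cases h0 : x ∈ U₀
  · by_cases h1 : x ∈ U₁
    · exact (hB x ⟨h0, h1⟩).trans (le_max_left _ _)
    · refine hzero ?_
      have h2 : η₀ =ᶠ[𝓝 x] fun _ => 1 := by
        filter_upwards [notMem_tsupport_iff_eventuallyEq.1 fun h => h1 (hd.eta_support₁ h)] with y hy
        simp only [Pi.zero_apply] at hy
        linarith
      rw [h2.mfderiv_eq]
      exact mfderiv_const
  · refine hzero ?_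
    have h2 : η₀ =ᶠ[𝓝 x] fun _ => 0 :=
      notMem_tsupport_iff_eventuallyEq.1 fun h => h0 (hd.eta_support₀ h)
    rw [h2.mfderiv_eq]
    exact mfderiv_const

theorem IsLocalisationDatum.measurableSection_massOperator
    (hd : IsLocalisationDatum σ η₀ U₀ U₁ L h) (m : ℝ) (Φ : SmoothCompactSections (E := E) F S) :
    MeasurableSection E F S (massOperator L h m Φ) :=
  (L Φ).2.1.measurableSection.add ((hd.h_measurable Φ).smul (m : ℂ))

/-- Cutting off preserves the domain of the operator, by the bound on the symbol. -/
theorem IsLocalisationDatum.smulSection_mem (hd : IsLocalisationDatum σ η₀ U₀ U₁ L h) (m : ℝ)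
    {f : ℝ → ℝ} {D : ℝ} (hf : ContDiff ℝ ∞ f)
    (hD : ∀ x (v : S x), deriv f (η₀ x) ^ 2 * ‖symbolOfDifferential σ η₀ x v‖ ^ 2 ≤ D ^ 2 * ‖v‖ ^ 2)
    {Φ : SmoothCompactSections (E := E) F S} (hΦ : Φ ∈ operatorDomain (massOperator L h m)) :
    smulSection (hd.contMDiff_cos hf) Φ ∈ operatorDomain (massOperator L h m) := by
  constructor
  · refine mem_squareIntegrableSections_of_norm_le hΦ.1
      (smulSection (hd.contMDiff_cos hf) Φ).2.1.measurableSection (B := 1) fun x => ?_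
    change ‖(Real.cos (f (η₀ x)) : ℂ) • Φ.1 x‖ ≤ 1 * ‖Φ.1 x‖
    rw [norm_smul, Complex.norm_real]
    gcongr
    exact Real.abs_cos_le_one _
  · have hmeas := hd.measurableSection_massOperator m (smulSection (hd.contMDiff_cos hf) Φ)
    refine ⟨hmeas, (hΦ.2.2.add (hΦ.1.2.const_mul |D|)).mono hmeas.aestronglyMeasurable_norm
      (ae_of_all _ fun x => ?_)⟩
    rw [norm_norm]
    refine le_trans ?_ (le_abs_self _)
    refine le_of_sq_le_sq ?_ (by
      simp only [Pi.add_apply]; positivity)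
    refine (norm_massOperator_cos_sq_le hd.hasSymbol m hf hd.eta_smooth _ Φ x).trans ?_
    have h1 := hD x (Φ.1 x)
    rw [← sq_abs D] at h1
    simp only [Pi.add_apply]
    change _ ≤ (‖massOperator L h m Φ x‖ + |D| * ‖Φ.1 x‖) ^ 2
    nlinarith [mul_nonneg (norm_nonneg (massOperator L h m Φ x))
      (mul_nonneg (abs_nonneg D) (norm_nonneg (Φ.1 x)))]

/-- The bounds on the symbol of `dη₀` that control the two cut-off functions. The first one uses that
`cos (innerAngle η₀)` varies only where `cos (outerAngle η₀)` is `1`. -/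
structure CutoffBound (C : ℝ) (σ : SymbolField E S) (η₀ : Z → ℝ) : Prop where
  inner_le : ∀ x (v : S x), deriv innerAngle (η₀ x) ^ 2 * ‖symbolOfDifferential σ η₀ x v‖ ^ 2 ≤
    C ^ 2 * (Real.cos (outerAngle (η₀ x)) ^ 2 * ‖v‖ ^ 2)
  outer_le : ∀ x (v : S x), deriv outerAngle (η₀ x) ^ 2 * ‖symbolOfDifferential σ η₀ x v‖ ^ 2 ≤
    C ^ 2 * ‖v‖ ^ 2

variable (σ η₀) in
/-- The constant is chosen before the datum: it depends on `σ` and `η₀` only. -/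
theorem exists_cutoffBound : ∃ C₀ : ℝ, ∀ C, C₀ ≤ C → ∀ (U₀ U₁ : Set Z)
    (L : SmoothCompactSections (E := E) F S →ₗ[ℂ] SmoothCompactSections (E := E) F S)
    (h : ∀ x, Module.End ℂ (S x)), IsLocalisationDatum σ η₀ U₀ U₁ L h → CutoffBound C σ η₀ := by
  obtain ⟨D₁, hD₁⟩ := exists_deriv_le contDiff_innerAngle
  obtain ⟨D₂, hD₂⟩ := exists_deriv_le contDiff_outerAngle
  -- a bound on the symbol that does not depend on the datum
  obtain ⟨B, hB⟩ : ∃ B : ℝ, (∃ B₀ : ℝ, ∀ x, ‖symbolOfDifferential σ η₀ x‖ ≤ B₀) →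
      ∀ x, ‖symbolOfDifferential σ η₀ x‖ ≤ B := by
    by_cases hB : ∃ B₀ : ℝ, ∀ x, ‖symbolOfDifferential σ η₀ x‖ ≤ B₀
    · exact ⟨hB.choose, fun _ => hB.choose_spec⟩
    · exact ⟨0, fun h => absurd h hB⟩
  refine ⟨max |D₁| |D₂| * |B|, fun C hC U₀ U₁ L h hd => ?_⟩
  have hsymb : ∀ x (v : S x), ‖symbolOfDifferential σ η₀ x v‖ ^ 2 ≤ |B| ^ 2 * ‖v‖ ^ 2 := by
    intro x v
    rw [← mul_pow]
    refine pow_le_pow_left₀ (norm_nonneg _) (((symbolOfDifferential σ η₀ x).le_opNorm v).trans ?_) 2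
    gcongr
    exact (hB hd.exists_symbol_le x).trans (le_abs_self B)
  have hsq : (max |D₁| |D₂|) ^ 2 * |B| ^ 2 ≤ C ^ 2 := by
    rw [← mul_pow]
    exact pow_le_pow_left₀ (by positivity) hC 2
  constructor
  · intro x v
    have h1 := deriv_innerAngle_sq_le
      (((hD₁ _ (hd.eta_mem x)).trans (le_abs_self _)).trans (le_max_left _ |D₂|))
    calc deriv innerAngle (η₀ x) ^ 2 * ‖symbolOfDifferential σ η₀ x v‖ ^ 2
        ≤ ((max |D₁| |D₂|) ^ 2 * Real.cos (outerAngle (η₀ x)) ^ 2) * (|B| ^ 2 * ‖v‖ ^ 2) :=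
          mul_le_mul h1 (hsymb x v) (sq_nonneg _) (by positivity)
      _ = ((max |D₁| |D₂|) ^ 2 * |B| ^ 2) * (Real.cos (outerAngle (η₀ x)) ^ 2 * ‖v‖ ^ 2) := by ring
      _ ≤ _ := by gcongr
  · intro x v
    have h1 : deriv outerAngle (η₀ x) ^ 2 ≤ (max |D₁| |D₂|) ^ 2 := by
      rw [← sq_abs (deriv _ _)]
      exact pow_le_pow_left₀ (abs_nonneg _)
        (((hD₂ _ (hd.eta_mem x)).trans (le_abs_self _)).trans (le_max_right _ _)) 2
    calc deriv outerAngle (η₀ x) ^ 2 * ‖symbolOfDifferential σ η₀ x v‖ ^ 2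
        ≤ (max |D₁| |D₂|) ^ 2 * (|B| ^ 2 * ‖v‖ ^ 2) :=
          mul_le_mul h1 (hsymb x v) (sq_nonneg _) (by positivity)
      _ = ((max |D₁| |D₂|) ^ 2 * |B| ^ 2) * ‖v‖ ^ 2 := by ring
      _ ≤ _ := by gcongr

/-- The section `Φ`, cut off to `U₀`. -/
noncomputable def IsLocalisationDatum.innerCutoff (hd : IsLocalisationDatum σ η₀ U₀ U₁ L h) :
    SmoothCompactSections (E := E) F S →ₗ[ℂ] SmoothCompactSections (E := E) F S where
  toFun := smulSection (hd.contMDiff_cos contDiff_innerAngle)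
  map_add' _ _ := Subtype.ext (funext fun _ => smul_add _ _ _)
  map_smul' _ _ := Subtype.ext (funext fun _ => smul_comm _ _ _)

theorem IsLocalisationDatum.innerCutoff_apply (hd : IsLocalisationDatum σ η₀ U₀ U₁ L h)
    (Φ : SmoothCompactSections (E := E) F S) (x : Z) :
    (hd.innerCutoff Φ).1 x = (Real.cos (innerAngle (η₀ x)) : ℂ) • Φ.1 x := rfl

theorem IsLocalisationDatum.sectionSupport_innerCutoff (hd : IsLocalisationDatum σ η₀ U₀ U₁ L h)
    (Φ : SmoothCompactSections (E := E) F S) : sectionSupport (hd.innerCutoff Φ).1 ⊆ U₀ := by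
  refine (closure_mono fun x hx => ?_).trans hd.eta_support₀
  intro h0
  refine hx ?_
  rw [hd.innerCutoff_apply, h0, cos_innerAngle_zero, Complex.ofReal_zero, zero_smul]

theorem CutoffBound.innerCutoff_mem {C m : ℝ} (hC : CutoffBound C σ η₀)
    (hd : IsLocalisationDatum σ η₀ U₀ U₁ L h) {Φ : SmoothCompactSections (E := E) F S}
    (hΦ : Φ ∈ operatorDomain (massOperator L h m)) :
    hd.innerCutoff Φ ∈ operatorDomain (massOperator L h m) := by
  refine hd.smulSection_mem m (D := C) contDiff_innerAngle (fun x v => (hC.inner_le x v).trans ?_) hΦ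
  gcongr
  exact mul_le_of_le_one_left (sq_nonneg _) (Real.cos_sq_le_one _)

/-- The estimates for the cut-off to `U₀`. Where it loses something, the complementary cut-off `ρΦ`
is supported in `U₁`, and there the mass term dominates. -/
theorem CutoffBound.innerCutoff_estimates {C m : ℝ} (hC : CutoffBound C σ η₀)
    (hd : IsLocalisationDatum σ η₀ U₀ U₁ L h) {Φ : SmoothCompactSections (E := E) F S}
    (hΦ : Φ ∈ operatorDomain (massOperator L h m)) :
    m ^ 2 * ∫ x, ‖Φ.1 x‖ ^ 2 ∂(riemannianVolume E : Measure Z) ≤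
        m ^ 2 * ∫ x, ‖(hd.innerCutoff Φ).1 x‖ ^ 2 ∂(riemannianVolume E : Measure Z) +
        (∫ x, ‖massOperator L h m Φ x‖ ^ 2 ∂(riemannianVolume E : Measure Z) +
          C ^ 2 * ∫ x, ‖Φ.1 x‖ ^ 2 ∂(riemannianVolume E : Measure Z)) ∧
      m ^ 2 * ∫ x, ‖massOperator L h m (hd.innerCutoff Φ) x‖ ^ 2 ∂(riemannianVolume E : Measure Z) ≤
        m ^ 2 * ∫ x, ‖massOperator L h m Φ x‖ ^ 2 ∂(riemannianVolume E : Measure Z) +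
        C ^ 2 * (∫ x, ‖massOperator L h m Φ x‖ ^ 2 ∂(riemannianVolume E : Measure Z) +
          C ^ 2 * ∫ x, ‖Φ.1 x‖ ^ 2 ∂(riemannianVolume E : Measure Z)) := by
  set ρΦ := smulSection (hd.contMDiff_cos contDiff_outerAngle) Φ with hρ
  have hρapp : ∀ x, ρΦ.1 x = (Real.cos (outerAngle (η₀ x)) : ℂ) • Φ.1 x := fun _ => rfl
  have hρΦ : ρΦ ∈ operatorDomain (massOperator L h m) :=
    hd.smulSection_mem m (D := C) contDiff_outerAngle hC.outer_le hΦ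
  have hχΦ := hC.innerCutoff_mem hd hΦ
  have hsupp : sectionSupport ρΦ.1 ⊆ U₁ := by
    refine (closure_mono fun x hx => ?_).trans hd.eta_support₁
    intro h0
    refine hx ?_
    rw [hρapp, show η₀ x = 1 by linarith, cos_outerAngle_one, Complex.ofReal_zero, zero_smul]
  have hmass := hd.sq_mul_integral_le m hρΦ hsupp
  have i0 : Integrable (fun x => ‖Φ.1 x‖ ^ 2) (riemannianVolume E) :=
    integrable_norm_sq ⟨_, hΦ.1⟩
  have i1 : Integrable (fun x => ‖massOperator L h m Φ x‖ ^ 2) (riemannianVolume E) :=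
    integrable_norm_sq ⟨_, hΦ.2⟩
  have i2 : Integrable (fun x => ‖(hd.innerCutoff Φ).1 x‖ ^ 2) (riemannianVolume E) :=
    integrable_norm_sq ⟨_, hχΦ.1⟩
  have i3 : Integrable (fun x => ‖massOperator L h m (hd.innerCutoff Φ) x‖ ^ 2) (riemannianVolume E) :=
    integrable_norm_sq ⟨_, hχΦ.2⟩
  have i4 : Integrable (fun x => ‖ρΦ.1 x‖ ^ 2) (riemannianVolume E) :=
    integrable_norm_sq ⟨_, hρΦ.1⟩
  have i5 : Integrable (fun x => ‖massOperator L h m ρΦ x‖ ^ 2) (riemannianVolume E) :=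
    integrable_norm_sq ⟨_, hρΦ.2⟩
  have hnρ : ∀ x, ‖ρΦ.1 x‖ ^ 2 = Real.cos (outerAngle (η₀ x)) ^ 2 * ‖Φ.1 x‖ ^ 2 := fun x => by
    rw [hρapp, norm_smul, mul_pow, Complex.norm_real, Real.norm_eq_abs, sq_abs]
  have hnχ : ∀ x, ‖(hd.innerCutoff Φ).1 x‖ ^ 2 = Real.cos (innerAngle (η₀ x)) ^ 2 * ‖Φ.1 x‖ ^ 2 :=
    fun x => by rw [hd.innerCutoff_apply, norm_smul, mul_pow, Complex.norm_real, Real.norm_eq_abs,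
      sq_abs]
  have e1 : ∫ x, ‖Φ.1 x‖ ^ 2 ∂(riemannianVolume E : Measure Z) ≤
      ∫ x, ‖(hd.innerCutoff Φ).1 x‖ ^ 2 ∂(riemannianVolume E : Measure Z) +
        ∫ x, ‖ρΦ.1 x‖ ^ 2 ∂(riemannianVolume E : Measure Z) := by
    rw [← integral_add i2 i4]
    refine integral_mono i0 (i2.add i4) fun x => ?_
    simp only
    rw [hnρ, hnχ, ← add_mul]
    exact le_mul_of_one_le_left (sq_nonneg _) (one_le_cos_sq_add_cos_sq _)
  have e2 : ∫ x, ‖massOperator L h m ρΦ x‖ ^ 2 ∂(riemannianVolume E : Measure Z) ≤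
      ∫ x, ‖massOperator L h m Φ x‖ ^ 2 ∂(riemannianVolume E : Measure Z) +
        C ^ 2 * ∫ x, ‖Φ.1 x‖ ^ 2 ∂(riemannianVolume E : Measure Z) := by
    rw [← integral_const_mul, ← integral_add i1 (i0.const_mul _)]
    refine integral_mono i5 (i1.add (i0.const_mul _)) fun x => ?_
    exact (norm_massOperator_cos_sq_le hd.hasSymbol m contDiff_outerAngle hd.eta_smooth _ Φ x).trans
      (add_le_add_right (hC.outer_le x _) _)
  have e3 : ∫ x, ‖massOperator L h m (hd.innerCutoff Φ) x‖ ^ 2 ∂(riemannianVolume E : Measure Z) ≤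
      ∫ x, ‖massOperator L h m Φ x‖ ^ 2 ∂(riemannianVolume E : Measure Z) +
        C ^ 2 * ∫ x, ‖ρΦ.1 x‖ ^ 2 ∂(riemannianVolume E : Measure Z) := by
    rw [← integral_const_mul, ← integral_add i1 (i4.const_mul _)]
    refine integral_mono i3 (i1.add (i4.const_mul _)) fun x => ?_
    refine (norm_massOperator_cos_sq_le hd.hasSymbol m contDiff_innerAngle hd.eta_smooth
      (hd.contMDiff_cos contDiff_innerAngle) Φ x).trans ?_
    rw [hnρ]
    exact add_le_add_right (hC.inner_le x _) _
  constructor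
  · nlinarith [mul_le_mul_of_nonneg_left e1 (sq_nonneg m)]
  · nlinarith [mul_le_mul_of_nonneg_left e3 (sq_nonneg m),
      mul_le_mul_of_nonneg_left (hmass.trans e2) (sq_nonneg C)]

end CutoffSections

/-! ### Transport of sections by a bundle isometry -/

section Transport

variable {E : Type*} [NormedAddCommGroup E] [NormedSpace ℝ E]
  {Z : Type*} [EMetricSpace Z] [ChartedSpace E Z]
  [RiemannianBundle (fun x : Z => TangentSpace 𝓘(ℝ, E) x)]
  {F : Type*} [NormedAddCommGroup F] [NormedSpace ℂ F]
  {S : Z → Type*} [TopologicalSpace (TotalSpace F S)]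
  [∀ x, NormedAddCommGroup (S x)] [∀ x, InnerProductSpace ℂ (S x)] [FiberBundle F S]
  {E' : Type*} [NormedAddCommGroup E'] [NormedSpace ℝ E']
  {Z' : Type*} [EMetricSpace Z'] [ChartedSpace E' Z']
  [RiemannianBundle (fun x : Z' => TangentSpace 𝓘(ℝ, E') x)]
  {F' : Type*} [NormedAddCommGroup F'] [NormedSpace ℂ F']
  {S' : Z' → Type*} [TopologicalSpace (TotalSpace F' S')]
  [∀ x, NormedAddCommGroup (S' x)] [∀ x, InnerProductSpace ℂ (S' x)] [FiberBundle F' S']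
  {τ : OpenPartialHomeomorph Z Z'} {θ : ∀ x, S x →ₗ[ℂ] S' (τ x)} {U₀ : Set Z} {U₀' : Set Z'}

theorem IsBundleIsometry.mem_source (hθ : IsBundleIsometry E F E' F' τ θ U₀ U₀') {x : Z}
    (hx : x ∈ U₀) : x ∈ τ.source := by rwa [hθ.source_eq]

theorem IsBundleIsometry.mem_target (hθ : IsBundleIsometry E F E' F' τ θ U₀ U₀') {y : Z'}
    (hy : y ∈ U₀') : y ∈ τ.target := by rwa [hθ.target_eq]

theorem IsBundleIsometry.map_mem (hθ : IsBundleIsometry E F E' F' τ θ U₀ U₀') {x : Z}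
    (hx : x ∈ U₀) : τ x ∈ U₀' :=
  hθ.target_eq.subset (τ.map_source (hθ.mem_source hx))

theorem IsBundleIsometry.symm_mem (hθ : IsBundleIsometry E F E' F' τ θ U₀ U₀') {y : Z'}
    (hy : y ∈ U₀') : τ.symm y ∈ U₀ :=
  hθ.source_eq.subset (τ.map_target (hθ.mem_target hy))

theorem IsBundleIsometry.isOpen_source (hθ : IsBundleIsometry E F E' F' τ θ U₀ U₀') : IsOpen U₀ :=
  hθ.source_eq ▸ τ.open_source

theorem IsBundleIsometry.isOpen_target (hθ : IsBundleIsometry E F E' F' τ θ U₀ U₀') :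
    IsOpen U₀' :=
  hθ.target_eq ▸ τ.open_target

theorem IsBundleIsometry.injective (hθ : IsBundleIsometry E F E' F' τ θ U₀ U₀') {x : Z}
    (hx : x ∈ U₀) : Function.Injective (θ x) :=
  (injective_iff_map_eq_zero _).2 fun v hv => by
    rw [← norm_eq_zero, ← hθ.bundle_norm x hx, hv, norm_zero]

section Volume

variable [FiniteDimensional ℝ E] [FiniteDimensional ℝ E']
  [SecondCountableTopology Z] [MeasurableSpace Z] [BorelSpace Z] [IsRiemannianManifold 𝓘(ℝ, E) Z]
  [SecondCountableTopology Z'] [MeasurableSpace Z'] [BorelSpace Z'] [IsRiemannianManifold 𝓘(ℝ, E') Z']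

/-- A Riemannian isometry preserves the `L²` norms of functions, because it preserves the volume. -/
theorem IsBundleIsometry.eLpNorm_eq (hθ : IsBundleIsometry E F E' F' τ θ U₀ U₀') {f : Z → ℝ}
    {f' : Z' → ℝ} (hf' : AEStronglyMeasurable f' (riemannianVolume E' : Measure Z'))
    (h0 : ∀ x ∉ U₀, f x = 0) (h0' : ∀ y ∉ U₀', f' y = 0)
    (hff' : ∀ᵐ x ∂(riemannianVolume E : Measure Z), x ∈ U₀ → f' (τ x) = f x) :
    eLpNorm f' 2 (riemannianVolume E' : Measure Z') = eLpNorm f 2 (riemannianVolume E : Measure Z) ∧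
      ∫ y, f' y ^ 2 ∂(riemannianVolume E' : Measure Z') =
        ∫ x, f x ^ 2 ∂(riemannianVolume E : Measure Z) := by
  have hvol := map_riemannianVolume_restrict (τ := τ) (hθ.source_eq ▸ hθ.contMDiffOn)
    (hθ.target_eq ▸ hθ.contMDiffOn_symm) (fun x hx => hθ.norm_mfderiv x (hθ.source_eq ▸ hx))
  rw [hθ.source_eq, hθ.target_eq] at hvol
  have hτ : AEMeasurable τ ((riemannianVolume E : Measure Z).restrict U₀) :=
    hθ.contMDiffOn.continuousOn.aemeasurable hθ.isOpen_source.measurableSet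
  have hae : ∀ᵐ x ∂((riemannianVolume E : Measure Z).restrict U₀), f' (τ x) = f x :=
    (ae_restrict_iff' hθ.isOpen_source.measurableSet).2 hff'
  have hm : AEStronglyMeasurable f' (((riemannianVolume E : Measure Z).restrict U₀).map τ) := by
    rw [hvol]
    exact hf'.restrict
  constructor
  · rw [← eLpNorm_restrict_eq_of_support_subset (s := U₀) (f := f) fun x hx => by_contra fun h => hx (h0 x h),
      ← eLpNorm_restrict_eq_of_support_subset (s := U₀') (f := f') fun y hy => by_contra fun h => hy (h0' y h),
      ← hvol, eLpNorm_map_measure hm hτ]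
    exact eLpNorm_congr_ae hae
  · rw [← setIntegral_eq_integral_of_forall_compl_eq_zero (s := U₀) (f := fun x => f x ^ 2)
        (fun x hx => by simp [h0 x hx]),
      ← setIntegral_eq_integral_of_forall_compl_eq_zero (s := U₀') (f := fun y => f' y ^ 2)
        (fun y hy => by simp [h0' y hy]),
      ← hvol, integral_map (f := fun y => f' y ^ 2) hτ (hm.pow 2)]
    refine integral_congr_ae ?_
    filter_upwards [hae] with x hx
    rw [hx]

end Volume

variable [VectorBundle ℂ F S] [VectorBundle ℝ F S] [VectorBundle ℂ F' S'] [VectorBundle ℝ F' S']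

theorem sectionSupport_smul_subset (c : ℂ) (s : ∀ x, S x) :
    sectionSupport (c • s) ⊆ sectionSupport s :=
  closure_mono fun x hx hc => hx (by simp [hc])

variable (E F E' F' τ θ U₀ U₀') in
/-- The pairs of a section of `S` supported in `U₀` and a section of `S'` supported in `U₀'` that
correspond to each other under the bundle map `θ` over `τ`. -/
def correspondence :
    Submodule ℂ (SmoothCompactSections (E := E) F S × SmoothCompactSections (E := E') F' S') where
  carrier := {p | sectionSupport p.1.1 ⊆ U₀ ∧ sectionSupport p.2.1 ⊆ U₀' ∧
    ∀ x ∈ U₀, p.2.1 (τ x) = θ x (p.1.1 x)}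
  add_mem' := by
    rintro p q ⟨h1, h2, h3⟩ ⟨h4, h5, h6⟩
    refine ⟨(sectionSupport_add_subset _ _).trans (union_subset h1 h4),
      (sectionSupport_add_subset _ _).trans (union_subset h2 h5), fun x hx => ?_⟩
    change p.2.1 (τ x) + q.2.1 (τ x) = θ x (p.1.1 x + q.1.1 x)
    rw [h3 x hx, h6 x hx, map_add]
  zero_mem' := by
    refine ⟨?_, ?_, fun x _ => (map_zero (θ x)).symm⟩ <;> simp [sectionSupport]
  smul_mem' := by
    rintro c p ⟨h1, h2, h3⟩
    refine ⟨(sectionSupport_smul_subset _ _).trans h1, (sectionSupport_smul_subset _ _).trans h2,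
      fun x hx => ?_⟩
    change c • p.2.1 (τ x) = θ x (c • p.1.1 x)
    rw [h3 x hx, map_smul]

/-- Every section supported in `U₀` is transported to a section supported in `U₀'`. -/
theorem IsBundleIsometry.exists_correspondence_right
    (hθ : IsBundleIsometry E F E' F' τ θ U₀ U₀') (Φ : SmoothCompactSections (E := E) F S)
    (hΦ : sectionSupport Φ.1 ⊆ U₀) :
    ∃ Φ', (Φ, Φ') ∈ correspondence E F E' F' τ θ U₀ U₀' := by
  let g : Z → TotalSpace F' S' := fun x => TotalSpace.mk' F' (τ x) (θ x (Φ.1 x))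
  -- the fibres over `y` and over `τ (τ.symm y)` are compared in the total space, to avoid casts
  have hex : ∀ y, ∃ v : S' y, (y ∈ U₀' → TotalSpace.mk' F' y v = g (τ.symm y)) ∧
      (y ∉ U₀' → v = 0) := by
    intro y
    by_cases hy : y ∈ U₀'
    · have haux : ∀ z, z = y → ∀ w : S' z, ∃ v : S' y, TotalSpace.mk' F' y v = TotalSpace.mk' F' z w := by
        rintro _ rfl w
        exact ⟨w, rfl⟩
      obtain ⟨v, hv⟩ := haux _ (τ.right_inv (hθ.mem_target hy)) (θ (τ.symm y) (Φ.1 (τ.symm y)))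
      exact ⟨v, fun _ => hv, fun h => absurd hy h⟩
    · exact ⟨0, fun h => absurd h hy, fun _ => rfl⟩
  choose s hs hs0 using hex
  have hsτ : ∀ x ∈ U₀, s (τ x) = θ x (Φ.1 x) := by
    intro x hx
    have h1 := hs (τ x) (hθ.map_mem hx)
    rw [τ.left_inv (hθ.mem_source hx)] at h1
    exact TotalSpace.mk_inj.1 h1
  set K := τ '' sectionSupport Φ.1 with hKdef
  have hK : IsCompact K := Φ.2.2.image_of_continuousOn
    (τ.continuousOn.mono fun x hx => hθ.mem_source (hΦ hx))
  have hKU : K ⊆ U₀' := by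
    rintro _ ⟨x, hx, rfl⟩
    exact hθ.map_mem (hΦ hx)
  have h0 : ∀ y ∉ K, s y = 0 := by
    intro y hy
    by_cases hyU : y ∈ U₀'
    · obtain ⟨x, hx, rfl⟩ : ∃ x ∈ U₀, τ x = y :=
        ⟨τ.symm y, hθ.symm_mem hyU, τ.right_inv (hθ.mem_target hyU)⟩
      rw [hsτ x hx, eq_zero_of_notMem_sectionSupport fun h => hy ⟨x, h, rfl⟩, map_zero]
    · exact hs0 y hyU
  have hsmooth : SmoothSectionOn (E := E') F' S' s U₀' := by
    have h1 : ContMDiffOn 𝓘(ℝ, E') (𝓘(ℝ, E').prod 𝓘(ℝ, F')) ∞ (fun y => g (τ.symm y)) U₀' :=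
      hθ.bundle_contMDiffOn.comp
        (((Φ.2.1.mono (subset_univ U₀)).comp hθ.contMDiffOn_symm fun y hy => hθ.symm_mem hy))
        fun y hy => hθ.symm_mem hy
    exact h1.congr fun y hy => hs y hy
  obtain ⟨hsK, hsc⟩ := isCompact_sectionSupport_of_eq_zero hK h0
  exact ⟨⟨s, smoothSectionOn_univ_of_eq_zero hθ.isOpen_target hK.isClosed hKU hsmooth h0, hsc⟩,
    hΦ, hsK.trans hKU, hsτ⟩

/-- The inverse of a bundle isometry maps smooth sections to smooth sections: in local trivialisations,
it is the inverse of an operator-valued smooth function. -/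
theorem IsBundleIsometry.smoothSectionOn_of_comp [FiniteDimensional ℂ F] [FiniteDimensional ℂ F']
    [ContMDiffVectorBundle ∞ F S 𝓘(ℝ, E)] [ContMDiffVectorBundle ∞ F' S' 𝓘(ℝ, E')]
    (hθ : IsBundleIsometry E F E' F' τ θ U₀ U₀') {s : ∀ x, S x}
    {t : ∀ y, S' y} (ht : SmoothSectionOn (E := E') F' S' t univ)
    (hst : ∀ x ∈ U₀, t (τ x) = θ x (s x)) : SmoothSectionOn (E := E) F S s U₀ := by
  intro x₀ hx₀
  refine ContMDiffAt.contMDiffWithinAt ?_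
  rw [contMDiffAt_section]
  have := FiniteDimensional.complexToReal F
  have := FiniteDimensional.complexToReal F'
  have hfd : ∀ x, FiniteDimensional ℝ (S x) := fun x =>
    have := finiteDimensional_fiber F (S := S) x
    FiniteDimensional.complexToReal (S x)
  set e := trivializationAt F S x₀
  set e' := trivializationAt F' S' (τ x₀)
  have hτ : ContMDiffAt 𝓘(ℝ, E) 𝓘(ℝ, E') ∞ τ x₀ :=
    hθ.contMDiffOn.contMDiffAt (hθ.isOpen_source.mem_nhds hx₀)
  let b := Module.finBasis ℝ F
  let θL : ∀ x, S x →L[ℝ] S' (τ x) := fun x =>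
    LinearMap.toContinuousLinearMap ((θ x).restrictScalars ℝ)
  let M : Z → F →L[ℝ] F' := fun x =>
    (e'.continuousLinearMapAt ℝ (τ x)) ∘L (θL x) ∘L (e.symmL ℝ x)
  have hW : ∀ᶠ x in 𝓝 x₀, x ∈ U₀ ∧ x ∈ e.baseSet ∧ τ x ∈ e'.baseSet := by
    filter_upwards [hθ.isOpen_source.mem_nhds hx₀,
      e.open_baseSet.mem_nhds (mem_baseSet_trivializationAt F S x₀),
      hτ.continuousAt (e'.open_baseSet.mem_nhds (mem_baseSet_trivializationAt F' S' (τ x₀)))]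
      with x h1 h2 h3 using ⟨h1, h2, h3⟩
  have hMb : ∀ i, ContMDiffAt 𝓘(ℝ, E) 𝓘(ℝ, F') ∞ (fun x => M x (b i)) x₀ := by
    intro i
    have h1 : ContMDiffAt 𝓘(ℝ, E) (𝓘(ℝ, E).prod 𝓘(ℝ, F)) ∞
        (fun x => TotalSpace.mk' F x (e.localFrame b i x)) x₀ :=
      (e.contMDiffOn_localFrame_baseSet (I := 𝓘(ℝ, E)) (n := ∞) b i).contMDiffAt
        (e.open_baseSet.mem_nhds (mem_baseSet_trivializationAt F S x₀))
    have h2 : ContMDiffAt 𝓘(ℝ, E) (𝓘(ℝ, E').prod 𝓘(ℝ, F')) ∞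
        (fun x => TotalSpace.mk' F' (τ x) (θ x (e.localFrame b i x))) x₀ := by
      refine ContMDiffAt.comp (g := fun p : TotalSpace F S => TotalSpace.mk' F' (τ p.1) (θ p.1 p.2))
        x₀ (hθ.bundle_contMDiffOn.contMDiffAt ?_) h1
      exact (hθ.isOpen_source.preimage (FiberBundle.continuous_proj F S)).mem_nhds hx₀
    refine ((contMDiffAt_totalSpace.1 h2).2).congr_of_eventuallyEq ?_
    filter_upwards [hW] with x ⟨_, h3, h4⟩
    change e'.continuousLinearMapAt ℝ (τ x) (θ x (e.symmL ℝ x (b i))) = _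
    rw [e.localFrame_apply_of_mem_baseSet b h3, e'.continuousLinearMapAt_apply (R := ℝ),
      e'.coe_linearMapAt_of_mem (R := ℝ) h4, e.symmL_apply h3]
    rfl
  have hM : ContMDiffAt 𝓘(ℝ, E) 𝓘(ℝ, F →L[ℝ] F') ∞ M x₀ := by
    let Ψ : (Fin (Module.finrank ℝ F) → F') →ₗ[ℝ] F →L[ℝ] F' :=
      LinearMap.toContinuousLinearMap.toLinearMap ∘ₗ (b.constr ℝ).toLinearMap
    have h1 : ContMDiffAt 𝓘(ℝ, E) 𝓘(ℝ, F →L[ℝ] F') ∞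
        (fun x => LinearMap.toContinuousLinearMap Ψ fun i => M x (b i)) x₀ :=
      (LinearMap.toContinuousLinearMap Ψ).contDiff.contMDiff.contMDiffAt.comp x₀
        (contMDiffAt_pi_space.2 hMb)
    refine h1.congr_of_eventuallyEq (Filter.Eventually.of_forall fun x => ?_)
    ext v
    change M x v = b.constr ℝ (fun i => M x (b i)) v
    exact (LinearMap.congr_fun (b.constr_self ℝ (M x).toLinearMap) v).symm
  have hequiv : ∀ x, x ∈ U₀ ∧ x ∈ e.baseSet ∧ τ x ∈ e'.baseSet →
      ∃ N : F ≃L[ℝ] F', (N : F →L[ℝ] F') = M x := by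
    rintro x ⟨h1, h2, h3⟩
    let θE : S x ≃L[ℝ] S' (τ x) := (LinearEquiv.ofBijective ((θ x).restrictScalars ℝ)
      ⟨hθ.injective h1, hθ.bundle_surjective x h1⟩).toContinuousLinearEquiv
    refine ⟨((e.continuousLinearEquivAt ℝ x h2).symm.trans θE).trans
      (e'.continuousLinearEquivAt ℝ (τ x) h3), ?_⟩
    ext v
    change (e' ⟨τ x, θ x (e.symm x v)⟩).2 = e'.continuousLinearMapAt ℝ (τ x) (θ x (e.symmL ℝ x v))
    rw [e'.continuousLinearMapAt_apply (R := ℝ), e'.coe_linearMapAt_of_mem (R := ℝ) h3, e.symmL_apply h2]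
  have hinv : ContMDiffAt 𝓘(ℝ, E) 𝓘(ℝ, F' →L[ℝ] F) ∞
      (fun x => ContinuousLinearMap.inverse (M x)) x₀ := by
    obtain ⟨N, hN⟩ := hequiv x₀ hW.self_of_nhds
    have h1 : ContDiffAt ℝ ∞ ContinuousLinearMap.inverse (M x₀) := hN ▸ contDiffAt_map_inverse N
    exact h1.contMDiffAt.comp x₀ hM
  have ht' : ContMDiffAt 𝓘(ℝ, E) 𝓘(ℝ, F') ∞ (fun x => (e' ⟨τ x, t (τ x)⟩).2) x₀ := by
    have h1 : ContMDiffAt 𝓘(ℝ, E') (𝓘(ℝ, E').prod 𝓘(ℝ, F')) ∞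
        (fun y => TotalSpace.mk' F' y (t y)) (τ x₀) := ht.contMDiffAt Filter.univ_mem
    exact ((contMDiffAt_section _).1 h1).comp x₀ hτ
  refine (hinv.clm_apply ht').congr_of_eventuallyEq ?_
  filter_upwards [hW] with x hx
  obtain ⟨N, hN⟩ := hequiv x hx
  rw [← hN, ContinuousLinearMap.inverse_equiv]
  refine (N.symm_apply_eq.2 ?_).symm
  change _ = (N : F →L[ℝ] F') _
  rw [hN, hst x hx.1]
  change _ = e'.continuousLinearMapAt ℝ (τ x) (θ x (e.symmL ℝ x (e ⟨x, s x⟩).2))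
  rw [e'.continuousLinearMapAt_apply (R := ℝ), e'.coe_linearMapAt_of_mem (R := ℝ) hx.2.2]
  have h5 : e.symmL ℝ x (e ⟨x, s x⟩).2 = s x := by
    rw [e.symmL_apply hx.2.1]
    exact (e.continuousLinearEquivAt ℝ x hx.2.1).symm_apply_apply (s x)
  rw [h5]

/-- Every section supported in `U₀'` is the transport of a section supported in `U₀`. -/
theorem IsBundleIsometry.exists_correspondence_left [FiniteDimensional ℂ F] [FiniteDimensional ℂ F']
    [ContMDiffVectorBundle ∞ F S 𝓘(ℝ, E)] [ContMDiffVectorBundle ∞ F' S' 𝓘(ℝ, E')]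
    (hθ : IsBundleIsometry E F E' F' τ θ U₀ U₀') (Φ' : SmoothCompactSections (E := E') F' S')
    (hΦ' : sectionSupport Φ'.1 ⊆ U₀') :
    ∃ Φ, (Φ, Φ') ∈ correspondence E F E' F' τ θ U₀ U₀' := by
  have hex : ∀ x, ∃ v : S x, (x ∈ U₀ → Φ'.1 (τ x) = θ x v) ∧ (x ∉ U₀ → v = 0) := by
    intro x
    by_cases hx : x ∈ U₀
    · obtain ⟨v, hv⟩ := hθ.bundle_surjective x hx (Φ'.1 (τ x))
      exact ⟨v, fun _ => hv.symm, fun h => absurd hx h⟩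
    · exact ⟨0, fun h => absurd h hx, fun _ => rfl⟩
  choose s hs hs0 using hex
  set K := τ.symm '' sectionSupport Φ'.1 with hKdef
  have hK : IsCompact K := Φ'.2.2.image_of_continuousOn
    (τ.continuousOn_symm.mono fun y hy => hθ.mem_target (hΦ' hy))
  have hKU : K ⊆ U₀ := by
    rintro _ ⟨y, hy, rfl⟩
    exact hθ.symm_mem (hΦ' hy)
  have h0 : ∀ x ∉ K, s x = 0 := by
    intro x hx
    by_cases hxU : x ∈ U₀
    · refine hθ.injective hxU ?_
      rw [← hs x hxU, map_zero]
      exact eq_zero_of_notMem_sectionSupport fun h =>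
        hx ⟨τ x, h, τ.left_inv (hθ.mem_source hxU)⟩
    · exact hs0 x hxU
  obtain ⟨hsK, hsc⟩ := isCompact_sectionSupport_of_eq_zero hK h0
  exact ⟨⟨s, smoothSectionOn_univ_of_eq_zero hθ.isOpen_source hK.isClosed hKU
    (hθ.smoothSectionOn_of_comp Φ'.2.1 hs) h0, hsc⟩, hsK.trans hKU, hΦ', hs⟩

section Norms

variable [FiniteDimensional ℝ E] [FiniteDimensional ℝ E']
  [SecondCountableTopology Z] [MeasurableSpace Z] [BorelSpace Z] [IsManifold 𝓘(ℝ, E) ∞ Z]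
  [IsRiemannianManifold 𝓘(ℝ, E) Z]
  [SecondCountableTopology Z'] [MeasurableSpace Z'] [BorelSpace Z'] [IsManifold 𝓘(ℝ, E') ∞ Z']
  [IsRiemannianManifold 𝓘(ℝ, E') Z']

variable [FiniteDimensional ℂ F] [FiniteDimensional ℂ F']
  [ContMDiffVectorBundle ∞ F S 𝓘(ℝ, E)] [ContMDiffVectorBundle ∞ F' S' 𝓘(ℝ, E')]
  [IsSmoothHermitianBundle (E := E) F S] [IsSmoothHermitianBundle (E := E') F' S']
  {σ : SymbolField E S} {η₀ : Z → ℝ} {U₁ : Set Z}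
  {L : SmoothCompactSections (E := E) F S →ₗ[ℂ] SmoothCompactSections (E := E) F S}
  {h : ∀ x, Module.End ℂ (S x)}
  {σ' : SymbolField E' S'} {η₀' : Z' → ℝ} {U₁' : Set Z'}
  {L' : SmoothCompactSections (E := E') F' S' →ₗ[ℂ] SmoothCompactSections (E := E') F' S'}
  {h' : ∀ x, Module.End ℂ (S' x)} {m : ℝ}

/-- Corresponding sections have the same norms, and so have their images under the operators. -/
theorem IsBundleIsometry.norms_eq_of_mem_correspondence
    (hθ : IsBundleIsometry E F E' F' τ θ U₀ U₀') (hd : IsLocalisationDatum σ η₀ U₀ U₁ L h)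
    (hd' : IsLocalisationDatum σ' η₀' U₀' U₁' L' h')
    (hint : Intertwines τ θ U₀ U₀' (massOperator L h m) (massOperator L' h' m))
    {p : SmoothCompactSections (E := E) F S × SmoothCompactSections (E := E') F' S'}
    (hp : p ∈ correspondence E F E' F' τ θ U₀ U₀') :
    (p.1 ∈ operatorDomain (massOperator L h m) ↔ p.2 ∈ operatorDomain (massOperator L' h' m)) ∧
    ∫ y, ‖p.2.1 y‖ ^ 2 ∂(riemannianVolume E' : Measure Z') =
      ∫ x, ‖p.1.1 x‖ ^ 2 ∂(riemannianVolume E : Measure Z) ∧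
    ∫ y, ‖massOperator L' h' m p.2 y‖ ^ 2 ∂(riemannianVolume E' : Measure Z') =
      ∫ x, ‖massOperator L h m p.1 x‖ ^ 2 ∂(riemannianVolume E : Measure Z) := by
  obtain ⟨hp1, hp2, hp3⟩ := hp
  have hm1 := p.1.2.1.measurableSection
  have hm1' := p.2.2.1.measurableSection
  have hm2 := hd.measurableSection_massOperator m p.1
  have hm2' := hd'.measurableSection_massOperator m p.2
  obtain ⟨h1, h2⟩ := hθ.eLpNorm_eq (f := fun x => ‖p.1.1 x‖) (f' := fun y => ‖p.2.1 y‖)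
    hm1'.aestronglyMeasurable_norm
    (fun x hx => by rw [eq_zero_of_notMem_sectionSupport fun h => hx (hp1 h), norm_zero])
    (fun y hy => by rw [eq_zero_of_notMem_sectionSupport fun h => hy (hp2 h), norm_zero])
    (ae_of_all _ fun x hx => by rw [hp3 x hx, hθ.bundle_norm x hx])
  obtain ⟨h3, h4⟩ := hθ.eLpNorm_eq (f := fun x => ‖massOperator L h m p.1 x‖)
    (f' := fun y => ‖massOperator L' h' m p.2 y‖)
    hm2'.aestronglyMeasurable_norm
    (fun x hx => by rw [hd.massOperator_eq_zero fun h => hx (hp1 h), norm_zero])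
    (fun y hy => by rw [hd'.massOperator_eq_zero fun h => hy (hp2 h), norm_zero])
    (by
      filter_upwards [hint p.1 p.2 hp1 hp2 hp3] with x hx hxU
      rw [hx hxU, hθ.bundle_norm x hxU])
  refine ⟨⟨fun h => ⟨⟨hm1', hm1'.aestronglyMeasurable_norm, ?_⟩,
      ⟨hm2', hm2'.aestronglyMeasurable_norm, ?_⟩⟩,
    fun h => ⟨⟨hm1, hm1.aestronglyMeasurable_norm, ?_⟩,
      ⟨hm2, hm2.aestronglyMeasurable_norm, ?_⟩⟩⟩, h2, h4⟩
  · exact h1 ▸ h.1.2.2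
  · exact h3 ▸ h.2.2.2
  · exact h1 ▸ h.1.2.2
  · exact h3 ▸ h.2.2.2

end Norms

end Transport

/-! ### Comparison of the closed operators -/

section Extension

variable {H H' V : Type*} [NormedAddCommGroup H] [InnerProductSpace ℂ H]
  [NormedAddCommGroup H'] [InnerProductSpace ℂ H'] [CompleteSpace H']
  [AddCommGroup V] [Module ℂ V] {A : Submodule ℂ (H × H)} {A' : Submodule ℂ (H' × H')} {C m : ℝ}

/-- An almost isometry may be given on a dense subspace of the graph. -/
theorem exists_isAlmostIsometry_of_denseRange (hA' : IsClosed (A' : Set (H' × H'))) (hm : m ≠ 0)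
    (e : V →ₗ[ℂ] A) (f : V →ₗ[ℂ] A') (he : DenseRange e)
    (hle : ∀ v, ‖(f v).1.1‖ ^ 2 ≤ ‖(e v).1.1‖ ^ 2)
    (h1 : ∀ v, m ^ 2 * ‖(e v).1.1‖ ^ 2 ≤ m ^ 2 * ‖(f v).1.1‖ ^ 2 +
      (‖(e v).1.2‖ ^ 2 + C ^ 2 * ‖(e v).1.1‖ ^ 2))
    (h2 : ∀ v, m ^ 2 * ‖(f v).1.2‖ ^ 2 ≤ m ^ 2 * ‖(e v).1.2‖ ^ 2 +
      C ^ 2 * (‖(e v).1.2‖ ^ 2 + C ^ 2 * ‖(e v).1.1‖ ^ 2)) :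
    ∃ J : A →ₗ[ℂ] A', IsAlmostIsometry C m J := by
  have : CompleteSpace A' := hA'.completeSpace_coe
  have hm2 : 0 < m ^ 2 := by positivity
  -- `K` bounds the square of the operator norm of `f` with respect to the graph norms
  set K : ℝ := 1 + C ^ 2 * (1 + C ^ 2) / m ^ 2 with hK
  have hK1 : 1 ≤ K := by
    have : 0 ≤ C ^ 2 * (1 + C ^ 2) / m ^ 2 := by positivity
    linarith
  have hbound : ∀ v, ‖f v‖ ≤ √K * ‖e v‖ := by
    intro v
    have ha : ‖(e v).1.1‖ ≤ ‖e v‖ := norm_fst_le (e v).1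
    have hb : ‖(e v).1.2‖ ≤ ‖e v‖ := norm_snd_le (e v).1
    have ha2 : ‖(e v).1.1‖ ^ 2 ≤ ‖e v‖ ^ 2 := by gcongr
    have hb2 : ‖(e v).1.2‖ ^ 2 ≤ ‖e v‖ ^ 2 := by gcongr
    have hbd : ∀ t : ℝ, t ^ 2 ≤ K * ‖e v‖ ^ 2 → t ≤ √K * ‖e v‖ := by
      intro t ht
      refine le_of_sq_le_sq ?_ (by positivity)
      rwa [mul_pow, Real.sq_sqrt (by linarith)]
    refine norm_prod_le_iff.2 ⟨hbd _ ?_, hbd _ ?_⟩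
    · refine ((hle v).trans ha2).trans (le_mul_of_one_le_left (sq_nonneg _) hK1)
    · refine le_of_mul_le_mul_left ((h2 v).trans ?_) hm2
      calc m ^ 2 * ‖(e v).1.2‖ ^ 2 + C ^ 2 * (‖(e v).1.2‖ ^ 2 + C ^ 2 * ‖(e v).1.1‖ ^ 2)
          ≤ m ^ 2 * ‖e v‖ ^ 2 + C ^ 2 * (‖e v‖ ^ 2 + C ^ 2 * ‖e v‖ ^ 2) := by gcongr
        _ = m ^ 2 * (K * ‖e v‖ ^ 2) := by
          rw [hK]
          field_simp
  refine ⟨(f.extendOfNorm e).toLinearMap, fun p => ?_⟩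
  have hJ : ∀ v, f.extendOfNorm e (e v) = f v := LinearMap.extendOfNorm_eq he ⟨_, hbound⟩
  have hc1 : Continuous fun p : A => ‖p.1.1‖ ^ 2 := by fun_prop
  have hc2 : Continuous fun p : A => ‖p.1.2‖ ^ 2 := by fun_prop
  have hc3 : Continuous fun p : A => ‖(f.extendOfNorm e p).1.1‖ ^ 2 := by fun_prop
  have hc4 : Continuous fun p : A => ‖(f.extendOfNorm e p).1.2‖ ^ 2 := by fun_prop
  constructor
  · refine he.induction_on (p := fun p : A => m ^ 2 * ‖p.1.1‖ ^ 2 ≤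
      m ^ 2 * ‖(f.extendOfNorm e p).1.1‖ ^ 2 + (‖p.1.2‖ ^ 2 + C ^ 2 * ‖p.1.1‖ ^ 2)) p ?_ fun v => ?_
    · exact isClosed_le (by fun_prop) (by fun_prop)
    · rw [hJ]
      exact h1 v
  · refine he.induction_on (p := fun p : A => m ^ 2 * ‖(f.extendOfNorm e p).1.2‖ ^ 2 ≤
      m ^ 2 * ‖p.1.2‖ ^ 2 + C ^ 2 * (‖p.1.2‖ ^ 2 + C ^ 2 * ‖p.1.1‖ ^ 2)) p ?_ fun v => ?_
    · exact isClosed_le (by fun_prop) (by fun_prop)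
    · rw [hJ]
      exact h2 v

/-- An almost isometry from a relation, given by `q` and `q'`, between the domains of two operators
given by the maps `u ↦ (g u, k u)` and `u ↦ (g' u, k' u)`. -/
theorem exists_isAlmostIsometry_of_relation {D D' : Type*} [AddCommGroup D] [Module ℂ D]
    [AddCommGroup D'] [Module ℂ D'] (g k : D →ₗ[ℂ] H) (g' k' : D' →ₗ[ℂ] H') (q : V →ₗ[ℂ] D)
    (q' : V →ₗ[ℂ] D') (hq : Function.Surjective q) (hm : m ≠ 0)
    (hle : ∀ v, ‖g' (q' v)‖ ^ 2 ≤ ‖g (q v)‖ ^ 2)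
    (h1 : ∀ v, m ^ 2 * ‖g (q v)‖ ^ 2 ≤ m ^ 2 * ‖g' (q' v)‖ ^ 2 +
      (‖k (q v)‖ ^ 2 + C ^ 2 * ‖g (q v)‖ ^ 2))
    (h2 : ∀ v, m ^ 2 * ‖k' (q' v)‖ ^ 2 ≤ m ^ 2 * ‖k (q v)‖ ^ 2 +
      C ^ 2 * (‖k (q v)‖ ^ 2 + C ^ 2 * ‖g (q v)‖ ^ 2)) :
    ∃ J : (LinearMap.range (g.prod k)).topologicalClosure →ₗ[ℂ]
      (LinearMap.range (g'.prod k')).topologicalClosure, IsAlmostIsometry C m J := by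
  refine exists_isAlmostIsometry_of_denseRange (Submodule.isClosed_topologicalClosure _) hm
    ((g.prod k ∘ₗ q).codRestrict _ fun v => Submodule.le_topologicalClosure _ ⟨q v, rfl⟩)
    ((g'.prod k' ∘ₗ q').codRestrict _ fun v => Submodule.le_topologicalClosure _ ⟨q' v, rfl⟩)
    (fun p => closure_subtype.2 (closure_mono ?_
      (p.2 : p.1 ∈ closure (LinearMap.range (g.prod k) : Set (H × H))))) hle h1 h2
  rintro _ ⟨u, rfl⟩
  obtain ⟨v, rfl⟩ := hq u
  exact ⟨_, ⟨v, rfl⟩, rfl⟩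

end Extension

section Comparison

variable {E : Type*} [NormedAddCommGroup E] [NormedSpace ℝ E]
  {Z : Type*} [EMetricSpace Z] [SecondCountableTopology Z]
  [MeasurableSpace Z] [BorelSpace Z] [ChartedSpace E Z]
  {F : Type*} [NormedAddCommGroup F] [NormedSpace ℂ F] [FiniteDimensional ℂ F]
  {S : Z → Type*} [TopologicalSpace (TotalSpace F S)]
  [∀ x, NormedAddCommGroup (S x)] [∀ x, InnerProductSpace ℂ (S x)] [FiberBundle F S]
  [VectorBundle ℂ F S] [VectorBundle ℝ F S] [ContMDiffVectorBundle ∞ F S 𝓘(ℝ, E)]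
  [IsSmoothHermitianBundle (E := E) F S]
  {E' : Type*} [NormedAddCommGroup E'] [NormedSpace ℝ E']
  {Z' : Type*} [EMetricSpace Z'] [SecondCountableTopology Z']
  [MeasurableSpace Z'] [BorelSpace Z'] [ChartedSpace E' Z']
  {F' : Type*} [NormedAddCommGroup F'] [NormedSpace ℂ F'] [FiniteDimensional ℂ F']
  {S' : Z' → Type*} [TopologicalSpace (TotalSpace F' S')]
  [∀ x, NormedAddCommGroup (S' x)] [∀ x, InnerProductSpace ℂ (S' x)] [FiberBundle F' S']
  [VectorBundle ℂ F' S'] [VectorBundle ℝ F' S'] [ContMDiffVectorBundle ∞ F' S' 𝓘(ℝ, E')]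
  [IsSmoothHermitianBundle (E := E') F' S']
  {σ : SymbolField E S} {η₀ : Z → ℝ} {U₀ U₁ : Set Z}
  {L : SmoothCompactSections (E := E) F S →ₗ[ℂ] SmoothCompactSections (E := E) F S}
  {h : ∀ x, Module.End ℂ (S x)}
  {L' : SmoothCompactSections (E := E') F' S' →ₗ[ℂ] SmoothCompactSections (E := E') F' S'}
  {h' : ∀ x, Module.End ℂ (S' x)} {C m : ℝ}

theorem IsLocalisationDatum.integral_innerCutoff_le (hd : IsLocalisationDatum σ η₀ U₀ U₁ L h)
    {Φ : SmoothCompactSections (E := E) F S} (hΦ : Φ.1 ∈ squareIntegrableSections E F S)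
    (hχ : (hd.innerCutoff Φ).1 ∈ squareIntegrableSections E F S) :
    ∫ x, ‖(hd.innerCutoff Φ).1 x‖ ^ 2 ∂(riemannianVolume E : Measure Z) ≤
      ∫ x, ‖Φ.1 x‖ ^ 2 ∂(riemannianVolume E : Measure Z) := by
  refine integral_mono (integrable_norm_sq ⟨_, hχ⟩) (integrable_norm_sq ⟨_, hΦ⟩) fun x => ?_
  change ‖(hd.innerCutoff Φ).1 x‖ ^ 2 ≤ ‖Φ.1 x‖ ^ 2
  rw [hd.innerCutoff_apply, norm_smul, mul_pow, Complex.norm_real, Real.norm_eq_abs, sq_abs]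
  exact mul_le_of_le_one_left (sq_nonneg _) (Real.cos_sq_le_one _)

/-- A norm-preserving relation `R` that is defined on all sections supported in `U₀` gives an almost
isometry of the closed operators: cut off to `U₀`, then apply `R`. -/
theorem CutoffBound.exists_isAlmostIsometry (hC : CutoffBound C σ η₀)
    (hd : IsLocalisationDatum σ η₀ U₀ U₁ L h) (hm : m ≠ 0)
    (R : Submodule ℂ (SmoothCompactSections (E := E) F S × SmoothCompactSections (E := E') F' S'))
    (hex : ∀ Φ : SmoothCompactSections (E := E) F S, sectionSupport Φ.1 ⊆ U₀ → ∃ Φ', (Φ, Φ') ∈ R)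
    (hR : ∀ p ∈ R, p.1 ∈ operatorDomain (massOperator L h m) →
      p.2 ∈ operatorDomain (massOperator L' h' m) ∧
      ∫ y, ‖p.2.1 y‖ ^ 2 ∂(riemannianVolume E' : Measure Z') =
        ∫ x, ‖p.1.1 x‖ ^ 2 ∂(riemannianVolume E : Measure Z) ∧
      ∫ y, ‖massOperator L' h' m p.2 y‖ ^ 2 ∂(riemannianVolume E' : Measure Z') =
        ∫ x, ‖massOperator L h m p.1 x‖ ^ 2 ∂(riemannianVolume E : Measure Z)) :
    ∃ J : massClosure L h m →ₗ[ℂ] massClosure L' h' m, IsAlmostIsometry C m J := by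
  set D := operatorDomain (massOperator L h m) with hD
  set D' := operatorDomain (massOperator L' h' m) with hD'
  have k1 : ∀ Φ ∈ D, (SmoothCompactSections (E := E) F S).subtype Φ ∈
    squareIntegrableSections E F S := fun Φ hΦ => hΦ.1
  have k2 : ∀ Φ ∈ D, massOperator L h m Φ ∈ squareIntegrableSections E F S := fun Φ hΦ => hΦ.2
  have k1' : ∀ Φ ∈ D', (SmoothCompactSections (E := E') F' S').subtype Φ ∈
    squareIntegrableSections E' F' S' := fun Φ hΦ => hΦ.1
  have k2' : ∀ Φ ∈ D', massOperator L' h' m Φ ∈ squareIntegrableSections E' F' S' :=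
    fun Φ hΦ => hΦ.2
  -- the pairs of a section in the domain and a partner of its cut-off
  let V : Submodule ℂ (SmoothCompactSections (E := E) F S × SmoothCompactSections (E := E') F' S') :=
    D.comap (LinearMap.fst ℂ _ _) ⊓ R.comap (hd.innerCutoff.prodMap LinearMap.id)
  have hV : ∀ v : V, (hd.innerCutoff v.1.1, v.1.2) ∈ R := fun v => v.2.2
  have hχ : ∀ v : V, hd.innerCutoff v.1.1 ∈ D := fun v => hC.innerCutoff_mem hd v.2.1
  let q : V →ₗ[ℂ] D := (LinearMap.fst ℂ _ _ ∘ₗ V.subtype).codRestrict D fun v => v.2.1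
  let q' : V →ₗ[ℂ] D' := (LinearMap.snd ℂ _ _ ∘ₗ V.subtype).codRestrict D'
    fun v => (hR _ (hV v) (hχ v)).1
  have hq : Function.Surjective q := by
    intro Φ
    obtain ⟨Φ', hΦ'⟩ := hex (hd.innerCutoff Φ.1) (hd.sectionSupport_innerCutoff _)
    exact ⟨⟨(Φ.1, Φ'), Φ.2, hΦ'⟩, rfl⟩
  have key := @exists_isAlmostIsometry_of_relation (L2Space E F S) (L2Space E' F' S') V _ _ _ _ _
    _ _ C m D D' _ _ _ _ (sectionClass D _ k1) (sectionClass D _ k2) (sectionClass D' _ k1')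
    (sectionClass D' _ k2') q q' hq hm
  simp only [norm_sectionClass_sq] at key
  have hN := fun v => (hR _ (hV v) (hχ v)).2
  simp only at hN
  have hest := fun v : V => hC.innerCutoff_estimates hd (Φ := v.1.1) v.2.1
  have key2 := key (fun v => (hN v).1.trans_le (hd.integral_innerCutoff_le v.2.1.1 (hχ v).1))
    (fun v => by
      have := (hest v).1
      rw [← (hN v).1] at this
      exact this)
    (fun v => by
      have := (hest v).2
      rw [← (hN v).2] at this
      exact this)
  unfold massClosure
  rw [operatorGraph_eq_range hD.symm k1 k2, operatorGraph_eq_range hD'.symm k1' k2']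
  exact key2

end Comparison

/-! ### The comparison theorem -/

theorem mainTheorem3
    -- the complete Riemannian manifold `Z`
    {E : Type*} [NormedAddCommGroup E] [NormedSpace ℝ E] [FiniteDimensional ℝ E]
    {Z : Type*} [EMetricSpace Z] [CompleteSpace Z] [SecondCountableTopology Z]
    [MeasurableSpace Z] [BorelSpace Z] [ChartedSpace E Z] [IsManifold 𝓘(ℝ, E) ∞ Z]
    [RiemannianBundle (fun x : Z => TangentSpace 𝓘(ℝ, E) x)]
    [IsContMDiffRiemannianBundle 𝓘(ℝ, E) ∞ E (fun x : Z => TangentSpace 𝓘(ℝ, E) x)]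
    [IsRiemannianManifold 𝓘(ℝ, E) Z]
    -- the hermitian vector bundle `S` on `Z`
    {F : Type*} [NormedAddCommGroup F] [NormedSpace ℂ F] [FiniteDimensional ℂ F]
    {S : Z → Type*} [TopologicalSpace (TotalSpace F S)]
    [∀ x, NormedAddCommGroup (S x)] [∀ x, InnerProductSpace ℂ (S x)] [FiberBundle F S]
    [VectorBundle ℂ F S] [VectorBundle ℝ F S] [ContMDiffVectorBundle ∞ F S 𝓘(ℝ, E)]
    [IsSmoothHermitianBundle (E := E) F S]
    -- the complete Riemannian manifold `Z'`
    {E' : Type*} [NormedAddCommGroup E'] [NormedSpace ℝ E'] [FiniteDimensional ℝ E']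
    {Z' : Type*} [EMetricSpace Z'] [CompleteSpace Z'] [SecondCountableTopology Z']
    [MeasurableSpace Z'] [BorelSpace Z'] [ChartedSpace E' Z'] [IsManifold 𝓘(ℝ, E') ∞ Z']
    [RiemannianBundle (fun x : Z' => TangentSpace 𝓘(ℝ, E') x)]
    [IsContMDiffRiemannianBundle 𝓘(ℝ, E') ∞ E' (fun x : Z' => TangentSpace 𝓘(ℝ, E') x)]
    [IsRiemannianManifold 𝓘(ℝ, E') Z']
    -- the hermitian vector bundle `S'` on `Z'`
    {F' : Type*} [NormedAddCommGroup F'] [NormedSpace ℂ F'] [FiniteDimensional ℂ F']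
    {S' : Z' → Type*} [TopologicalSpace (TotalSpace F' S')]
    [∀ x, NormedAddCommGroup (S' x)] [∀ x, InnerProductSpace ℂ (S' x)] [FiberBundle F' S']
    [VectorBundle ℂ F' S'] [VectorBundle ℝ F' S'] [ContMDiffVectorBundle ∞ F' S' 𝓘(ℝ, E')]
    [IsSmoothHermitianBundle (E := E') F' S']
    -- the data on which the constant may depend
    (σ : SymbolField E S) (η₀ : Z → ℝ) (σ' : SymbolField E' S') (η₀' : Z' → ℝ) :
    ∃ C : ℝ, 0 < C ∧
      ∀ (U₀ U₁ : Set Z)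
        (L : SmoothCompactSections (E := E) F S →ₗ[ℂ] SmoothCompactSections (E := E) F S)
        (h : ∀ x, Module.End ℂ (S x))
        (U₀' U₁' : Set Z')
        (L' : SmoothCompactSections (E := E') F' S' →ₗ[ℂ] SmoothCompactSections (E := E') F' S')
        (h' : ∀ x, Module.End ℂ (S' x))
        (τ : OpenPartialHomeomorph Z Z') (θ : ∀ x, S x →ₗ[ℂ] S' (τ x)),
        IsLocalisationDatum σ η₀ U₀ U₁ L h →
        IsLocalisationDatum σ' η₀' U₀' U₁' L' h' →
        IsBundleIsometry E F E' F' τ θ U₀ U₀' →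
        ∀ Λ₂ Λ₁ Λ₀ m : ℝ, Λ₁ < Λ₂ → Λ₀ < Λ₁ → 0 ≤ Λ₀ → 0 < m →
          Intertwines τ θ U₀ U₀' (massOperator L h m) (massOperator L' h' m) →
          HasOnlyDiscreteSpectrum (massClosure L h m) Λ₀ →
          {t : ℝ | (t : ℂ) ∈ graphSpectrum (massClosure L h m)} ∩
            (Ico (-Λ₂) (-Λ₀) ∪ Ioc Λ₀ Λ₂) = ∅ →
          m ^ 2 > max (max
              ((C ^ 2 + Λ₂ ^ 2) * (C ^ 2 + Λ₁ ^ 2) / (Λ₂ ^ 2 - Λ₁ ^ 2))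
              ((C ^ 2 + Λ₁ ^ 2) * (C ^ 2 + Λ₀ ^ 2) / (Λ₁ ^ 2 - Λ₀ ^ 2)))
              (C ^ 2 + Λ₂ ^ 2) →
          HasOnlyDiscreteSpectrum (massClosure L' h' m) Λ₁ ∧
            eigenvalueCount (massClosure L' h' m) Λ₁ =
              eigenvalueCount (massClosure L h m) Λ₀ := by
  obtain ⟨C₀, hC₀⟩ := exists_cutoffBound (F := F) σ η₀
  obtain ⟨C₀', hC₀'⟩ := exists_cutoffBound (F := F') σ' η₀'
  -- the last entry of the maximum only serves to make the constant positive
  refine ⟨max (max C₀ C₀') 1, lt_max_of_lt_right one_pos, ?_⟩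
  intro U₀ U₁ L h U₀' U₁' L' h' τ θ hd hd' hθ Λ₂ Λ₁ Λ₀ m h12 h01 h0 hm hint hdisc hgap hmass
  set C := max (max C₀ C₀') 1 with hCdef
  have hC : CutoffBound C σ η₀ :=
    hC₀ C ((le_max_left _ _).trans (le_max_left _ _)) U₀ U₁ L h hd
  have hC' : CutoffBound C σ' η₀' :=
    hC₀' C ((le_max_right _ _).trans (le_max_left _ _)) U₀' U₁' L' h' hd'
  obtain ⟨J, hJ⟩ := hC.exists_isAlmostIsometry hd hm.ne' (correspondence E F E' F' τ θ U₀ U₀')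
    (L' := L') (h' := h') hθ.exists_correspondence_right fun p hp hp1 => by
      obtain ⟨h1, h2⟩ := hθ.norms_eq_of_mem_correspondence hd hd' hint hp
      exact ⟨h1.1 hp1, h2⟩
  -- the same relation, read in the other direction
  obtain ⟨J', hJ'⟩ := hC'.exists_isAlmostIsometry hd' hm.ne'
    ((correspondence E F E' F' τ θ U₀ U₀').comap (LinearEquiv.prodComm ℂ _ _).toLinearMap)
    (L' := L) (h' := h) hθ.exists_correspondence_left fun p hp hp1 => by
      obtain ⟨h1, h2, h3⟩ := hθ.norms_eq_of_mem_correspondence hd hd' hint hp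
      exact ⟨h1.2 hp1, h2.symm, h3.symm⟩
  obtain ⟨hmax, -⟩ := max_lt_iff.1 hmass
  obtain ⟨hm₁, hm₀⟩ := max_lt_iff.1 hmax
  rw [div_lt_iff₀ (by nlinarith)] at hm₁ hm₀
  have key := @eigenvalueCount_eq_of_isAlmostIsometry (L2Space E F S) _ _ (massClosure L h m)
    (L2Space E' F' S') _ _ (massClosure L' h' m) _ _ (hd.massClosure_eq_adjoint m)
    (hd'.massClosure_eq_adjoint m) C m J hJ J' hJ'
  exact key h0 h01 h12 hm₁ hm₀ hdisc hgap
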